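/- **Lemma.** Let $X=\{0,\dots,n-1\}$ be a finite ground set, split into $q$ disjoint (possibly empty) parts $X_1,\dots,X_q$ with capacities $c_1,\dots,c_q\in\mathbb{Z}_{\ge 0}$, and let $\mathcal M$ be the partition matroid in which $I\subseteq X$ is independent if and only if $|I\cap X_i|\le c_i$ for all $i$. Let $k$ be the rank of $\mathcal M$. Let $f:2^X\to\mathbb{R}_{\ge 0}$ be monotone ($f(S)\le f(T)$ for $S\subseteq T$) and submodular ($f(S\cup T)+f(S\cap T)\le f(S)+f(T)$), given by a value oracle. For every $c\in\mathbb{N}$ there is a randomized (Monte Carlo) polynomial-time algorithm that, given $(X_i)_i$, $(c_i)_i$, a real number $\gamma\ge 1$ and the value oracle for $f$, returns a set $S\subseteq X$ such that 1. in every run, the number of steps is at most $p(n+q)$, where $p$ is a polynomial that depends only on $c$; the set $S$ has full rank ($\operatorname{rank}_{\mathcal M}(S)=k$); and $|S|\le\gamma k$; 2. with probability at least $1-(n+1)^{-c}$ over the random bits of the algorithm, $$f(S)\ \ge\ \bigl(1-e^{-\gamma}\bigr)\, f(F^\star)\qquad\text{for every independent set } F^\star \text{ of } \mathcal M$$ (in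 particular $|F^\star|\le k$). The algorithm is one fixed program, independent of the instance, on a random access machine with fair coin flips in which natural numbers and real numbers (the oracle values and $\gamma$) can be added, subtracted and compared at unit cost, and an oracle query for a set costs $O(n)$ steps. -/

import Mathlib

open scoped ENNReal

/-- Submodularity of a set function. -/
def IsSubmodular {α : Type*} [DecidableEq α] (f : Finset α → ℝ) : Prop :=
  ∀ S T : Finset α, f (S ∪ T) + f (S ∩ T) ≤ f S + f T

/-- The partition matroid on `α` whose parts are the fibres of `part : α → ι`, where an independent
set contains at most `cap i` elements of the part `i`. -/
noncomputable def partitionMatroid {α ι : Type*} [Finite α] (part : α → ι) (cap : ι → ℕ) :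
    Matroid α :=
  (IndepMatroid.ofFinite (E := Set.univ) Set.finite_univ
    (fun I => ∀ i, (I ∩ part ⁻¹' {i}).ncard ≤ cap i)
    (by simp)
    (fun I J hJ hIJ i => (Set.ncard_le_ncard (Set.inter_subset_inter_left _ hIJ)
      (Set.toFinite _)).trans (hJ i))
    (by
      classical
      intro I J hI hJ hIJ
      have := Fintype.ofFinite α
      obtain ⟨i, hi⟩ : ∃ i, (I ∩ part ⁻¹' {i}).ncard < (J ∩ part ⁻¹' {i}).ncard := by
        by_contra! h
        have key : ∀ K : Set α,
            K.ncard = ∑ i ∈ Finset.univ.image part, (K ∩ part ⁻¹' {i}).ncard := by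
          intro K
          rw [Set.ncard_eq_toFinset_card',
            Finset.card_eq_sum_card_fiberwise (f := part) (t := Finset.univ.image part)
              (by intro x _; simp)]
          refine Finset.sum_congr rfl fun i _ => ?_
          rw [Set.ncard_eq_toFinset_card']
          congr 1
          ext x
          simp
        rw [key I, key J] at hIJ
        exact absurd hIJ (not_lt.mpr (Finset.sum_le_sum fun i _ => h i))
      obtain ⟨e, heJ, heI⟩ : ∃ e ∈ J ∩ part ⁻¹' {i}, e ∉ I ∩ part ⁻¹' {i} :=
        Set.exists_mem_notMem_of_ncard_lt_ncard hi (Set.toFinite _)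
      have hpe : part e = i := heJ.2
      refine ⟨e, heJ.1, fun h => heI ⟨h, heJ.2⟩, fun j => ?_⟩
      by_cases hj : j = i
      · subst hj
        have h1 : insert e I ∩ part ⁻¹' {j} = insert e (I ∩ part ⁻¹' {j}) :=
          Set.insert_inter_of_mem heJ.2
        rw [h1]
        exact (Set.ncard_insert_le _ _).trans (hi.trans_le (hJ j))
      · have h1 : insert e I ∩ part ⁻¹' {j} = I ∩ part ⁻¹' {j} :=
          Set.insert_inter_of_notMem (by
            simp only [Set.mem_preimage, Set.mem_singleton_iff, hpe]
            exact fun h => hj h.symm)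
        rw [h1]
        exact hI j)
    (fun _ _ => Set.subset_univ _)).matroid

/-- Sanity check of the definition: its independent sets are the expected ones. -/
theorem partitionMatroid_indep_iff {α ι : Type*} [Finite α] (part : α → ι) (cap : ι → ℕ)
    (I : Set α) :
    (partitionMatroid part cap).Indep I ↔ ∀ i, (I ∩ part ⁻¹' {i}).ncard ≤ cap i := by
  simp [partitionMatroid]

/-! ### Randomized random access machine with a value oracle

A program is a finite text in a structured language; the same text is run on inputs of all sizes.
The memory consists of arrays of natural numbers and arrays of real numbers.  The instructions have
unit cost (plus the size of the expressions written in them).  Natural numbers are only added,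
subtracted and compared, so after `t` steps they have bit length at most `t` plus that of the input.
Real numbers are only added, subtracted and compared, and there is no conversion of a real
number to a natural number, so all reals are integer combinations (with coefficients of bit length
at most `t`) of `1`, the real input, and answers of the oracle.  Hence unit cost is not abused.  Only
counting loops are provided: with them every polynomial-time computation can be
written, and every program terminates. -/

namespace OracleRAM

/-- Machine states: natural memory, real memory, and the number of steps made so far.
Cells are addressed by the index of an array and a position in that array. -/
structure State where
  mem : ℕ → ℕ → ℕ
  rmem : ℕ → ℕ → ℝ
  time : ℕ

/-- Expressions of natural type: constants, memory cells (with computed address), sum and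
truncated difference. -/
inductive NatExpr where
  | const (c : ℕ)
  | get (a b : NatExpr)
  | add (x y : NatExpr)
  | sub (x y : NatExpr)

namespace NatExpr

def eval (s : State) : NatExpr → ℕ
  | const c => c
  | get a b => s.mem (a.eval s) (b.eval s)
  | add x y => x.eval s + y.eval s
  | sub x y => x.eval s - y.eval s

def size : NatExpr → ℕ
  | const _ => 1
  | get a b => a.size + b.size + 1
  | add x y => x.size + y.size + 1
  | sub x y => x.size + y.size + 1

end NatExpr

/-- Expressions of real type: the number one, memory cells, sum and difference. -/
inductive RealExpr where
  | one
  | get (a b : NatExpr)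
  | add (x y : RealExpr)
  | sub (x y : RealExpr)

namespace RealExpr

def eval (s : State) : RealExpr → ℝ
  | one => 1
  | get a b => s.rmem (a.eval s) (b.eval s)
  | add x y => x.eval s + y.eval s
  | sub x y => x.eval s - y.eval s

def size : RealExpr → ℕ
  | one => 1
  | get a b => a.size + b.size + 1
  | add x y => x.size + y.size + 1
  | sub x y => x.size + y.size + 1

end RealExpr

/-- Tests: `x ≤ y` for naturals or for reals. -/
inductive Test where
  | natLe (x y : NatExpr)
  | realLe (x y : RealExpr)

namespace Test

def holds (s : State) : Test → Prop
  | natLe x y => x.eval s ≤ y.eval s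
  | realLe x y => x.eval s ≤ y.eval s

def size : Test → ℕ
  | natLe x y => x.size + y.size + 1
  | realLe x y => x.size + y.size + 1

end Test

/-- Programs. -/
inductive Prog where
  /-- do nothing -/
  | skip
  /-- assign `x` to the natural cell `(a, b)` -/
  | set (a b x : NatExpr)
  /-- assign `x` to the real cell `(a, b)` -/
  | rset (a b : NatExpr) (x : RealExpr)
  /-- assign a fair random bit to the natural cell `(a, b)` -/
  | flip (a b : NatExpr)
  /-- assign to the real cell `(a, b)` the oracle's value of the set whose indicator is the
  natural array `c` -/
  | query (a b c : NatExpr)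
  /-- sequential composition -/
  | seq (P Q : Prog)
  /-- conditional -/
  | ite (t : Test) (P Q : Prog)
  /-- evaluate `x` once and repeat `P` that many times -/
  | loop (x : NatExpr) (P : Prog)

namespace State

/-- Let `c` units of time elapse. -/
def tick (s : State) (c : ℕ) : State := { s with time := s.time + c }

def write (s : State) (a b v : ℕ) : State :=
  { s with mem := Function.update s.mem a (Function.update (s.mem a) b v) }

def rwrite (s : State) (a b : ℕ) (v : ℝ) : State :=
  { s with rmem := Function.update s.rmem a (Function.update (s.rmem a) b v) }

/-- The subset of `{0, …, n - 1}` whose indicator (nonzero means member) is stored in array `c`. -/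
def toFinset (n : ℕ) (s : State) (c : ℕ) : Finset (Fin n) :=
  Finset.univ.filter fun e => s.mem c e ≠ 0

end State

open Classical in
/-- The random final state of a program run from a given state, with value oracle `f`. A query
costs `n` extra steps, for reading the set. -/
noncomputable def Prog.exec {n : ℕ} (f : Finset (Fin n) → ℝ) : Prog → State → PMF State
  | .skip, s => PMF.pure (s.tick 1)
  | .set a b x, s =>
      PMF.pure ((s.write (a.eval s) (b.eval s) (x.eval s)).tick (a.size + b.size + x.size + 1))
  | .rset a b x, s =>
      PMF.pure ((s.rwrite (a.eval s) (b.eval s) (x.eval s)).tick (a.size + b.size + x.size + 1))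
  | .flip a b, s =>
      (PMF.uniformOfFintype (Fin 2)).map fun r : Fin 2 =>
        (s.write (a.eval s) (b.eval s) (r : ℕ)).tick (a.size + b.size + 1)
  | .query a b c, s =>
      PMF.pure ((s.rwrite (a.eval s) (b.eval s) (f (s.toFinset n (c.eval s)))).tick
        (a.size + b.size + c.size + n + 1))
  | .seq P Q, s => (P.exec f s).bind (Q.exec f)
  | .ite t P Q, s =>
      if t.holds s then P.exec f (s.tick (t.size + 1)) else Q.exec f (s.tick (t.size + 1))
  | .loop x P, s =>
      (fun d : PMF State => d.bind fun s' => P.exec f (s'.tick 1))^[x.eval s]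
        (PMF.pure (s.tick (x.size + 1)))

/-- The initial state.  Array `0` holds the number `n` of elements and the number `q` of
parts, array `1` the part of each element, array `2` the capacity of each part, and the first cell
of the real array `0` holds `γ`.  All other cells are zero. -/
def initState {n q : ℕ} (part : Fin n → Fin q) (cap : Fin q → ℕ) (γ : ℝ) : State where
  mem a b :=
    if a = 0 ∧ b = 0 then n
    else if a = 0 ∧ b = 1 then q
    else if a = 1 then (if h : b < n then (part ⟨b, h⟩ : ℕ) else 0)
    else if a = 2 then (if h : b < q then cap ⟨b, h⟩ else 0)
    else 0
  rmem a b := if a = 0 ∧ b = 0 then γ else 0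
  time := 0

/-- The set returned by a run: array `3` of the final state. -/
def output (n : ℕ) (s : State) : Finset (Fin n) := s.toFinset n 3

end OracleRAM

/-!
The algorithm is a variant of the tabular greedy algorithm (Streeter and Golovin) for monotone
submodular maximization over a partition matroid, followed by ordinary greedy steps that use up the
size `γ * k`.

*Tables.* Fix a base `B` of the matroid; its `k` elements are the slots. A table gives every slot
`C` elements of the part of the slot, one for each colour, and a colouring of the slots selects one
of them for each slot, hence an independent set. Tabular greedy fills the table colour by colour and
slot by slot, each time choosing the element that is best for the average of `f` over all
colourings. As the entry to be filled is still empty, the average gain is at least `1 / C` times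
the average of the marginal values of the partner of the slot in an optimal set `O`
(`Table.sum_marginal_le`, with partners from `PartSpanning.exists_matching`). Summing over the slots
shows that each round multiplies the distance to `f O` by at most `C / (C + 1)`, so that in the end
at most the fraction `(C / (C + 1)) ^ C`, about `1 / e`, of it is left (`GreedyRun.exists_table`,
`GreedyRun.sub_le`).

*Sampling.* The averages are estimated from `m` random colourings that are drawn once and for all at
the beginning. There are at most `2 ^ (n * C * n)` tables, so by Chernoff's bound and a union bound
over all tables the estimates are good simultaneously for every table that might ever occur
(`card_not_accurate_le`, `failure_bound`). Hence no independence between the steps is needed, the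
algorithm is a deterministic function of a uniform word of bits (`OracleRAM.exec_algorithm`), and
everything after the random draw is a statement about a fixed accurate sample. With `C` a power of
two, the colours are read off from the bits, and different words give different samples
(`colouring_injective`).

*Removing the error terms.* Finite `C` and `m` cost an additive error. It is absorbed by trying all
pairs of a slot `s₀` and an element `e` of its part, where `e` fills the slot `s₀` for all colours:
for the slot whose partner has the largest value, the distance to `f O` starts at
`(1 - 1 / k) * f O` instead of `f O`, and `1 - 1 / k` is smaller than `exp (-1 / k)` by a term of
order `1 / k ^ 2`, which exceeds the errors (`greedy_factor_le`). The best set found has distance at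
most `exp (-1 - 1 / k) * f O`. It is extended to a base, which yields full rank, and then by
`⌊γ * k⌋ - k` greedy steps, each of which multiplies the distance by at most `1 - 1 / k`
(`GreedyChain.sub_le`). Since `⌊γ * k⌋ + 1 ≥ γ * k`, the extra factor `exp (-1 / k)` from the guess
also makes up for rounding, and at most `exp (-γ) * f O` remains. If `γ * k ≥ n`, the whole ground
set is returned.

*Programs.* Apart from the random draw, the programs are verified by weakest preconditions (`WP`),
which also bound the running time by `Prog.cost N`, a polynomial in a common bound `N` for the
numbers of iterations. A natural or real variable is the cell `0` of an array. The natural arrays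
are used as follows: `0`, `1`, `2` hold the input, `3` the best set so far and finally the result,
`4` the random bits, `5` the slots, `6` the set to be queried, `10` the number of samples, `12` the
number of colours, `13` its binary logarithm, `14` the number of bits, `16` the position in the
bits, `20` and `21` the guessed element and its slot, `22` and `23` the current colour and slot,
`25` the current sample, `28` the chosen element, and `100 + j` the set built for sample `j` (cells
below `n`) together with the colours of the slots in it (cells from `n` on); the other ones are
auxiliary. The real variables are
`0` for `γ`, `1` for a sum over the samples, `2` for the answer of the oracle, `3` for the best
value in a search, `4` for the value of the best set so far, `5` for `γ * k`, `6` for the size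
bound reached, and `7` for `n`.
-/

/-! ### Reasoning about deterministic programs -/

namespace OracleRAM

/-- An upper bound for the running time of a program all of whose loops are repeated at most `N`
times and whose queries cost at most `N` extra steps. -/
def Prog.cost (N : ℕ) : Prog → ℕ
  | .skip => 1
  | .set a b x => a.size + b.size + x.size + 1
  | .rset a b x => a.size + b.size + x.size + 1
  | .flip a b => a.size + b.size + 1
  | .query a b c => a.size + b.size + c.size + N + 1
  | .seq P Q => P.cost N + Q.cost N
  | .ite t P Q => t.size + 1 + (P.cost N + Q.cost N)
  | .loop x P => x.size + 1 + N * (P.cost N + 1)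

theorem Prog.exists_polynomial_cost (P : Prog) :
    ∃ p : Polynomial ℕ, ∀ N, p.eval N = P.cost N := by
  induction P with
  | skip => exact ⟨1, by simp [cost]⟩
  | set a b x => exact ⟨Polynomial.C (a.size + b.size + x.size + 1), by simp [cost]⟩
  | rset a b x => exact ⟨Polynomial.C (a.size + b.size + x.size + 1), by simp [cost]⟩
  | flip a b => exact ⟨Polynomial.C (a.size + b.size + 1), by simp [cost]⟩
  | query a b c =>
    exact ⟨Polynomial.C (a.size + b.size + c.size) + Polynomial.X + 1, by simp [cost]⟩
  | seq P Q hP hQ =>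
    obtain ⟨p, hp⟩ := hP
    obtain ⟨q, hq⟩ := hQ
    exact ⟨p + q, by simp [cost, hp, hq]⟩
  | ite t P Q hP hQ =>
    obtain ⟨p, hp⟩ := hP
    obtain ⟨q, hq⟩ := hQ
    exact ⟨Polynomial.C (t.size + 1) + (p + q), by simp [cost, hp, hq]⟩
  | loop x P hP =>
    obtain ⟨p, hp⟩ := hP
    exact ⟨Polynomial.C (x.size + 1) + Polynomial.X * (p + 1), by simp [cost, hp]⟩

/-- A syntactic criterion for the address expression never to evaluate to `a`. -/
def NatExpr.avoids (a : ℕ) : NatExpr → Bool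
  | .const c => decide (c ≠ a)
  | .add _ (.const c) => decide (a < c)
  | _ => false

/-- A syntactic criterion for the address expression to evaluate to less than `100`. -/
def NatExpr.isLow : NatExpr → Bool
  | .const c => decide (c < 100)
  | _ => false

/-- A syntactic criterion for the program not to write to the natural array `a`. -/
def Prog.keeps (a : ℕ) : Prog → Bool
  | .set b _ _ => b.avoids a
  | .flip b _ => b.avoids a
  | .seq P Q => P.keeps a && Q.keeps a
  | .ite _ P Q => P.keeps a && Q.keeps a
  | .loop _ P => P.keeps a
  | _ => true

/-- A syntactic criterion for the program not to write to natural arrays with index at least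
`100`, where the samples are kept. -/
def Prog.keepsHigh : Prog → Bool
  | .set b _ _ => b.isLow
  | .flip b _ => b.isLow
  | .seq P Q => P.keepsHigh && Q.keepsHigh
  | .ite _ P Q => P.keepsHigh && Q.keepsHigh
  | .loop _ P => P.keepsHigh
  | _ => true

/-- A syntactic criterion for the program not to write to the real array `a`. -/
def Prog.rkeeps (a : ℕ) : Prog → Bool
  | .rset b _ _ => b.avoids a
  | .query b _ _ => b.avoids a
  | .seq P Q => P.rkeeps a && Q.rkeeps a
  | .ite _ P Q => P.rkeeps a && Q.rkeeps a
  | .loop _ P => P.rkeeps a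
  | _ => true

theorem NatExpr.eval_ne_of_avoids {a : ℕ} {x : NatExpr} (h : x.avoids a = true) (s : State) :
    a ≠ x.eval s := by
  unfold NatExpr.avoids at h
  split at h
  · simp only [decide_eq_true_eq] at h
    simpa [NatExpr.eval] using h.symm
  · simp only [decide_eq_true_eq] at h
    simp only [NatExpr.eval]
    omega
  · simp at h

theorem NatExpr.eval_lt_of_isLow {x : NatExpr} (h : x.isLow = true) (s : State) :
    x.eval s < 100 := by
  unfold NatExpr.isLow at h
  split at h
  · simpa [NatExpr.eval] using h
  · simp at h

namespace State

@[simp] theorem tick_mem (s : State) (c : ℕ) : (s.tick c).mem = s.mem := rfl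
@[simp] theorem tick_rmem (s : State) (c : ℕ) : (s.tick c).rmem = s.rmem := rfl
@[simp] theorem tick_time (s : State) (c : ℕ) : (s.tick c).time = s.time + c := rfl
@[simp] theorem tick_tick (s : State) (c d : ℕ) : (s.tick c).tick d = s.tick (c + d) := by
  simp [tick, Nat.add_assoc]
@[simp] theorem tick_write (s : State) (c a b v : ℕ) :
    (s.tick c).write a b v = (s.write a b v).tick c := rfl
@[simp] theorem write_rmem (s : State) (a b v : ℕ) : (s.write a b v).rmem = s.rmem := rfl
@[simp] theorem write_time (s : State) (a b v : ℕ) : (s.write a b v).time = s.time := rfl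
@[simp] theorem rwrite_mem (s : State) (a b : ℕ) (v : ℝ) : (s.rwrite a b v).mem = s.mem := rfl
@[simp] theorem rwrite_time (s : State) (a b : ℕ) (v : ℝ) : (s.rwrite a b v).time = s.time := rfl

@[simp] theorem write_mem_self (s : State) (a b v : ℕ) : (s.write a b v).mem a b = v := by
  simp [write]

@[simp] theorem write_mem_of_ne {s : State} {a a' b v : ℕ} (h : a' ≠ a) :
    (s.write a b v).mem a' = s.mem a' := by
  simp [write, h]

@[simp] theorem write_mem_of_ne_right {s : State} {a b b' v : ℕ} (h : b' ≠ b) :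
    (s.write a b v).mem a b' = s.mem a b' := by
  simp [write, h]

@[simp] theorem rwrite_rmem_self (s : State) (a b : ℕ) (v : ℝ) :
    (s.rwrite a b v).rmem a b = v := by
  simp [rwrite]

@[simp] theorem rwrite_rmem_of_ne {s : State} {a a' b : ℕ} {v : ℝ} (h : a' ≠ a) :
    (s.rwrite a b v).rmem a' = s.rmem a' := by
  simp [rwrite, h]

theorem toFinset_congr {n : ℕ} {s t : State} {a b : ℕ}
    (h : ∀ e : Fin n, s.mem a e = t.mem b e) : s.toFinset n a = t.toFinset n b := by
  simp [toFinset, h]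

theorem toFinset_congr_mem {n : ℕ} {s t : State} {a : ℕ} (h : s.mem a = t.mem a) :
    s.toFinset n a = t.toFinset n a :=
  toFinset_congr fun e => by rw [h]

theorem mem_toFinset {n : ℕ} {s : State} {a : ℕ} {e : Fin n} :
    e ∈ s.toFinset n a ↔ s.mem a e ≠ 0 := by
  simp [toFinset]

@[simp] theorem toFinset_tick {n : ℕ} (s : State) (a c : ℕ) :
    (s.tick c).toFinset n a = s.toFinset n a := rfl

@[simp] theorem toFinset_rwrite {n : ℕ} (s : State) (a b c : ℕ) (v : ℝ) :
    (s.rwrite b c v).toFinset n a = s.toFinset n a := rfl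

@[simp] theorem toFinset_write_of_ne {n : ℕ} {s : State} {a b c v : ℕ} (h : a ≠ b) :
    (s.write b c v).toFinset n a = s.toFinset n a :=
  toFinset_congr_mem (write_mem_of_ne h)

theorem toFinset_write_one {n : ℕ} (s : State) (a : ℕ) (x : Fin n) :
    (s.write a x 1).toFinset n a = insert x (s.toFinset n a) := by
  ext e
  by_cases h : e = x
  · subst h
    simp [mem_toFinset]
  · have : (e : ℕ) ≠ x := fun h' => h (Fin.ext h')
    simp [mem_toFinset, this, h]

end State

theorem NatExpr.eval_tick (x : NatExpr) (s : State) (c : ℕ) : x.eval (s.tick c) = x.eval s := by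
  induction x with
  | const => rfl
  | get a b ha hb => simp [NatExpr.eval, ha, hb]
  | add a b ha hb => simp [NatExpr.eval, ha, hb]
  | sub a b ha hb => simp [NatExpr.eval, ha, hb]

/-- What a run of the program from `s` to `s'` leaves unchanged for syntactic reasons. -/
structure Frame (P : Prog) (s s' : State) : Prop where
  mem : ∀ a, P.keeps a = true → s'.mem a = s.mem a
  high : P.keepsHigh = true → ∀ a, 100 ≤ a → s'.mem a = s.mem a
  rmem : ∀ a, P.rkeeps a = true → s'.rmem a = s.rmem a

/-- Iterated `bind` preserves every invariant of the support. -/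
theorem support_iterate_bind {I : State → Prop} {g : State → PMF State}
    (hg : ∀ u, I u → ∀ u' ∈ (g u).support, I u') (k : ℕ) (d : PMF State)
    (hd : ∀ u ∈ d.support, I u) :
    ∀ u ∈ ((fun d : PMF State => d.bind g)^[k] d).support, I u := by
  induction k with
  | zero => simpa using hd
  | succ k ih =>
    intro u hu
    rw [Function.iterate_succ_apply'] at hu
    obtain ⟨w, hw, hu⟩ := (PMF.mem_support_bind_iff _ _ _).1 hu
    exact hg w (ih w hw) u hu

theorem Prog.mem_eq_of_mem_support {n : ℕ} (f : Finset (Fin n) → ℝ) (A : ℕ → Prop)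
    (P : Prog)
    (hA : ∀ a, A a → P.keeps a = true ∨ (P.keepsHigh = true ∧ 100 ≤ a)) :
    ∀ s, ∀ s' ∈ (P.exec f s).support, ∀ a, A a → s'.mem a = s.mem a := by
  have key : ∀ (b : NatExpr) (s : State) (a : ℕ),
      (b.avoids a = true ∨ b.isLow = true ∧ 100 ≤ a) → a ≠ b.eval s := by
    rintro b s a (h | ⟨h, ha⟩)
    · exact b.eval_ne_of_avoids h s
    · have := b.eval_lt_of_isLow h s
      omega
  induction P with
  | skip => intro s s' hs'; simp [exec] at hs'; simp [hs']
  | set b _ x =>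
    intro s s' hs' a ha
    simp only [exec, PMF.support_pure, Set.mem_singleton_iff] at hs'
    have := key b s a (hA a ha)
    simp [hs', this]
  | rset b _ x => intro s s' hs'; simp [exec] at hs'; simp [hs']
  | flip b _ =>
    intro s s' hs' a ha
    simp only [exec, PMF.support_map, Set.mem_image] at hs'
    obtain ⟨r, -, rfl⟩ := hs'
    have := key b s a (hA a ha)
    simp [this]
  | query b _ x => intro s s' hs'; simp [exec] at hs'; simp [hs']
  | seq P Q hP hQ =>
    intro s s' hs' a ha
    simp only [keeps, keepsHigh, Bool.and_eq_true] at hA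
    rw [exec] at hs'
    obtain ⟨w, hw, hs'⟩ := (PMF.mem_support_bind_iff _ _ _).1 hs'
    rw [hQ (fun a ha => (hA a ha).imp And.right fun h => ⟨h.1.2, h.2⟩) w s' hs' a ha,
      hP (fun a ha => (hA a ha).imp And.left fun h => ⟨h.1.1, h.2⟩) s w hw a ha]
  | ite t P Q hP hQ =>
    intro s s' hs' a ha
    simp only [keeps, keepsHigh, Bool.and_eq_true] at hA
    rw [exec] at hs'
    split at hs'
    · exact hP (fun a ha => (hA a ha).imp And.left fun h => ⟨h.1.1, h.2⟩) _ s' hs' a ha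
    · exact hQ (fun a ha => (hA a ha).imp And.right fun h => ⟨h.1.2, h.2⟩) _ s' hs' a ha
  | loop x P hP =>
    intro s s' hs' a ha
    rw [exec] at hs'
    refine support_iterate_bind (I := fun u => u.mem a = s.mem a) ?_ _ _ ?_ s' hs'
    · intro u hu u' hu'
      rw [hP (fun a ha => hA a ha) _ u' hu' a ha]
      simpa using hu
    · intro u hu
      simp only [PMF.support_pure, Set.mem_singleton_iff] at hu
      simp [hu]

theorem Prog.rmem_eq_of_mem_support {n : ℕ} (f : Finset (Fin n) → ℝ) {a : ℕ} (P : Prog)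
    (h : P.rkeeps a = true) :
    ∀ s, ∀ s' ∈ (P.exec f s).support, s'.rmem a = s.rmem a := by
  induction P with
  | skip => intro s s' hs'; simp [exec] at hs'; simp [hs']
  | set b _ x => intro s s' hs'; simp [exec] at hs'; simp [hs']
  | rset b _ x =>
    intro s s' hs'
    simp only [exec, PMF.support_pure, Set.mem_singleton_iff] at hs'
    simp [hs', b.eval_ne_of_avoids h s]
  | flip b _ =>
    intro s s' hs'
    simp only [exec, PMF.support_map, Set.mem_image] at hs'
    obtain ⟨r, -, rfl⟩ := hs'
    simp
  | query b _ x =>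
    intro s s' hs'
    simp only [exec, PMF.support_pure, Set.mem_singleton_iff] at hs'
    simp [hs', b.eval_ne_of_avoids h s]
  | seq P Q hP hQ =>
    intro s s' hs'
    simp only [rkeeps, Bool.and_eq_true] at h
    rw [exec] at hs'
    obtain ⟨w, hw, hs'⟩ := (PMF.mem_support_bind_iff _ _ _).1 hs'
    rw [hQ h.2 w s' hs', hP h.1 s w hw]
  | ite t P Q hP hQ =>
    intro s s' hs'
    simp only [rkeeps, Bool.and_eq_true] at h
    rw [exec] at hs'
    split at hs'
    · exact hP h.1 (s.tick (t.size + 1)) s' hs'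
    · exact hQ h.2 (s.tick (t.size + 1)) s' hs'
  | loop x P hP =>
    intro s s' hs'
    rw [exec] at hs'
    refine support_iterate_bind (I := fun u => u.rmem a = s.rmem a) ?_ _ _ ?_ s' hs'
    · intro u hu u' hu'
      rw [hP h _ u' hu']
      simpa using hu
    · intro u hu
      simp only [PMF.support_pure, Set.mem_singleton_iff] at hu
      simp [hu]

theorem Frame.of_mem_support {n : ℕ} {f : Finset (Fin n) → ℝ} {P : Prog} {s s' : State}
    (h : s' ∈ (P.exec f s).support) : Frame P s s' where
  mem a ha := P.mem_eq_of_mem_support f (fun b => b = a) (by rintro b rfl; exact .inl ha) s s' h a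
    rfl
  high hP a ha := P.mem_eq_of_mem_support f (fun b => 100 ≤ b) (fun b hb => .inr ⟨hP, hb⟩) s s' h a
    ha
  rmem a ha := P.rmem_eq_of_mem_support f ha s s' h

/-- The program is deterministic from the state `s` on, it takes no more time than `Prog.cost N`
allows, and its final state satisfies `post`. -/
def WP {n : ℕ} (f : Finset (Fin n) → ℝ) (N : ℕ) (P : Prog) (post : State → Prop) (s : State) :
    Prop :=
  ∃ s', P.exec f s = PMF.pure s' ∧ s'.time ≤ s.time + P.cost N ∧ post s'

section rules

variable {n : ℕ} {f : Finset (Fin n) → ℝ} {N : ℕ} {P Q : Prog} {post : State → Prop} {s : State}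

/-- The rule of consequence, which also provides what the program leaves unchanged. -/
theorem WP.imp {post' : State → Prop} (h : WP f N P post s)
    (himp : ∀ s', Frame P s s' → post s' → post' s') : WP f N P post' s := by
  obtain ⟨s', h1, h2, h3⟩ := h
  exact ⟨s', h1, h2, himp s' (Frame.of_mem_support (f := f) (by simp [h1])) h3⟩

theorem WP.skip (h : post (s.tick 1)) : WP f N .skip post s :=
  ⟨_, rfl, by simp [Prog.cost], h⟩

theorem WP.set {a b x : NatExpr}
    (h : ∀ c, post ((s.write (a.eval s) (b.eval s) (x.eval s)).tick c)) :
    WP f N (.set a b x) post s :=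
  ⟨_, rfl, by simp [Prog.cost], h _⟩

theorem WP.rset {a b : NatExpr} {x : RealExpr}
    (h : ∀ c, post ((s.rwrite (a.eval s) (b.eval s) (x.eval s)).tick c)) :
    WP f N (.rset a b x) post s :=
  ⟨_, rfl, by simp [Prog.cost], h _⟩

theorem WP.query {a b c : NatExpr} (hN : n ≤ N)
    (h : ∀ d, post ((s.rwrite (a.eval s) (b.eval s) (f (s.toFinset n (c.eval s)))).tick d)) :
    WP f N (.query a b c) post s :=
  ⟨_, rfl, by simp [Prog.cost]; omega, h _⟩

theorem WP.seq (h : WP f N P (WP f N Q post) s) : WP f N (.seq P Q) post s := by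
  obtain ⟨s', h1, h2, s'', h3, h4, h5⟩ := h
  refine ⟨s'', ?_, ?_, h5⟩
  · rw [Prog.exec, h1, PMF.pure_bind, h3]
  · simp only [Prog.cost]
    omega

theorem WP.ite {t : Test} (h1 : t.holds s → ∀ c, WP f N P post (s.tick c))
    (h2 : ¬ t.holds s → ∀ c, WP f N Q post (s.tick c)) : WP f N (.ite t P Q) post s := by
  by_cases h : t.holds s
  · obtain ⟨s', h3, h4, h5⟩ := h1 h (t.size + 1)
    refine ⟨s', ?_, ?_, h5⟩
    · rw [Prog.exec, if_pos h, h3]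
    · simp only [Prog.cost]
      simp only [State.tick_time] at h4
      omega
  · obtain ⟨s', h3, h4, h5⟩ := h2 h (t.size + 1)
    refine ⟨s', ?_, ?_, h5⟩
    · rw [Prog.exec, if_neg h, h3]
    · simp only [Prog.cost]
      simp only [State.tick_time] at h4
      omega

/-- The invariant rule for loops. -/
theorem WP.loop {x : NatExpr} (I : ℕ → State → Prop) (hx : x.eval s ≤ N)
    (h0 : ∀ c, I 0 (s.tick c))
    (hstep : ∀ i < x.eval s, ∀ t, Frame (.loop x P) s t → I i t → WP f N P (I (i + 1)) (t.tick 1))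
    (hpost : ∀ t, I (x.eval s) t → post t) : WP f N (.loop x P) post s := by
  have key : ∀ i, i ≤ x.eval s → ∃ t,
      (fun d : PMF State => d.bind fun s' => P.exec f (s'.tick 1))^[i]
        (PMF.pure (s.tick (x.size + 1))) = PMF.pure t ∧
      t.time ≤ s.time + (x.size + 1 + i * (P.cost N + 1)) ∧ Frame (.loop x P) s t ∧ I i t := by
    intro i
    induction i with
    | zero =>
      intro _
      refine ⟨_, rfl, by simp, ⟨fun _ _ => rfl, fun _ _ _ => rfl, fun _ _ => rfl⟩, h0 _⟩
    | succ i ih =>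
      intro hi
      obtain ⟨t, h1, h2, h3, h4⟩ := ih (by omega)
      obtain ⟨u, h5, h6, h7⟩ := hstep i (by omega) t h3 h4
      have hF : Frame P (t.tick 1) u := Frame.of_mem_support (f := f) (by simp [h5])
      refine ⟨u, ?_, ?_, ⟨fun a ha => ?_, fun hP a ha => ?_, fun a ha => ?_⟩, h7⟩
      · rw [Function.iterate_succ_apply', h1, PMF.pure_bind, h5]
      · simp only [State.tick_time] at h6
        rw [Nat.succ_mul]
        omega
      · rw [hF.mem a ha, ← h3.mem a ha]
        rfl
      · rw [hF.high hP a ha, ← h3.high hP a ha]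
        rfl
      · rw [hF.rmem a ha, ← h3.rmem a ha]
        rfl
  obtain ⟨t, h1, h2, -, h4⟩ := key _ le_rfl
  refine ⟨t, h1, h2.trans ?_, hpost t h4⟩
  simp only [Prog.cost]
  gcongr

end rules

/-- The natural variable number `i`, which is kept in cell `(i, 0)`. -/
abbrev nvar (i : ℕ) : NatExpr := .get (.const i) (.const 0)

/-- Assignment to the natural variable number `i`. -/
abbrev assign (i : ℕ) (x : NatExpr) : Prog := .set (.const i) (.const 0) x

/-- The real variable number `i`, which is kept in cell `(i, 0)`. -/
abbrev rvar (i : ℕ) : RealExpr := .get (.const i) (.const 0)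

/-- Assignment to the real variable number `i`. -/
abbrev rassign (i : ℕ) (x : RealExpr) : Prog := .rset (.const i) (.const 0) x

/-- Run `P` with the natural variable `v` set to `0, 1, …, x - 1` in turn. -/
def forLoop (v : ℕ) (x : NatExpr) (P : Prog) : Prog :=
  .seq (assign v (.const 0)) (.loop x (.seq P (assign v (.add (nvar v) (.const 1)))))

/-- Run `P` if `x = y`. -/
def whenEq (x y : NatExpr) (P : Prog) : Prog :=
  .ite (.natLe x y) (.ite (.natLe y x) P .skip) .skip

section rules

variable {n : ℕ} {f : Finset (Fin n) → ℝ} {N : ℕ} {P : Prog} {post : State → Prop} {s : State}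

theorem WP.whenEq {x y : NatExpr} (h1 : x.eval s = y.eval s → ∀ c, WP f N P post (s.tick c))
    (h2 : x.eval s ≠ y.eval s → ∀ c, post (s.tick c)) :
    WP f N (whenEq x y P) post s := by
  refine WP.ite (fun h c => WP.ite (fun h' d => ?_) fun h' d => WP.skip ?_) fun h c => WP.skip ?_
  · simp only [Test.holds, NatExpr.eval_tick] at h h'
    simpa using h1 (le_antisymm h h') (c + d)
  · simp only [Test.holds, NatExpr.eval_tick] at h h'
    simpa [Nat.add_assoc] using h2 (fun h3 => h' h3.ge) (c + d + 1)
  · simp only [Test.holds] at h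
    simpa using h2 (fun h3 => h h3.le) (c + 1)

/-- The rule for counting loops: besides the invariant, the body may use that whatever the loop
does not write to is unchanged since the start of the loop. -/
theorem WP.forLoop {v : ℕ} {x : NatExpr} (k : ℕ) (I : ℕ → State → Prop)
    (hx : x.eval (s.write v 0 0) = k) (hk : k ≤ N) (hP : P.keeps v = true)
    (hI : ∀ i t u, I i t → (∀ a, a ≠ v → u.mem a = t.mem a) → u.rmem = t.rmem → I i u)
    (h0 : I 0 s)
    (hstep : ∀ i < k, ∀ t, Frame (forLoop v x P) s t → t.mem v 0 = i → I i t →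
      WP f N P (I (i + 1)) t)
    (hpost : ∀ t, Frame (OracleRAM.forLoop v x P) s t → I k t → post t) :
    WP f N (forLoop v x P) post s := by
  have main : WP f N (OracleRAM.forLoop v x P) (I k) s := by
    refine WP.seq (WP.set fun c => ?_)
    have hx' : x.eval ((s.write v 0 0).tick c) = k := by
      rw [NatExpr.eval_tick, hx]
    refine WP.loop (fun i t => t.mem v 0 = i ∧ I i t) ?_ ?_ ?_ ?_
    · simp only [NatExpr.eval]
      omega
    · intro d
      refine ⟨by simp [NatExpr.eval], hI 0 s _ h0 (fun a ha => ?_) rfl⟩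
      simp [NatExpr.eval, ha]
    · rintro i hi t hF ⟨ht, hIt⟩
      simp only [NatExpr.eval, hx'] at hi
      refine WP.seq ?_
      have hF' : Frame (OracleRAM.forLoop v x P) s (t.tick 1) := by
        refine ⟨fun a ha => ?_, fun h a ha => ?_, fun a ha => ?_⟩
        · simp only [OracleRAM.forLoop, Prog.keeps, Bool.and_eq_true] at ha
          have h1 := hF.mem a (by simp [Prog.keeps, ha])
          have h2 : a ≠ v := NatExpr.eval_ne_of_avoids ha.1 s
          simp only [State.tick_mem, h1]
          simp [NatExpr.eval, h2]
        · simp only [OracleRAM.forLoop, Prog.keepsHigh, Bool.and_eq_true] at h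
          have h1 := hF.high (by simp [Prog.keepsHigh, h]) a ha
          have h2 : v < 100 := NatExpr.eval_lt_of_isLow h.1 s
          have h3 : a ≠ v := by omega
          simp only [State.tick_mem, h1]
          simp [NatExpr.eval, h3]
        · simp only [OracleRAM.forLoop, Prog.rkeeps, Bool.and_eq_true] at ha
          have h1 := hF.rmem a (by simp [Prog.rkeeps, ha])
          simp only [State.tick_rmem, h1]
          simp
      refine (hstep i hi (t.tick 1) hF' (by simpa using ht)
        (hI i t _ hIt (fun _ _ => rfl) rfl)).imp ?_
      intro u hu hIu
      have hv : u.mem v 0 = i := by rw [hu.mem v hP]; simpa using ht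
      refine WP.set fun d => ⟨by simp [NatExpr.eval, hv], hI _ u _ hIu (fun a ha => ?_) rfl⟩
      simp [NatExpr.eval, ha]
    · rintro t ⟨-, h⟩
      simp only [NatExpr.eval, hx'] at h
      exact h
  exact main.imp hpost

end rules

attribute [simp] NatExpr.eval RealExpr.eval Test.holds

end OracleRAM

/-! ### Subroutines: copying a set, and extending an independent set to a base -/

theorem Fin.card_filter_lt_succ {n : ℕ} (p : Fin n → Prop) [DecidablePred p] {i : ℕ} (hi : i < n) :
    (Finset.univ.filter fun y : Fin n => (y : ℕ) < i + 1 ∧ p y).card =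
      (Finset.univ.filter fun y : Fin n => (y : ℕ) < i ∧ p y).card +
        if p ⟨i, hi⟩ then 1 else 0 := by
  split_ifs with h
  · rw [← Finset.card_insert_of_notMem (a := (⟨i, hi⟩ : Fin n)) (by simp)]
    congr 1
    ext y
    simp only [Finset.mem_filter, Finset.mem_univ, true_and, Finset.mem_insert, Fin.ext_iff]
    constructor
    · rintro ⟨h1, h2⟩
      rcases Nat.lt_succ_iff_lt_or_eq.1 h1 with h3 | h3
      · exact .inr ⟨h3, h2⟩
      · exact .inl h3
    · rintro (h1 | ⟨h1, h2⟩)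
      · have : y = ⟨i, hi⟩ := Fin.ext h1
        subst this
        exact ⟨by simp, h⟩
      · exact ⟨by omega, h2⟩
  · rw [add_zero]
    congr 1
    ext y
    simp only [Finset.mem_filter, Finset.mem_univ, true_and]
    refine ⟨fun ⟨h1, h2⟩ => ⟨?_, h2⟩, fun ⟨h1, h2⟩ => ⟨by omega, h2⟩⟩
    rcases Nat.lt_succ_iff_lt_or_eq.1 h1 with h3 | h3
    · exact h3
    · have : y = ⟨i, hi⟩ := Fin.ext h3
      subst this
      exact absurd h2 h

/-- The number of elements of `S` in the part `i`. -/
def partCount {n q : ℕ} (part : Fin n → Fin q) (S : Finset (Fin n)) (i : Fin q) : ℕ :=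
  (S.filter fun x => part x = i).card

theorem partCount_mono {n q : ℕ} (part : Fin n → Fin q) {S T : Finset (Fin n)} (h : S ⊆ T)
    (i : Fin q) : partCount part S i ≤ partCount part T i :=
  Finset.card_le_card (Finset.filter_subset_filter _ h)

/-- Independence in the partition matroid, for finsets. -/
def PartIndep {n q : ℕ} (part : Fin n → Fin q) (cap : Fin q → ℕ) (S : Finset (Fin n)) : Prop :=
  ∀ i, partCount part S i ≤ cap i

/-- `S` contains as many elements of every part as an independent set can have. -/
def PartSpanning {n q : ℕ} (part : Fin n → Fin q) (cap : Fin q → ℕ) (S : Finset (Fin n)) : Prop :=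
  ∀ x, x ∈ S ∨ cap (part x) ≤ partCount part S (part x)

theorem PartIndep.insert {n q : ℕ} {part : Fin n → Fin q} {cap : Fin q → ℕ} {S : Finset (Fin n)}
    (h : PartIndep part cap S) {x : Fin n} (hx : partCount part S (part x) < cap (part x)) :
    PartIndep part cap (insert x S) := by
  intro i
  unfold partCount
  rw [Finset.filter_insert]
  split_ifs with hi
  · subst hi
    exact (Finset.card_insert_le _ _).trans hx
  · exact h i

namespace OracleRAM

/-- The natural memory holds the input. -/
structure Env {n q : ℕ} (part : Fin n → Fin q) (cap : Fin q → ℕ) (s : State) : Prop where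
  size : s.mem 0 0 = n
  part : ∀ x : Fin n, s.mem 1 x = part x
  cap : ∀ i : Fin q, s.mem 2 i = cap i

theorem Env.congr {n q : ℕ} {part : Fin n → Fin q} {cap : Fin q → ℕ} {s t : State}
    (h : Env part cap s) (h0 : t.mem 0 = s.mem 0) (h1 : t.mem 1 = s.mem 1)
    (h2 : t.mem 2 = s.mem 2) : Env part cap t where
  size := by rw [h0, h.size]
  part x := by rw [h1, h.part]
  cap i := by rw [h2, h.cap]

theorem Env.frame {n q : ℕ} {part : Fin n → Fin q} {cap : Fin q → ℕ} {P : Prog} {s t : State}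
    (h : Env part cap s) (hF : Frame P s t) (h0 : P.keeps 0 = true) (h1 : P.keeps 1 = true)
    (h2 : P.keeps 2 = true) : Env part cap t :=
  h.congr (hF.mem 0 h0) (hF.mem 1 h1) (hF.mem 2 h2)

theorem Env.tick {n q : ℕ} {part : Fin n → Fin q} {cap : Fin q → ℕ} {s : State}
    (h : Env part cap s) (c : ℕ) : Env part cap (s.tick c) :=
  h.congr rfl rfl rfl

theorem Env.write {n q : ℕ} {part : Fin n → Fin q} {cap : Fin q → ℕ} {s : State}
    (h : Env part cap s) {a b v : ℕ} (ha : 2 < a) : Env part cap (s.write a b v) :=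
  h.congr (State.write_mem_of_ne (by omega)) (State.write_mem_of_ne (by omega))
    (State.write_mem_of_ne (by omega))

/-- Copy the set stored in the array `src` to the array `dst`. -/
def copySet (src : NatExpr) (dst : ℕ) : Prog :=
  forLoop 26 (nvar 0) (.set (.const dst) (nvar 26) (.get src (nvar 26)))

section

variable {n q : ℕ} {part : Fin n → Fin q} {cap : Fin q → ℕ} {f : Finset (Fin n) → ℝ} {N : ℕ}
  {post : State → Prop} {s : State}

/-- The array to be copied may depend on variable `25`, the number of the current sample. -/
theorem WP.copySet {src : NatExpr} {dst a : ℕ} (hn : s.mem 0 0 = n) (hN : n ≤ N)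
    (hdst : 2 < dst) (hdst' : dst < 10)
    (hsrc : ∀ t : State, t.mem 25 = s.mem 25 → src.eval t = a)
    (had : a ≠ dst) (ha : a ≠ 26)
    (hpost : ∀ t, Frame (copySet src dst) s t → t.toFinset n dst = s.toFinset n a → post t) :
    WP f N (copySet src dst) post s := by
  have hd26 : dst ≠ 26 := by omega
  refine WP.forLoop n (fun i t => t.mem a = s.mem a ∧ t.mem 25 = s.mem 25 ∧
    ∀ e < i, t.mem dst e = s.mem a e) ?_ hN ?_ ?_ ?_ ?_ ?_
  · simp [hn]
  · simp [Prog.keeps, NatExpr.avoids, hd26]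
  · rintro i t u ⟨h1, h2, h3⟩ h4 -
    exact ⟨by rw [h4 a ha, h1], by rw [h4 25 (by decide), h2],
      fun e he => by rw [h4 dst hd26, h3 e he]⟩
  · simp
  · rintro i hi t hF ht ⟨h1, h2, h3⟩
    refine WP.set fun c => ?_
    have hsrc' : src.eval t = a := hsrc t h2
    have hd25 : 25 ≠ dst := by omega
    simp only [NatExpr.eval, ht, hsrc', State.tick_mem]
    refine ⟨by rw [State.write_mem_of_ne had, h1], by rw [State.write_mem_of_ne hd25, h2], ?_⟩
    intro e he
    rcases Nat.lt_succ_iff_lt_or_eq.1 he with h | rfl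
    · rw [State.write_mem_of_ne_right h.ne, h3 e h]
    · rw [State.write_mem_self, h1]
  · rintro t hF ⟨-, -, h3⟩
    exact hpost t hF (State.toFinset_congr fun e => h3 e e.2)

/-- Go through the elements of the ground set in order and add to the set stored in the array `A`
each one whose part is not yet filled up. -/
def fill (A : ℕ) : Prog :=
  forLoop 24 (nvar 0)
    (.seq (assign 27 (.const 0))
    (.seq (forLoop 26 (nvar 0)
      (.ite (.natLe (.const 1) (.get (.const A) (nvar 26)))
        (whenEq (.get (.const 1) (nvar 26)) (.get (.const 1) (nvar 24))
          (assign 27 (.add (nvar 27) (.const 1)))) .skip))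
    (.ite (.natLe (.add (nvar 27) (.const 1)) (.get (.const 2) (.get (.const 1) (nvar 24))))
      (.set (.const A) (nvar 24) (.const 1)) .skip)))

theorem WP.fill {A : ℕ} {S : Finset (Fin n)} (hE : Env part cap s) (hN : n ≤ N) (hA : 2 < A)
    (hA' : A < 10) (hS : s.toFinset n A = S) (hI : PartIndep part cap S)
    (hpost : ∀ t, Frame (fill A) s t → ∀ B : Finset (Fin n), t.toFinset n A = B → S ⊆ B →
      PartIndep part cap B → PartSpanning part cap B → post t) :
    WP f N (fill A) post s := by
  refine WP.forLoop n (fun i t => ∃ B : Finset (Fin n), t.toFinset n A = B ∧ S ⊆ B ∧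
    PartIndep part cap B ∧
      ∀ x : Fin n, (x : ℕ) < i → x ∈ B ∨ cap (part x) ≤ partCount part B (part x)) ?_ hN ?_ ?_ ?_
      ?_ ?_
  · simp [hE.size]
  · simp [Prog.keeps, NatExpr.avoids, OracleRAM.forLoop, OracleRAM.whenEq]
    omega
  · rintro i t u ⟨B, h1, h2⟩ h3 -
    exact ⟨B, by rw [← h1]; exact State.toFinset_congr_mem (h3 A (by omega)), h2⟩
  · exact ⟨S, hS, subset_rfl, hI, by simp⟩
  · rintro i hi t hF ht ⟨B, h1, h2, h3, h4⟩
    have hEt : Env part cap t := by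
      refine hE.frame hF ?_ ?_ ?_ <;>
        simp [Prog.keeps, NatExpr.avoids, OracleRAM.forLoop, OracleRAM.whenEq] <;> omega
    refine WP.seq (WP.set fun c => ?_)
    refine WP.seq ?_
    set x : Fin n := ⟨i, hi⟩ with hx
    have hA24 : A ≠ 24 := by omega
    have hA26 : A ≠ 26 := by omega
    have hA27 : A ≠ 27 := by omega
    refine WP.forLoop n (fun l u => u.mem 27 0 =
        (Finset.univ.filter fun y : Fin n => (y : ℕ) < l ∧ y ∈ B ∧ part y = part x).card)
      ?_ hN ?_ ?_ ?_ ?_ ?_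
    · simp [hEt.size]
    · rfl
    · intro l u w h5 h6 _
      rw [h6 27 (by decide), h5]
    · simp
    · intro l hl u hFu hu h5
      have hEu : Env part cap u := by
        refine ((hEt.write (by simp)).tick _).frame hFu rfl rfl rfl
      have hu24 : u.mem 24 0 = i := by
        rw [hFu.mem 24 rfl]
        simp [ht]
      have hp1 := hEu.part ⟨l, hl⟩
      have hp2 := hEu.part x
      have hB : (⟨l, hl⟩ : Fin n) ∈ B ↔ u.mem A l ≠ 0 := by
        rw [← h1, State.mem_toFinset]
        rw [hFu.mem A (by
          simp [Prog.keeps, NatExpr.avoids, OracleRAM.forLoop, OracleRAM.whenEq]; omega)]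
        simp [hA27]
      have hcard := Fin.card_filter_lt_succ (fun y => y ∈ B ∧ part y = part x) hl
      simp only [hx] at hp1 hp2
      refine WP.ite (fun h c => ?_) (fun h c => ?_)
      · simp only [Test.holds, NatExpr.eval, hu] at h
        have hlB : (⟨l, hl⟩ : Fin n) ∈ B := hB.2 (by omega)
        refine WP.whenEq (fun h' d => ?_) (fun h' d => ?_)
        · simp only [NatExpr.eval, State.tick_mem, hu, hu24, hp1, hp2] at h'
          refine WP.set fun e => ?_
          rw [hcard, if_pos ⟨hlB, Fin.ext h'⟩]
          simp [h5]
        · simp only [NatExpr.eval, State.tick_mem, hu, hu24, hp1, hp2] at h'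
          rw [hcard, if_neg (fun h'' => h' (congrArg Fin.val h''.2))]
          simp [h5]
      · refine WP.skip ?_
        simp only [Test.holds, NatExpr.eval, hu] at h
        have hlB : (⟨l, hl⟩ : Fin n) ∉ B := fun h' => hB.1 h' (by omega)
        rw [hcard, if_neg (fun h'' => hlB h''.1)]
        simp [h5]
    · intro u hFu h5
      have hEu : Env part cap u := by
        refine ((hEt.write (by simp)).tick _).frame hFu rfl rfl rfl
      have hu24 : u.mem 24 0 = i := by
        rw [hFu.mem 24 rfl]
        simp [ht]
      have hp2 := hEu.part x
      have hc2 := hEu.cap (part x)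
      simp only [hx] at hp2 hc2
      have hBu : u.toFinset n A = B := by
        rw [← h1]
        refine State.toFinset_congr_mem ?_
        rw [hFu.mem A (by
          simp [Prog.keeps, NatExpr.avoids, OracleRAM.forLoop, OracleRAM.whenEq]; omega)]
        simp [hA27]
      have hcount : u.mem 27 0 = partCount part B (part x) := by
        rw [h5, partCount]
        congr 1
        ext y
        simp
      refine WP.ite (fun h c => ?_) (fun h c => ?_)
      · simp only [Test.holds, NatExpr.eval, hu24, hp2, hc2, hcount] at h
        refine WP.set fun d => ?_
        refine ⟨insert x B, ?_, h2.trans (Finset.subset_insert _ _), h3.insert h, ?_⟩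
        · have := State.toFinset_write_one u A x
          rw [hBu] at this
          simpa [hu24, hx] using this
        · intro y hy
          rcases Nat.lt_succ_iff_lt_or_eq.1 hy with h6 | h6
          · exact (h4 y h6).imp Finset.mem_insert_of_mem
              fun h7 => h7.trans (partCount_mono _ (Finset.subset_insert _ _) _)
          · have : y = x := Fin.ext h6
            simp [this]
      · simp only [Test.holds, NatExpr.eval, hu24, hp2, hc2, hcount] at h
        refine WP.skip ⟨B, by simpa using hBu, h2, h3, ?_⟩
        intro y hy
        rcases Nat.lt_succ_iff_lt_or_eq.1 hy with h6 | h6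
        · exact h4 y h6
        · have : y = x := Fin.ext h6
          have h7 : ¬ partCount part B (part x) + 1 ≤ cap (part x) := h
          right
          rw [this]
          omega
  · rintro t hF ⟨B, h1, h2, h3, h4⟩
    exact hpost t hF B h1 h2 h3 fun x => h4 x x.2

end

end OracleRAM

/-! ### The greedy rounds -/

/-- Add `x` to those of the sets `R j` whose sample gives the slot `s` the colour `c`. -/
def addAt {n : ℕ} (col : ℕ → Fin n → ℕ) (c : ℕ) (s x : Fin n) (R : ℕ → Finset (Fin n)) :
    ℕ → Finset (Fin n) :=
  fun j => if col j s = c then insert x (R j) else R j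

/-- `GreedyRun f part B m col s₀ e c i R` says that the sets `R 0, …, R (m - 1)` can arise in the
greedy procedure with guess `e` for the slot `s₀`, at the beginning of the step for colour `c` and
slot number `i`. The slots are the elements of `B`; an element of the part of the slot which is
best on average over the `m` samples is chosen in each step. -/
inductive GreedyRun {n q : ℕ} (f : Finset (Fin n) → ℝ) (part : Fin n → Fin q)
    (B : Finset (Fin n)) (m : ℕ) (col : ℕ → Fin n → ℕ) (s₀ e : Fin n) :
    ℕ → ℕ → (ℕ → Finset (Fin n)) → Prop
  | init : GreedyRun f part B m col s₀ e 0 0 fun _ => {e}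
  | skip {c : ℕ} {R : ℕ → Finset (Fin n)} (s : Fin n) (hs : s ∉ B ∨ s = s₀)
      (h : GreedyRun f part B m col s₀ e c s R) : GreedyRun f part B m col s₀ e c (s + 1) R
  | step {c : ℕ} {R : ℕ → Finset (Fin n)} (s : Fin n) (hs : s ∈ B) (hs₀ : s ≠ s₀) (x : Fin n)
      (hx : part x = part s)
      (hmax : ∀ y, part y = part s → ∑ j ∈ Finset.range m, f (addAt col c s y R j) ≤
        ∑ j ∈ Finset.range m, f (addAt col c s x R j))
      (h : GreedyRun f part B m col s₀ e c s R) :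
      GreedyRun f part B m col s₀ e c (s + 1) (addAt col c s x R)
  | next {c : ℕ} {R : ℕ → Finset (Fin n)} (h : GreedyRun f part B m col s₀ e c n R) :
      GreedyRun f part B m col s₀ e (c + 1) 0 R

namespace OracleRAM

/-- Run `P` unless `x = y`. -/
def whenNe (x y : NatExpr) (P : Prog) : Prog :=
  .ite (.natLe x y) (.ite (.natLe y x) .skip P) P

/-- The real number `0`. -/
abbrev rzero : RealExpr := .sub .one .one

/-- The index of the array that belongs to the current sample. Its cells from `n` on hold the
colours of the slots, the other ones the set that is being built. -/
abbrev sampleArr : NatExpr := .add (nvar 25) (.const 100)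

/-- The colour of the current slot in the current sample. -/
abbrev colourExpr : NatExpr := .get sampleArr (.add (nvar 0) (nvar 23))

/-- Find an element (variable `28`) of the part of the current slot (variable `23`) that is best
for the current colour (variable `22`). -/
def chooseElement : Prog :=
  .seq (assign 28 (.const 0))
  (.seq (rassign 3 rzero)
  (forLoop 24 (nvar 0) (whenEq (.get (.const 1) (nvar 24)) (.get (.const 1) (nvar 23))
    (.seq (rassign 1 rzero)
    (.seq (forLoop 25 (nvar 10)
      (.seq (copySet sampleArr 6)
      (.seq (whenEq colourExpr (nvar 22) (.set (.const 6) (nvar 24) (.const 1)))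
      (.seq (.query (.const 2) (.const 0) (.const 6))
      (rassign 1 (.add (rvar 1) (rvar 2)))))))
    (.ite (.realLe (rvar 3) (rvar 1))
      (.seq (assign 28 (nvar 24)) (rassign 3 (rvar 1))) .skip))))))

/-- Add the chosen element to the sets of those samples in which the current slot has the current
colour. -/
def addElement : Prog :=
  forLoop 25 (nvar 10)
    (whenEq colourExpr (nvar 22) (.set sampleArr (nvar 28) (.const 1)))

/-- Let all sets consist of the guessed element (variable `20`). -/
def resetSets : Prog :=
  forLoop 25 (nvar 10)
    (.seq (forLoop 26 (nvar 0) (.set sampleArr (nvar 26) (.const 0)))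
    (.set sampleArr (nvar 20) (.const 1)))

/-- The greedy procedure for the guess given by variables `20` (element) and `21` (slot). -/
def greedyRounds : Prog :=
  forLoop 22 (nvar 12) (forLoop 23 (nvar 0)
    (.ite (.natLe (.const 1) (.get (.const 5) (nvar 23)))
      (whenNe (nvar 23) (nvar 21) (.seq chooseElement addElement)) .skip))

/-- Keep the best of the current sets in array `3` if it improves on what is there. -/
def recordBest : Prog :=
  forLoop 25 (nvar 10)
    (.seq (.query (.const 2) (.const 0) sampleArr)
    (.ite (.realLe (rvar 4) (rvar 2))
      (.seq (rassign 4 (rvar 2)) (copySet sampleArr 3)) .skip))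

/-- Run the greedy procedure for all guesses. -/
def allGuesses : Prog :=
  forLoop 20 (nvar 0) (forLoop 21 (nvar 0)
    (.ite (.natLe (.const 1) (.get (.const 5) (nvar 21)))
      (whenEq (.get (.const 1) (nvar 20)) (.get (.const 1) (nvar 21))
        (.seq resetSets (.seq greedyRounds recordBest))) .skip))

/-- The memory holds the input, the number `m` of samples, the number `C` of colours, the colours
`col` of the samples, and the slots `B`. -/
structure Ctx {n q : ℕ} (part : Fin n → Fin q) (cap : Fin q → ℕ) (m C : ℕ)
    (col : ℕ → Fin n → ℕ) (B : Finset (Fin n)) (s : State) : Prop where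
  env : Env part cap s
  samples : s.mem 10 0 = m
  colours : s.mem 12 0 = C
  col : ∀ j < m, ∀ x : Fin n, s.mem (j + 100) (n + x) = col j x
  slots : s.toFinset n 5 = B

section

variable {n q : ℕ} {part : Fin n → Fin q} {cap : Fin q → ℕ} {f : Finset (Fin n) → ℝ} {N : ℕ}
  {post : State → Prop} {s : State} {m C : ℕ} {col : ℕ → Fin n → ℕ} {B : Finset (Fin n)}

theorem Ctx.congr {t : State} (h : Ctx part cap m C col B s) (h0 : t.mem 0 = s.mem 0)
    (h1 : t.mem 1 = s.mem 1) (h2 : t.mem 2 = s.mem 2) (h3 : t.mem 5 = s.mem 5)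
    (h4 : t.mem 10 = s.mem 10) (h5 : t.mem 12 = s.mem 12)
    (h6 : ∀ j < m, ∀ x : Fin n, t.mem (j + 100) (n + x) = s.mem (j + 100) (n + x)) :
    Ctx part cap m C col B t where
  env := h.env.congr h0 h1 h2
  samples := by rw [h4, h.samples]
  colours := by rw [h5, h.colours]
  col j hj x := by rw [h6 j hj, h.col j hj]
  slots := by rw [← h.slots]; exact State.toFinset_congr_mem h3

theorem Ctx.frame {P : Prog} {t : State} (h : Ctx part cap m C col B s) (hF : Frame P s t)
    (h' : (P.keepsHigh && P.keeps 0 && P.keeps 1 && P.keeps 2 && P.keeps 5 && P.keeps 10 &&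
      P.keeps 12) = true) : Ctx part cap m C col B t := by
  simp only [Bool.and_eq_true] at h'
  obtain ⟨⟨⟨⟨⟨⟨hh, h0⟩, h1⟩, h2⟩, h3⟩, h4⟩, h5⟩ := h'
  exact h.congr (hF.mem 0 h0) (hF.mem 1 h1) (hF.mem 2 h2) (hF.mem 5 h3) (hF.mem 10 h4)
    (hF.mem 12 h5) fun j _ x => by rw [hF.high hh _ (by omega)]

/-- Changing a variable with an index between `13` and `99` does not affect the context. -/
theorem Ctx.of_eq_off {v : ℕ} {t : State} (h : Ctx part cap m C col B s)
    (ht : ∀ a, a ≠ v → t.mem a = s.mem a) (hv : 12 < v) (hv' : v < 100) :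
    Ctx part cap m C col B t :=
  h.congr (ht _ (by omega)) (ht _ (by omega)) (ht _ (by omega)) (ht _ (by omega))
    (ht _ (by omega)) (ht _ (by omega)) fun j _ x => by rw [ht _ (by omega)]

theorem Ctx.tick (h : Ctx part cap m C col B s) (c : ℕ) : Ctx part cap m C col B (s.tick c) :=
  h.congr rfl rfl rfl rfl rfl rfl fun _ _ _ => rfl

theorem WP.whenNe {P : Prog} {x y : NatExpr}
    (h1 : x.eval s ≠ y.eval s → ∀ c, WP f N P post (s.tick c))
    (h2 : x.eval s = y.eval s → ∀ c, post (s.tick c)) :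
    WP f N (whenNe x y P) post s := by
  refine WP.ite (fun h c => WP.ite (fun h' d => WP.skip ?_) fun h' d => ?_) fun h c => ?_
  · simp only [Test.holds, NatExpr.eval_tick] at h h'
    simpa [Nat.add_assoc] using h2 (le_antisymm h h') (c + d + 1)
  · simp only [Test.holds, NatExpr.eval_tick] at h h'
    simpa using h1 (fun h3 => h' h3.ge) (c + d)
  · simp only [Test.holds] at h
    exact h1 (fun h3 => h h3.le) c

theorem WP.chooseElement {R : ℕ → Finset (Fin n)} {slot : Fin n} {c : ℕ}
    (hC : Ctx part cap m C col B s) (hN : n ≤ N) (hm : m ≤ N) (hf : ∀ S, 0 ≤ f S)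
    (hR : ∀ j < m, s.toFinset n (j + 100) = R j) (h22 : s.mem 22 0 = c)
    (h23 : s.mem 23 0 = slot)
    (hpost : ∀ t, Frame chooseElement s t → ∀ x : Fin n, t.mem 28 0 = x → part x = part slot →
      (∀ y, part y = part slot → ∑ j ∈ Finset.range m, f (addAt col c slot y R j) ≤
        ∑ j ∈ Finset.range m, f (addAt col c slot x R j)) → post t) :
    WP f N chooseElement post s := by
  set val : Fin n → ℝ := fun y => ∑ j ∈ Finset.range m, f (addAt col c slot y R j) with hval
  have hval0 : ∀ y, 0 ≤ val y := fun y => Finset.sum_nonneg fun j _ => hf _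
  have main : WP f N OracleRAM.chooseElement (fun t => ∃ x : Fin n, t.mem 28 0 = x ∧
      part x = part slot ∧ ∀ y, part y = part slot → val y ≤ val x) s := by
    refine WP.seq (WP.set fun c1 => WP.seq (WP.rset fun c2 => ?_))
    refine WP.forLoop n (fun i t => (∀ y : Fin n, (y : ℕ) < i → part y = part slot →
        val y ≤ t.rmem 3 0) ∧
        ((∃ x : Fin n, t.mem 28 0 = x ∧ part x = part slot ∧ t.rmem 3 0 = val x) ∨
        (t.rmem 3 0 = 0 ∧ ∀ y : Fin n, (y : ℕ) < i → part y ≠ part slot))) ?_ hN rfl ?_ ?_ ?_ ?_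
    · simp [hC.env.size]
    · rintro i t u ⟨h1, h2⟩ h3 h4
      simp only [h4, h3 28 (by decide)]
      exact ⟨h1, h2⟩
    · simp
    · rintro i hi t hF ht ⟨h1, h2⟩
      have hCt : Ctx part cap m C col B t := by
        refine Ctx.frame ?_ hF rfl
        exact (Ctx.of_eq_off hC (v := 28) (fun a ha => by simp [ha]) (by simp) (by simp))
      have ht22 : t.mem 22 0 = c := by rw [hF.mem 22 rfl]; simpa using h22
      have ht23 : t.mem 23 0 = slot := by rw [hF.mem 23 rfl]; simpa using h23
      have htR : ∀ j < m, t.toFinset n (j + 100) = R j := by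
        intro j hj
        rw [← hR j hj]
        refine State.toFinset_congr_mem ?_
        rw [hF.high rfl _ (by omega)]
        simp
      set x : Fin n := ⟨i, hi⟩ with hx
      have hp1 : t.mem 1 i = part x := hCt.env.part x
      have hp2 := hCt.env.part slot
      refine WP.whenEq (fun h d => ?_) (fun h d => ?_)
      · simp only [NatExpr.eval, ht, ht23, hp1, hp2] at h
        have hxs : part x = part slot := Fin.ext h
        refine WP.seq (WP.rset fun d1 => WP.seq ?_)
        refine WP.forLoop m (fun l u => u.rmem 3 0 = t.rmem 3 0 ∧
          u.rmem 1 0 = ∑ j ∈ Finset.range l, f (addAt col c slot x R j)) ?_ hm rfl ?_ ?_ ?_ ?_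
        · simp [hCt.samples]
        · intro l u w h5 h6 h7
          rw [h7]
          exact h5
        · simp
        · rintro l hl u hFu hu ⟨h5, h6⟩
          have hCu : Ctx part cap m C col B u := by
            refine Ctx.frame ?_ hFu rfl
            exact hCt.congr rfl rfl rfl rfl rfl rfl fun _ _ _ => rfl
          have hu22 : u.mem 22 0 = c := by rw [hFu.mem 22 rfl]; exact ht22
          have hu23 : u.mem 23 0 = slot := by rw [hFu.mem 23 rfl]; exact ht23
          have hu24 : u.mem 24 0 = i := by rw [hFu.mem 24 rfl]; exact ht
          have huR : u.toFinset n (l + 100) = R l := by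
            rw [← htR l hl]
            refine State.toFinset_congr_mem ?_
            rw [hFu.high rfl _ (by omega)]
            rfl
          refine WP.seq (WP.copySet (a := l + 100) hCu.env.size hN (by simp) (by simp)
            (fun w hw => by simp [hw, hu]) (by omega) (by omega) fun v hFv hv => ?_)
          have hCv : Ctx part cap m C col B v := hCu.frame hFv rfl
          have hv22 : v.mem 22 0 = c := by rw [hFv.mem 22 rfl, hu22]
          have hv23 : v.mem 23 0 = slot := by rw [hFv.mem 23 rfl, hu23]
          have hv24 : v.mem 24 0 = i := by rw [hFv.mem 24 rfl, hu24]
          have hv25 : v.mem 25 0 = l := by rw [hFv.mem 25 rfl, hu]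
          have hvr3 : v.rmem 3 0 = t.rmem 3 0 := by rw [hFv.rmem 3 rfl, h5]
          have hvr1 : v.rmem 1 0 = ∑ j ∈ Finset.range l, f (addAt col c slot x R j) := by
            rw [hFv.rmem 1 rfl, h6]
          rw [huR] at hv
          -- It remains to query the set of the current sample, as it is after a change.
          have fin : ∀ w : State, w.rmem = v.rmem → w.toFinset n 6 = addAt col c slot x R l →
              WP f N (.seq (.query (.const 2) (.const 0) (.const 6))
                (rassign 1 (.add (rvar 1) (rvar 2)))) (fun u => u.rmem 3 0 = t.rmem 3 0 ∧
                u.rmem 1 0 = ∑ j ∈ Finset.range (l + 1), f (addAt col c slot x R j)) w := by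
            intro w hw1 hw2
            refine WP.seq (WP.query hN fun d2 => WP.rset fun d3 => ?_)
            simp [hw1, hw2, hvr3, hvr1, Finset.sum_range_succ]
          refine WP.seq (WP.whenEq (fun h' d2 => WP.set fun d3 => ?_) fun h' d2 => ?_)
          · refine fin _ rfl ?_
            have hcol : col l slot = c := by
              simpa [hv25, hv22, hv23, hCv.env.size, hCv.col l hl slot] using h'
            have := State.toFinset_write_one v 6 x
            simpa [hcol, addAt, hv24, hv] using this
          · refine fin _ rfl ?_
            have hcol : col l slot ≠ c := by
              simpa [hv25, hv22, hv23, hCv.env.size, hCv.col l hl slot] using h'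
            simp [hcol, addAt, hv]
        · rintro u hFu ⟨h5, h6⟩
          have hu24 : u.mem 24 0 = i := by rw [hFu.mem 24 rfl]; exact ht
          refine WP.ite (fun h' d2 => ?_) fun h' d2 => ?_
          · refine WP.seq (WP.set fun d3 => WP.rset fun d4 => ?_)
            simp only [Test.holds, RealExpr.eval, NatExpr.eval, h5, h6] at h'
            refine ⟨fun y hy hys => ?_, .inl ⟨x, ?_, hxs, ?_⟩⟩
            · simp only [NatExpr.eval, State.tick_rmem, State.rwrite_rmem_self, RealExpr.eval,
                State.write_rmem, h6]
              rcases Nat.lt_succ_iff_lt_or_eq.1 hy with h7 | h7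
              · exact (h1 y h7 hys).trans h'
              · have : y = x := Fin.ext h7
                rw [this]
            · simp [hu24, hx]
            · simp [h6, hval]
          · refine WP.skip ?_
            simp only [Test.holds, RealExpr.eval, NatExpr.eval, h5, h6, not_le] at h'
            have hu28 : u.mem 28 0 = t.mem 28 0 := by rw [hFu.mem 28 rfl]; rfl
            rcases h2 with ⟨x', h7, h8, h9⟩ | ⟨h7, h8⟩
            · refine ⟨fun y hy hys => ?_, .inl ⟨x', by simp [hu28, h7], h8, by simp [h5, h9]⟩⟩
              simp only [State.tick_rmem, h5]
              rcases Nat.lt_succ_iff_lt_or_eq.1 hy with h10 | h10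
              · exact h1 y h10 hys
              · have : y = x := Fin.ext h10
                rw [this]
                exact h'.le
            · exact absurd (h7 ▸ h') (not_lt.2 (hval0 x))
      · simp only [NatExpr.eval, ht, ht23, hp1, hp2] at h
        have hxs : part x ≠ part slot := fun h' => h (congrArg Fin.val h')
        have hne : ∀ y : Fin n, (y : ℕ) < i + 1 → part y = part slot → (y : ℕ) < i := by
          intro y hy hys
          rcases Nat.lt_succ_iff_lt_or_eq.1 hy with h10 | h10
          · exact h10
          · have : y = x := Fin.ext h10
            exact absurd (this ▸ hys) hxs
        exact ⟨fun y hy hys => h1 y (hne y hy hys) hys, h2.imp id fun h3 =>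
          ⟨h3.1, fun y hy hys => h3.2 y (hne y hy hys) hys⟩⟩
    · rintro t - ⟨h1, h2⟩
      rcases h2 with ⟨x, h3, h4, h5⟩ | ⟨-, h2⟩
      · exact ⟨x, h3, h4, fun y hy => h5 ▸ h1 y y.2 hy⟩
      · exact absurd rfl (h2 slot slot.2)
  exact main.imp fun t hF ⟨x, h1, h2, h3⟩ => hpost t hF x h1 h2 h3

end

end OracleRAM

namespace OracleRAM

section

variable {n q : ℕ} {part : Fin n → Fin q} {cap : Fin q → ℕ} {f : Finset (Fin n) → ℝ} {N : ℕ}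
  {post : State → Prop} {s : State} {m C : ℕ} {col : ℕ → Fin n → ℕ} {B : Finset (Fin n)}

theorem WP.addElement {R : ℕ → Finset (Fin n)} {slot x : Fin n} {c : ℕ}
    (hC : Ctx part cap m C col B s) (hm : m ≤ N)
    (hR : ∀ j < m, s.toFinset n (j + 100) = R j) (h22 : s.mem 22 0 = c)
    (h23 : s.mem 23 0 = slot) (h28 : s.mem 28 0 = x)
    (hpost : ∀ t, Frame addElement s t → Ctx part cap m C col B t →
      (∀ j < m, t.toFinset n (j + 100) = addAt col c slot x R j) → post t) :
    WP f N addElement post s := by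
  refine WP.forLoop m (fun i t => Ctx part cap m C col B t ∧
    (∀ j < i, t.toFinset n (j + 100) = addAt col c slot x R j) ∧
    ∀ j, i ≤ j → j < m → t.toFinset n (j + 100) = R j) ?_ hm rfl ?_ ?_ ?_ ?_
  · simp [hC.samples]
  · rintro i t u ⟨h1, h2, h3⟩ h4 -
    refine ⟨h1.of_eq_off h4 (by simp) (by simp), fun j hj => ?_, fun j hj hj' => ?_⟩
    · rw [← h2 j hj]
      exact State.toFinset_congr_mem (h4 _ (by omega))
    · rw [← h3 j hj hj']
      exact State.toFinset_congr_mem (h4 _ (by omega))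
  · exact ⟨hC, by simp, fun j _ hj => hR j hj⟩
  · rintro i hi t hF ht ⟨h1, h2, h3⟩
    have ht22 : t.mem 22 0 = c := by rw [hF.mem 22 rfl, h22]
    have ht23 : t.mem 23 0 = slot := by rw [hF.mem 23 rfl, h23]
    have ht28 : t.mem 28 0 = x := by rw [hF.mem 28 rfl, h28]
    refine WP.whenEq (fun h d => WP.set fun d' => ?_) fun h d => ?_
    · have hcol : col i slot = c := by
        simpa [ht, ht22, ht23, h1.env.size, h1.col i hi slot] using h
      simp only [NatExpr.eval, State.tick_mem, ht, ht28, State.tick_write, State.tick_tick]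
      refine ⟨h1.congr ?_ ?_ ?_ ?_ ?_ ?_ fun j hj y => ?_, fun j hj => ?_, fun j hj hj' => ?_⟩
      iterate 6 exact (congrFun (State.tick_mem _ _) _).trans (State.write_mem_of_ne (by omega))
      · by_cases hji : j + 100 = i + 100
        · rw [hji, State.tick_mem, State.write_mem_of_ne_right (by omega)]
        · rw [State.tick_mem, State.write_mem_of_ne hji]
      · rcases Nat.lt_succ_iff_lt_or_eq.1 hj with h4 | rfl
        · rw [State.toFinset_tick, State.toFinset_write_of_ne (by omega), h2 j h4]
        · rw [State.toFinset_tick, State.toFinset_write_one, h3 _ le_rfl hi]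
          simp [addAt, hcol]
      · rw [State.toFinset_tick, State.toFinset_write_of_ne (by omega), h3 j (by omega) hj']
    · have hcol : col i slot ≠ c := by
        simpa [ht, ht22, ht23, h1.env.size, h1.col i hi slot] using h
      refine ⟨h1.tick d, fun j hj => ?_, fun j hj hj' => ?_⟩
      · rcases Nat.lt_succ_iff_lt_or_eq.1 hj with h4 | rfl
        · exact h2 j h4
        · rw [State.toFinset_tick, h3 _ le_rfl hi]
          simp [addAt, hcol]
      · exact h3 j (by omega) hj'
  · rintro t hF ⟨h1, h2, -⟩
    exact hpost t hF h1 h2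

theorem WP.resetSets {e : Fin n} (hC : Ctx part cap m C col B s) (hN : n ≤ N) (hm : m ≤ N)
    (h20 : s.mem 20 0 = e)
    (hpost : ∀ t, Frame resetSets s t → Ctx part cap m C col B t →
      (∀ j < m, t.toFinset n (j + 100) = {e}) → post t) :
    WP f N resetSets post s := by
  refine WP.forLoop m (fun i t => Ctx part cap m C col B t ∧
    (∀ j < i, t.toFinset n (j + 100) = {e})) ?_ hm rfl ?_ ?_ ?_ ?_
  · simp [hC.samples]
  · rintro i t u ⟨h1, h2⟩ h4 -
    refine ⟨h1.of_eq_off h4 (by simp) (by simp), fun j hj => ?_⟩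
    rw [← h2 j hj]
    exact State.toFinset_congr_mem (h4 _ (by omega))
  · exact ⟨hC, by simp⟩
  · rintro i hi t hF ht ⟨h1, h2⟩
    have ht20 : t.mem 20 0 = e := by rw [hF.mem 20 rfl, h20]
    refine WP.seq (WP.forLoop n (fun l u => Ctx part cap m C col B u ∧ u.mem 25 0 = i ∧
      (∀ y : Fin n, (y : ℕ) < l → u.mem (i + 100) y = 0) ∧
      ∀ j < i, u.toFinset n (j + 100) = {e}) ?_ hN rfl ?_ ?_ ?_ ?_)
    · simp [h1.env.size]
    · rintro l u w ⟨h3, h4, h5, h6⟩ h7 -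
      refine ⟨h3.of_eq_off h7 (by simp) (by simp), by rw [h7 25 (by decide), h4],
        fun y hy => by rw [h7 _ (by omega), h5 y hy], fun j hj => ?_⟩
      rw [← h6 j hj]
      exact State.toFinset_congr_mem (h7 _ (by omega))
    · exact ⟨h1, ht, by simp, h2⟩
    · rintro l hl u hFu hu ⟨h3, h4, h5, h6⟩
      refine WP.set fun d => ?_
      simp only [NatExpr.eval, hu, h4]
      refine ⟨h3.congr ?_ ?_ ?_ ?_ ?_ ?_ fun j hj y => ?_, ?_, fun y hy => ?_, fun j hj => ?_⟩
      iterate 6 exact (congrFun (State.tick_mem _ _) _).trans (State.write_mem_of_ne (by omega))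
      · by_cases hji : j + 100 = i + 100
        · rw [hji, State.tick_mem, State.write_mem_of_ne_right (by omega)]
        · rw [State.tick_mem, State.write_mem_of_ne hji]
      · rw [State.tick_mem, State.write_mem_of_ne (by omega), h4]
      · rw [State.tick_mem]
        rcases Nat.lt_succ_iff_lt_or_eq.1 hy with h10 | h10
        · rw [State.write_mem_of_ne_right (by omega), h5 y h10]
        · rw [h10, State.write_mem_self]
      · rw [State.toFinset_tick, State.toFinset_write_of_ne (by omega), h6 j hj]
    · rintro u hFu ⟨h3, h4, h5, h6⟩
      have hu20 : u.mem 20 0 = e := by rw [hFu.mem 20 rfl, ht20]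
      refine WP.set fun d => ?_
      simp only [NatExpr.eval, hu20, h4]
      refine ⟨h3.congr ?_ ?_ ?_ ?_ ?_ ?_ fun j hj y => ?_, fun j hj => ?_⟩
      iterate 6 exact (congrFun (State.tick_mem _ _) _).trans (State.write_mem_of_ne (by omega))
      · by_cases hji : j + 100 = i + 100
        · rw [hji, State.tick_mem, State.write_mem_of_ne_right (by omega)]
        · rw [State.tick_mem, State.write_mem_of_ne hji]
      · rcases Nat.lt_succ_iff_lt_or_eq.1 hj with h7 | rfl
        · rw [State.toFinset_tick, State.toFinset_write_of_ne (by omega), h6 j h7]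
        · rw [State.toFinset_tick, State.toFinset_write_one]
          have : u.toFinset n (j + 100) = ∅ := by
            ext y
            simp [State.mem_toFinset, h5 y y.2]
          simp [this]
  · rintro t hF ⟨h1, h2⟩
    exact hpost t hF h1 h2

theorem WP.greedyRounds {s₀ e : Fin n} (hC : Ctx part cap m C col B s) (hN : n ≤ N) (hm : m ≤ N)
    (hCN : C ≤ N) (hf : ∀ S, 0 ≤ f S) (hR : ∀ j < m, s.toFinset n (j + 100) = {e})
    (h21 : s.mem 21 0 = s₀)
    (hpost : ∀ t, Frame greedyRounds s t → Ctx part cap m C col B t →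
      ∀ R, (∀ j < m, t.toFinset n (j + 100) = R j) → GreedyRun f part B m col s₀ e C 0 R →
      post t) :
    WP f N greedyRounds post s := by
  refine WP.forLoop C (fun c t => Ctx part cap m C col B t ∧ ∃ R,
    (∀ j < m, t.toFinset n (j + 100) = R j) ∧ GreedyRun f part B m col s₀ e c 0 R)
    ?_ hCN rfl ?_ ?_ ?_ ?_
  · simp [hC.colours]
  · rintro i t u ⟨h1, R, h2, h3⟩ h4 -
    refine ⟨h1.of_eq_off h4 (by simp) (by simp), R, fun j hj => ?_, h3⟩
    rw [← h2 j hj]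
    exact State.toFinset_congr_mem (h4 _ (by omega))
  · exact ⟨hC, _, hR, .init⟩
  · rintro c hc t hF ht ⟨h1, R, h2, h3⟩
    have ht21 : t.mem 21 0 = s₀ := by rw [hF.mem 21 rfl, h21]
    refine WP.forLoop n (fun i t => Ctx part cap m C col B t ∧ ∃ R,
      (∀ j < m, t.toFinset n (j + 100) = R j) ∧ GreedyRun f part B m col s₀ e c i R)
      ?_ hN rfl ?_ ?_ ?_ ?_
    · simp [h1.env.size]
    · rintro i t u ⟨h1, R, h2, h3⟩ h4 -
      refine ⟨h1.of_eq_off h4 (by simp) (by simp), R, fun j hj => ?_, h3⟩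
      rw [← h2 j hj]
      exact State.toFinset_congr_mem (h4 _ (by omega))
    · exact ⟨h1, R, h2, h3⟩
    · clear h2 h3
      rintro i hi u hFu hu ⟨h1, R, h2, h3⟩
      have hu21 : u.mem 21 0 = s₀ := by rw [hFu.mem 21 rfl, ht21]
      have hu22 : u.mem 22 0 = c := by rw [hFu.mem 22 rfl, ht]
      set slot : Fin n := ⟨i, hi⟩ with hslot
      have hB : slot ∈ B ↔ 1 ≤ u.mem 5 i := by
        rw [← h1.slots, State.mem_toFinset, Nat.one_le_iff_ne_zero]
      refine WP.ite (fun h d => ?_) fun h d => ?_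
      · have hslotB : slot ∈ B := hB.2 (by simpa [hu] using h)
        refine WP.whenNe (fun h' d' => ?_) fun h' d' => ?_
        · have hne : slot ≠ s₀ := by
            intro h''
            apply h'
            simp [hu, hu21, ← h'', hslot]
          refine WP.seq (WP.chooseElement ((h1.tick d).tick d') hN hm hf
            (R := R) h2 hu22 (slot := slot) hu fun v hFv x hvx hxs hmax => ?_)
          refine WP.addElement (R := R) (slot := slot) (x := x) (c := c)
            (((h1.tick d).tick d').frame hFv rfl) hm (fun j hj => ?_) ?_ ?_ hvx
            fun w hFw hCw hRw => ⟨hCw, _, hRw, .step slot hslotB hne x hxs hmax h3⟩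
          · rw [← h2 j hj]
            exact State.toFinset_congr_mem (hFv.high rfl _ (by omega))
          · rw [hFv.mem 22 rfl]
            exact hu22
          · rw [hFv.mem 23 rfl]
            exact hu
        · refine ⟨(h1.tick d).tick d', R, h2, .skip slot (.inr (Fin.ext ?_)) h3⟩
          simpa [hu, hu21, hslot] using h'
      · refine WP.skip ⟨(h1.tick d).tick 1, R, h2, .skip slot (.inl fun h' => h ?_) h3⟩
        simpa [hu] using hB.1 h'
    · rintro u - ⟨h4, R', h5, h6⟩
      exact ⟨h4, R', h5, h6.next⟩
  · rintro t hF ⟨h1, R, h2, h3⟩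
    exact hpost t hF h1 R h2 h3

theorem WP.recordBest {R : ℕ → Finset (Fin n)} (hC : Ctx part cap m C col B s) (hN : n ≤ N)
    (hm : m ≤ N) (hR : ∀ j < m, s.toFinset n (j + 100) = R j) (hs : s.rmem 4 0 ≤ f (s.toFinset n 3))
    (hpost : ∀ t, Frame recordBest s t → t.rmem 4 0 ≤ f (t.toFinset n 3) →
      s.rmem 4 0 ≤ t.rmem 4 0 → (∀ j < m, f (R j) ≤ t.rmem 4 0) →
      (t.toFinset n 3 = s.toFinset n 3 ∨ ∃ j < m, t.toFinset n 3 = R j) → post t) :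
    WP f N recordBest post s := by
  refine WP.forLoop m (fun i t => t.rmem 4 0 ≤ f (t.toFinset n 3) ∧ s.rmem 4 0 ≤ t.rmem 4 0 ∧
    (∀ j < i, f (R j) ≤ t.rmem 4 0) ∧
    (t.toFinset n 3 = s.toFinset n 3 ∨ ∃ j < m, t.toFinset n 3 = R j)) ?_ hm rfl ?_ ?_ ?_ ?_
  · simp [hC.samples]
  · rintro i t u h1 h2 h3
    rw [h3, State.toFinset_congr_mem (h2 3 (by decide))]
    exact h1
  · exact ⟨hs, le_rfl, by simp, .inl rfl⟩
  · rintro i hi t hF ht ⟨h1, h2, h3, h4⟩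
    have hCt : Ctx part cap m C col B t := hC.frame hF rfl
    have htR : t.toFinset n (i + 100) = R i := by
      rw [← hR i hi]
      exact State.toFinset_congr_mem (hF.high rfl _ (by omega))
    refine WP.seq (WP.query hN fun d => ?_)
    refine WP.ite (fun h d' => WP.seq (WP.rset fun d2 => ?_)) fun h d' => WP.skip ?_
    · have h' : t.rmem 4 0 ≤ f (R i) := by simpa [ht, htR] using h
      refine WP.copySet (a := i + 100) hCt.env.size hN (by simp) (by simp)
        (fun w hw => ?_) (by omega) (by omega) fun v hFv hv => ?_
      · have : w.mem 25 0 = i := by rw [hw]; exact ht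
        simp [this]
      · have hv4 : v.rmem 4 0 = f (R i) := by
          rw [hFv.rmem 4 rfl]
          simp [ht, htR]
        have hv3 : v.toFinset n 3 = R i := by
          rw [hv, ← htR]
          rfl
        rw [hv4, hv3]
        refine ⟨le_rfl, h2.trans h', fun j hj => ?_, .inr ⟨i, hi, rfl⟩⟩
        rcases Nat.lt_succ_iff_lt_or_eq.1 hj with h5 | rfl
        · exact (h3 j h5).trans h'
        · exact le_rfl
    · have h' : f (R i) ≤ t.rmem 4 0 := by
        have : ¬ t.rmem 4 0 ≤ f (R i) := by simpa [ht, htR] using h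
        exact (not_le.1 this).le
      refine ⟨?_, ?_, fun j hj => ?_, ?_⟩
      · simpa using h1
      · simpa using h2
      · rcases Nat.lt_succ_iff_lt_or_eq.1 hj with h5 | rfl
        · simpa using h3 j h5
        · simpa using h'
      · simpa using h4
  · rintro t hF ⟨h1, h2, h3, h4⟩
    exact hpost t hF h1 h2 h3 h4

/-- The specification of the main part of the algorithm: the set found is at least as good as each
of the sets constructed for some right guess. -/
theorem WP.allGuesses (hC : Ctx part cap m C col B s) (hN : n ≤ N) (hm : m ≤ N)
    (hCN : C ≤ N) (hf : ∀ S, 0 ≤ f S) (h3 : s.toFinset n 3 = ∅) (h4 : s.rmem 4 0 = 0)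
    (hind : ∀ s₀ ∈ B, ∀ e R, part e = part s₀ → GreedyRun f part B m col s₀ e C 0 R →
      ∀ j < m, PartIndep part cap (R j))
    (hpost : ∀ t, Frame allGuesses s t → PartIndep part cap (t.toFinset n 3) →
      Ctx part cap m C col B t →
      (∀ s₀ ∈ B, ∀ e, part e = part s₀ → ∃ R, GreedyRun f part B m col s₀ e C 0 R ∧
        ∀ j < m, f (R j) ≤ f (t.toFinset n 3)) → post t) :
    WP f N allGuesses post s := by
  let Inv (D : Fin n → Fin n → Prop) (t : State) : Prop := Ctx part cap m C col B t ∧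
    t.rmem 4 0 ≤ f (t.toFinset n 3) ∧ PartIndep part cap (t.toFinset n 3) ∧
    ∀ s₀ ∈ B, ∀ e, part e = part s₀ → D e s₀ → ∃ R, GreedyRun f part B m col s₀ e C 0 R ∧
        ∀ j < m, f (R j) ≤ t.rmem 4 0
  have hoff : ∀ D t u v, Inv D t → (∀ a, a ≠ v → u.mem a = t.mem a) → u.rmem = t.rmem →
      12 < v → v < 100 → Inv D u := by
    rintro D t u v ⟨h1, h2, h3, h4⟩ h5 h6 h7 h8
    refine ⟨h1.of_eq_off h5 h7 h8, ?_⟩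
    rw [h6, State.toFinset_congr_mem (h5 3 (by omega))]
    exact ⟨h2, h3, h4⟩
  refine WP.forLoop n (fun i => Inv fun e _ => (e : ℕ) < i) ?_ hN rfl ?_ ?_ ?_ ?_
  · simp [hC.env.size]
  · intro i t u h1 h2 h3
    exact hoff _ _ _ _ h1 h2 h3 (by simp) (by simp)
  · refine ⟨hC, by rw [h4]; exact hf _, ?_, by simp⟩
    rw [h3]
    intro i
    simp [partCount]
  · intro i hi t hF ht hInv
    refine WP.forLoop n (fun l => Inv fun e s₀ => (e : ℕ) < i ∨ (e : ℕ) = i ∧ (s₀ : ℕ) < l)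
      ?_ hN rfl ?_ ?_ ?_ ?_
    · simp [hInv.1.env.size]
    · intro i t u h1 h2 h3
      exact hoff _ _ _ _ h1 h2 h3 (by simp) (by simp)
    · simpa using hInv
    · rintro l hl u hFu hu ⟨h5, h6, h7, h8⟩
      have hu20 : u.mem 20 0 = i := by rw [hFu.mem 20 rfl, ht]
      set e : Fin n := ⟨i, hi⟩ with he
      set s₀ : Fin n := ⟨l, hl⟩ with hs₀
      have hB : s₀ ∈ B ↔ 1 ≤ u.mem 5 l := by
        rw [← h5.slots, State.mem_toFinset, Nat.one_le_iff_ne_zero]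
      have hp1 := h5.env.part e
      have hp2 := h5.env.part s₀
      simp only [he, hs₀] at hp1 hp2
      -- Unless the pair `e`, `s₀` is a possible guess, nothing has to be done for it.
      have hnone : ∀ d, (s₀ ∈ B → part e ≠ part s₀) →
          Inv (fun e s₀ => (e : ℕ) < i ∨ (e : ℕ) = i ∧ (s₀ : ℕ) < l + 1) (u.tick d) := by
        intro d h
        refine ⟨h5.tick d, h6, h7, fun s' hs' e' he' h9 => ?_⟩
        refine h8 s' hs' e' he' (h9.imp id fun h10 => ⟨h10.1, ?_⟩)
        rcases Nat.lt_succ_iff_lt_or_eq.1 h10.2 with h11 | h11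
        · exact h11
        · have h12 : s' = s₀ := Fin.ext h11
          have h13 : e' = e := Fin.ext h10.1
          subst h12 h13
          exact absurd he' (h hs')
      refine WP.ite (fun h d => ?_) fun h d => ?_
      · have hs₀B : s₀ ∈ B := hB.2 (by simpa [hu] using h)
        refine WP.whenEq (fun h' d' => ?_) fun h' d' => ?_
        · have hes : part e = part s₀ := by
            refine Fin.ext ?_
            simpa [hu, hu20, hp1, hp2] using h'
          refine WP.seq (WP.resetSets (e := e) ((h5.tick d).tick d') hN hm hu20
            fun v hFv hCv hRv => ?_)
          refine WP.seq (WP.greedyRounds (s₀ := s₀) hCv hN hm hCN hf hRv ?_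
            fun w hFw hCw R hRw hrun => ?_)
          · rw [hFv.mem 21 rfl]
            exact hu
          have hw4 : w.rmem 4 0 = u.rmem 4 0 := by
            rw [hFw.rmem 4 rfl, hFv.rmem 4 rfl]
            rfl
          have hw3 : w.toFinset n 3 = u.toFinset n 3 := by
            refine State.toFinset_congr_mem ?_
            rw [hFw.mem 3 rfl, hFv.mem 3 rfl]
            rfl
          refine WP.recordBest hCw hN hm hRw (by rw [hw4, hw3]; exact h6)
            fun z hFz h9 h10 h11 h12 => ?_
          refine ⟨hCw.frame hFz rfl, h9, ?_, fun s' hs' e' he' h13 => ?_⟩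
          · rcases h12 with h12 | ⟨j, hj, h12⟩
            · rw [h12, hw3]
              exact h7
            · rw [h12]
              exact hind s₀ hs₀B e R hes hrun j hj
          · by_cases h14 : (e' : ℕ) < i ∨ (e' : ℕ) = i ∧ (s' : ℕ) < l
            · obtain ⟨R', h15, h16⟩ := h8 s' hs' e' he' h14
              exact ⟨R', h15, fun j hj => (h16 j hj).trans (hw4 ▸ h10)⟩
            · have h15 : e' = e := Fin.ext (by simp only [he]; omega)
              have h16 : s' = s₀ := Fin.ext (by simp only [hs₀]; omega)
              subst h15 h16
              exact ⟨R, hrun, h11⟩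
        · rw [State.tick_tick]
          refine hnone _ fun _ h'' => h' ?_
          simpa [hu, hu20, hp1, hp2] using congrArg Fin.val h''
      · refine WP.skip ?_
        rw [State.tick_tick]
        exact hnone _ fun h' => absurd (hB.1 h') (by simpa [hu] using h)
    · rintro u - ⟨h5, h6, h7, h8⟩
      refine ⟨h5, h6, h7, fun s₀ hs₀ e he h9 => h8 s₀ hs₀ e he ?_⟩
      rcases Nat.lt_succ_iff_lt_or_eq.1 h9 with h10 | h10
      · exact .inl h10
      · exact .inr ⟨h10, s₀.2⟩
  · rintro t hF ⟨h5, h6, h7, h8⟩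
    refine hpost t hF h7 h5 fun s₀ hs₀ e he => ?_
    obtain ⟨R, h9, h10⟩ := h8 s₀ hs₀ e he e.2
    exact ⟨R, h9, fun j hj => (h10 j hj).trans h6⟩

end

end OracleRAM

/-! ### Parameters, random bits, and colours -/

/-- The number with binary digits `g p, g (p + 1), …, g (p + b - 1)`, the most significant digit
first. -/
def bitsVal (g : ℕ → ℕ) (p : ℕ) : ℕ → ℕ
  | 0 => 0
  | b + 1 => bitsVal g p b + bitsVal g p b + g (p + b)

/-- The uniform distribution on words of length `k + 1` arises by appending a uniform letter to a
uniform word of length `k`. -/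
theorem PMF.uniformOfFintype_snoc (k : ℕ) :
    PMF.uniformOfFintype (Fin (k + 1) → Fin 2) =
      (PMF.uniformOfFintype (Fin k → Fin 2)).bind fun β =>
        (PMF.uniformOfFintype (Fin 2)).map fun r => (Fin.snoc β r : Fin (k + 1) → Fin 2) := by
  classical
  ext γ
  rw [PMF.bind_apply, tsum_fintype, Finset.sum_eq_single (Fin.init γ : Fin k → Fin 2)]
  · rw [PMF.map_apply, tsum_fintype, Finset.sum_eq_single (γ (Fin.last k))]
    · simp only [PMF.uniformOfFintype_apply, Fin.snoc_init_self, if_true, Fintype.card_fun,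
        Fintype.card_fin, Nat.cast_pow, Nat.cast_ofNat]
      rw [pow_succ, ENNReal.mul_inv] <;> simp
    · intro r _ hr
      rw [if_neg]
      intro h
      apply hr
      simpa using (congrFun h (Fin.last k)).symm
    · simp
  · intro β _ hβ
    rw [PMF.map_apply, tsum_fintype, Finset.sum_eq_zero, mul_zero]
    intro r _
    rw [if_neg]
    rintro rfl
    simp at hβ
  · simp

namespace OracleRAM

/-- Multiply variable `i` by variable `k`. -/
def mulVar (i k : ℕ) : Prog :=
  .seq (assign 27 (.const 0))
  (.seq (.loop (nvar k) (assign 27 (.add (nvar 27) (nvar i)))) (assign i (nvar 27)))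

/-- Compute the number of samples (variable `10`), the number of colours (variable `12`), its
binary logarithm (variable `13`), and the number of random bits (variable `14`). -/
def setParameters (A : ℕ) : Prog :=
  .seq (assign 10 (.const A))
  (.seq (.loop (.const 14) (mulVar 10 0))
  (.seq (assign 11 (.const 6))
  (.seq (mulVar 11 0)
  (.seq (mulVar 11 0)
  (.seq (assign 12 (.const 1))
  (.seq (assign 13 (.const 0))
  (.seq (.loop (nvar 11) (.ite (.natLe (nvar 12) (nvar 11))
    (.seq (assign 12 (.add (nvar 12) (nvar 12))) (assign 13 (.add (nvar 13) (.const 1)))) .skip))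
  (.seq (assign 14 (nvar 10))
  (.seq (mulVar 14 0)
  (mulVar 14 13))))))))))

/-- Fill the beginning of array `4` with random bits. -/
def flipBits : Prog :=
  .seq (assign 16 (.const 0))
  (.loop (nvar 14) (.seq (.flip (.const 4) (nvar 16)) (assign 16 (.add (nvar 16) (.const 1)))))

/-- Turn the random bits into colours. -/
def decodeColours : Prog :=
  .seq (assign 16 (.const 0))
  (forLoop 25 (nvar 10) (forLoop 23 (nvar 0)
    (.seq (assign 27 (.const 0))
    (.seq (.loop (nvar 13)
      (.seq (assign 27 (.add (.add (nvar 27) (nvar 27)) (.get (.const 4) (nvar 16))))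
      (assign 16 (.add (nvar 16) (.const 1)))))
    (.set sampleArr (.add (nvar 0) (nvar 23)) (nvar 27))))))

section

variable {n q : ℕ} {part : Fin n → Fin q} {cap : Fin q → ℕ} {f : Finset (Fin n) → ℝ} {N : ℕ}
  {post : State → Prop} {s : State}

theorem WP.mulVar {i k : ℕ} (hi : i ≠ 27) (hk : k ≠ 27) (hN : s.mem k 0 ≤ N)
    (hpost : ∀ t, Frame (mulVar i k) s t → t.mem i 0 = s.mem i 0 * s.mem k 0 → post t) :
    WP f N (mulVar i k) post s := by
  have main : WP f N (OracleRAM.mulVar i k) (fun t => t.mem i 0 = s.mem i 0 * s.mem k 0) s := by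
    refine WP.seq (WP.set fun c => WP.seq ?_)
    refine WP.loop (fun l t => t.mem i 0 = s.mem i 0 ∧ t.mem 27 0 = s.mem i 0 * l) ?_ ?_ ?_ ?_
    · simpa [hk] using hN
    · intro d
      simp [hi]
    · rintro l - t - ⟨h1, h2⟩
      refine WP.set fun d => ?_
      simp [hi, h1, h2, mul_add]
    · rintro t ⟨-, h2⟩
      refine WP.set fun d => ?_
      simp [h2, hk]
  exact main.imp hpost

theorem WP.setParameters {A : ℕ} (hE : Env part cap s) (hN : n ≤ N) (hN' : 14 ≤ N)
    (hN2 : 6 * n * n ≤ N)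
    (hpost : ∀ t, Frame (setParameters A) s t → ∀ b : ℕ, t.mem 10 0 = A * n ^ 14 →
      t.mem 12 0 = 2 ^ b → t.mem 13 0 = b → t.mem 14 0 = A * n ^ 14 * n * b →
      b ≤ 6 * n * n → 6 * n * n < 2 ^ b → (2 ^ b ≤ 2 * (6 * n * n) ∨ b = 0) → post t) :
    WP f N (setParameters A) post s := by
  have main : WP f N (OracleRAM.setParameters A) (fun t => ∃ b : ℕ, t.mem 10 0 = A * n ^ 14 ∧
      t.mem 12 0 = 2 ^ b ∧ t.mem 13 0 = b ∧ t.mem 14 0 = A * n ^ 14 * n * b ∧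
      b ≤ 6 * n * n ∧ 6 * n * n < 2 ^ b ∧ (2 ^ b ≤ 2 * (6 * n * n) ∨ b = 0)) s := by
    have h0 := hE.size
    refine WP.seq (WP.set fun c => WP.seq ?_)
    refine WP.loop (fun l t => t.mem 0 0 = n ∧ t.mem 10 0 = A * n ^ l) (by simpa using hN') ?_ ?_ ?_
    · intro d
      simp [h0]
    · rintro l - t - ⟨h1, h2⟩
      refine WP.mulVar (by simp) (by simp) (by simpa [h1] using hN) fun u hF hu => ?_
      refine ⟨by rw [hF.mem 0 rfl]; simpa using h1, ?_⟩
      rw [hu]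
      simp [h1, h2, pow_succ, mul_assoc]
    rintro t1 ⟨h1, h2⟩
    refine WP.seq (WP.set fun c => WP.seq ?_)
    refine WP.mulVar (by simp) (by simp) (by simpa [h1] using hN) fun t2 hF2 ht2 => WP.seq ?_
    have h20 : t2.mem 0 0 = n := by rw [hF2.mem 0 rfl]; simpa using h1
    have h210 : t2.mem 10 0 = A * n ^ 14 := by rw [hF2.mem 10 rfl]; simpa using h2
    have h211 : t2.mem 11 0 = 6 * n := by rw [ht2]; simp [h1]
    refine WP.mulVar (by simp) (by simp) (by simpa [h20] using hN) fun t3 hF3 ht3 => WP.seq ?_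
    have h30 : t3.mem 0 0 = n := by rw [hF3.mem 0 rfl, h20]
    have h310 : t3.mem 10 0 = A * n ^ 14 := by rw [hF3.mem 10 rfl, h210]
    have h311 : t3.mem 11 0 = 6 * n * n := by rw [ht3, h211, h20]
    refine WP.set fun c => WP.seq (WP.set fun d => WP.seq ?_)
    refine WP.loop (fun l t => t.mem 0 0 = n ∧ t.mem 10 0 = A * n ^ 14 ∧ t.mem 11 0 = 6 * n * n ∧
      ∃ b, t.mem 12 0 = 2 ^ b ∧ t.mem 13 0 = b ∧ b ≤ l ∧ (6 * n * n < 2 ^ b ∨ b = l) ∧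
        (2 ^ b ≤ 2 * (6 * n * n) ∨ b = 0)) ?_ ?_ ?_ ?_
    · simpa [h311] using hN2
    · intro e
      simp [h30, h310, h311]
    · rintro l - t - ⟨h4, h5, h6, b, h7, h8, h9, h10, h11⟩
      refine WP.ite (fun h e => WP.seq (WP.set fun e' => WP.set fun e2 => ?_)) fun h e =>
        WP.skip ?_
      · have h' : 2 ^ b ≤ 6 * n * n := by simpa [h7, h6] using h
        refine ⟨by simpa using h4, by simpa using h5, by simpa using h6, b + 1, ?_, ?_, ?_, ?_, ?_⟩
        · simp [h7, pow_succ, mul_two]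
        · simp [h8]
        · omega
        · omega
        · left
          rw [pow_succ]
          omega
      · have h' : 6 * n * n < 2 ^ b := by simpa [h7, h6] using h
        exact ⟨h4, h5, h6, b, h7, h8, by omega, .inl h', h11⟩
    · rintro t4 ⟨h4, h5, h6, b, h7, h8, h9, h10, h11⟩
      have h9' : b ≤ 6 * n * n := by simpa [h311] using h9
      have h10' : 6 * n * n < 2 ^ b := by
        rcases h10 with h10 | h10
        · exact h10
        · have : b = 6 * n * n := by simpa [h311] using h10
          rw [← this]
          exact Nat.lt_two_pow_self
      refine WP.seq (WP.set fun c => WP.seq ?_)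
      refine WP.mulVar (by simp) (by simp) (by simpa [h4] using hN) fun t5 hF5 ht5 => ?_
      have h510 : t5.mem 10 0 = A * n ^ 14 := by rw [hF5.mem 10 rfl]; simpa using h5
      have h512 : t5.mem 12 0 = 2 ^ b := by rw [hF5.mem 12 rfl]; simpa using h7
      have h513 : t5.mem 13 0 = b := by rw [hF5.mem 13 rfl]; simpa using h8
      have h514 : t5.mem 14 0 = A * n ^ 14 * n := by rw [ht5]; simp [h4, h5]
      refine WP.mulVar (by simp) (by simp) (by rw [h513]; omega) fun t6 hF6 ht6 => ?_
      refine ⟨b, by rw [hF6.mem 10 rfl, h510], by rw [hF6.mem 12 rfl, h512],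
        by rw [hF6.mem 13 rfl, h513], by rw [ht6, h514, h513], h9', h10', h11⟩
  exact main.imp fun t hF ⟨b, h1, h2, h3, h4, h5, h6, h7⟩ => hpost t hF b h1 h2 h3 h4 h5 h6 h7

/-- The only randomized part of the algorithm draws a uniform word of bits. -/
theorem exec_flipBits (f : Finset (Fin n) → ℝ) {M : ℕ} (hM : s.mem 14 0 = M) (hN : M ≤ N) :
    ∃ G : (Fin M → Fin 2) → State,
      flipBits.exec f s = (PMF.uniformOfFintype (Fin M → Fin 2)).map G ∧
      ∀ β, (G β).time ≤ s.time + flipBits.cost N ∧ Frame flipBits s (G β) ∧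
        ∀ i : Fin M, (G β).mem 4 i = β i := by
  set body : Prog := .seq (.flip (.const 4) (nvar 16)) (assign 16 (.add (nvar 16) (.const 1)))
    with hbody
  -- the state after one iteration started in `u` in which the bit `r` is drawn;
  -- `5` and `8` are the costs of the two instructions, and one step is charged for the iteration
  let H : State → Fin 2 → State := fun u r =>
    ((((u.tick 1).write 4 (u.mem 16 0) r).tick 5).write 16 0 (u.mem 16 0 + 1)).tick 8
  have hH : ∀ u, body.exec f (u.tick 1) = (PMF.uniformOfFintype (Fin 2)).map (H u) := by
    intro u
    rw [hbody, Prog.exec, Prog.exec, PMF.bind_map, ← PMF.bind_pure_comp]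
    congr 1
  set s1 : State := ((s.write 16 0 0).tick 4).tick 4 with hs1
  have key : ∀ k, ∃ G : (Fin k → Fin 2) → State,
      (fun d : PMF State => d.bind fun s' => body.exec f (s'.tick 1))^[k] (PMF.pure s1) =
        (PMF.uniformOfFintype (Fin k → Fin 2)).map G ∧
      ∀ β, (G β).time = s1.time + k * 14 ∧ (G β).mem 16 0 = k ∧
        ∀ i : Fin k, (G β).mem 4 i = β i := by
    intro k
    induction k with
    | zero =>
      refine ⟨fun _ => s1, ?_, fun β => ⟨by simp, by simp [hs1], fun i => i.elim0⟩⟩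
      simp only [Function.iterate_zero, id]
      exact (PMF.map_const _ _).symm
    | succ k ih =>
      obtain ⟨G, hG, hG'⟩ := ih
      refine ⟨fun γ => H (G (Fin.init γ)) (γ (Fin.last k)), ?_, fun γ => ?_⟩
      · rw [Function.iterate_succ_apply', hG, PMF.bind_map, PMF.uniformOfFintype_snoc,
          PMF.map_bind]
        congr 1
        funext β
        rw [Function.comp_apply, hH, PMF.map_comp]
        congr 1
        funext r
        simp
      · obtain ⟨h1, h2, h3⟩ := hG' (Fin.init γ)
        refine ⟨?_, by simp [H, h2], fun i => ?_⟩
        · simp only [H, State.tick_time, State.write_time, h1]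
          ring
        · refine Fin.lastCases ?_ (fun i => ?_) i
          · simp [H, h2]
          · have : (i : ℕ) ≠ k := i.2.ne
            simp [H, h2, this, h3, Fin.init]
  obtain ⟨G, hG, hG'⟩ := key M
  have hexec : flipBits.exec f s = (PMF.uniformOfFintype (Fin M → Fin 2)).map G := by
    rw [flipBits, Prog.exec, Prog.exec, PMF.pure_bind, Prog.exec, ← hG]
    congr 1
  refine ⟨G, hexec, fun β => ⟨?_, Frame.of_mem_support (f := f) ?_, (hG' β).2.2⟩⟩
  · rw [(hG' β).1]
    simp only [hs1, flipBits, Prog.cost, NatExpr.size, State.tick_time, State.write_time]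
    nlinarith
  · rw [hexec, PMF.support_map]
    exact ⟨β, by simp, rfl⟩

theorem WP.decodeColours {m b : ℕ} (hE : Env part cap s) (hN : n ≤ N) (hm : s.mem 10 0 = m)
    (hb : s.mem 13 0 = b) (hmN : m ≤ N) (hbN : b ≤ N)
    (hpost : ∀ t, Frame decodeColours s t → (∀ j < m, ∀ x : Fin n,
      t.mem (j + 100) (n + x) = bitsVal (s.mem 4) ((j * n + x) * b) b) → post t) :
    WP f N decodeColours post s := by
  have main : WP f N OracleRAM.decodeColours (fun t => ∀ j < m, ∀ x : Fin n,
      t.mem (j + 100) (n + x) = bitsVal (s.mem 4) ((j * n + x) * b) b) s := by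
    refine WP.seq (WP.set fun c => ?_)
    refine WP.forLoop m (fun i t => t.mem 16 0 = (i * n) * b ∧ ∀ j < i, ∀ x : Fin n,
      t.mem (j + 100) (n + x) = bitsVal (s.mem 4) ((j * n + x) * b) b) ?_ hmN rfl ?_ ?_ ?_ ?_
    · simp [hm]
    · rintro i t u ⟨h1, h2⟩ h3 -
      refine ⟨by rw [h3 16 (by decide), h1], fun j hj x => ?_⟩
      rw [h3 _ (by omega), h2 j hj]
    · simp
    · rintro i hi t hF ht ⟨h1, h2⟩
      have h0 : t.mem 0 0 = n := by rw [hF.mem 0 rfl]; simpa using hE.size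
      refine WP.forLoop n (fun l t => t.mem 16 0 = (i * n + l) * b ∧ (∀ j < i, ∀ x : Fin n,
        t.mem (j + 100) (n + x) = bitsVal (s.mem 4) ((j * n + x) * b) b) ∧
        ∀ x : Fin n, (x : ℕ) < l → t.mem (i + 100) (n + x) =
          bitsVal (s.mem 4) ((i * n + x) * b) b) ?_ hN rfl ?_ ?_ ?_ ?_
      · simp [h0]
      · rintro l t u ⟨h1, h2, h3⟩ h4 -
        refine ⟨by rw [h4 16 (by decide), h1], fun j hj x => ?_, fun x hx => ?_⟩
        · rw [h4 _ (by omega), h2 j hj]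
        · rw [h4 _ (by omega), h3 x hx]
      · exact ⟨h1, h2, by simp⟩
      · clear h1 h2
        rintro l hl u hFu hu ⟨h1, h2, h3⟩
        have hu0 : u.mem 0 0 = n := by rw [hFu.mem 0 rfl, h0]
        have hu4 : u.mem 4 = s.mem 4 := by
          rw [hFu.mem 4 rfl, hF.mem 4 rfl]
          rfl
        have hu13 : u.mem 13 0 = b := by
          rw [hFu.mem 13 rfl, hF.mem 13 rfl]
          exact hb
        have hu25 : u.mem 25 0 = i := by rw [hFu.mem 25 rfl, ht]
        refine WP.seq (WP.set fun d => WP.seq ?_)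
        refine WP.loop (fun k v => v.mem 16 0 = (i * n + l) * b + k ∧
          v.mem 27 0 = bitsVal (s.mem 4) ((i * n + l) * b) k ∧
          ∀ a, a ≠ 16 → a ≠ 27 → v.mem a = u.mem a) ?_ ?_ ?_ ?_
        · simpa [hu13] using hbN
        · intro e
          refine ⟨by simp [h1], by simp [bitsVal], fun a _ ha => by simp [ha]⟩
        · rintro k - v - ⟨h4, h5, h6⟩
          refine WP.seq (WP.set fun d1 => WP.set fun d2 => ?_)
          refine ⟨by simp [h4, add_assoc], ?_, fun a ha ha' => by simp [ha, ha', h6 a ha ha']⟩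
          simp [bitsVal, h4, h5, h6 4, hu4]
        · rintro v ⟨h4, h5, h6⟩
          have h4' : v.mem 16 0 = (i * n + l) * b + b := by simpa [hu13] using h4
          have h5' : v.mem 27 0 = bitsVal (s.mem 4) ((i * n + l) * b) b := by simpa [hu13] using h5
          have h60 : v.mem 0 0 = n := by rw [h6 0 (by simp) (by simp), hu0]
          have h623 : v.mem 23 0 = l := by rw [h6 23 (by simp) (by simp), hu]
          have h625 : v.mem 25 0 = i := by rw [h6 25 (by simp) (by simp), hu25]
          refine WP.set fun d1 => ?_
          simp only [NatExpr.eval, h60, h623, h625, h5', State.tick_mem]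
          refine ⟨?_, fun j hj x => ?_, fun x hx => ?_⟩
          · rw [State.write_mem_of_ne (by omega), h4']
            ring
          · rw [State.write_mem_of_ne (by omega), h6 _ (by omega) (by omega), h2 j hj]
          · rcases Nat.lt_succ_iff_lt_or_eq.1 hx with h7 | h7
            · rw [State.write_mem_of_ne_right (by omega), h6 _ (by omega) (by omega), h3 x h7]
            · rw [h7, State.write_mem_self]
      · rintro u - ⟨h4, h5, h6⟩
        refine ⟨by rw [h4]; ring, fun j hj x => ?_⟩
        rcases Nat.lt_succ_iff_lt_or_eq.1 hj with h7 | rfl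
        · exact h5 j h7 x
        · exact h6 x x.2
    · rintro t - ⟨-, h2⟩
      exact h2
  exact main.imp hpost

end

end OracleRAM

/-! ### The final greedy steps -/

/-- `GreedyChain f S₁ τ S` says that `S` can be obtained from `S₁` in `τ` steps, in each of which
one best element of the ground set is added. -/
inductive GreedyChain {α : Type*} [DecidableEq α] (f : Finset α → ℝ) (S₁ : Finset α) :
    ℕ → Finset α → Prop
  | zero : GreedyChain f S₁ 0 S₁
  | step {τ : ℕ} {S : Finset α} (x : α) (hx : ∀ y, f (insert y S) ≤ f (insert x S))
      (h : GreedyChain f S₁ τ S) : GreedyChain f S₁ (τ + 1) (insert x S)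

namespace OracleRAM

/-- Add to the set in array `3` an element of the ground set which is best for it. -/
def greedyAdd : Prog :=
  .seq (assign 28 (.const 0))
  (.seq (rassign 3 rzero)
  (.seq (forLoop 24 (nvar 0)
    (.seq (copySet (.const 3) 6)
    (.seq (.set (.const 6) (nvar 24) (.const 1))
    (.seq (.query (.const 2) (.const 0) (.const 6))
    (.ite (.realLe (rvar 3) (rvar 2))
      (.seq (assign 28 (nvar 24)) (rassign 3 (rvar 2))) .skip)))))
  (.set (.const 3) (nvar 28) (.const 1))))

/-- Extend the set in array `3` to a base, and then greedily as far as the size bound permits; if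
the bound permits everything, take the whole ground set. -/
def finish : Prog :=
  .seq (fill 3)
  (.seq (rassign 5 rzero)
  (.seq (rassign 6 rzero)
  (.seq (rassign 7 rzero)
  (.seq (forLoop 24 (nvar 0) (.seq (rassign 7 (.add (rvar 7) .one))
    (.ite (.natLe (.const 1) (.get (.const 5) (nvar 24)))
      (.seq (rassign 5 (.add (rvar 5) (rvar 0))) (rassign 6 (.add (rvar 6) .one))) .skip)))
  (.seq (forLoop 29 (nvar 0) (.ite (.realLe (.add (rvar 6) .one) (rvar 5))
    (.seq (rassign 6 (.add (rvar 6) .one)) greedyAdd) .skip))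
  (.ite (.realLe (rvar 7) (rvar 5))
    (forLoop 24 (nvar 0) (.set (.const 3) (nvar 24) (.const 1))) .skip))))))

section

variable {n q : ℕ} {part : Fin n → Fin q} {cap : Fin q → ℕ} {f : Finset (Fin n) → ℝ} {N : ℕ}
  {post : State → Prop} {s : State}

theorem WP.greedyAdd {S : Finset (Fin n)} (hE : Env part cap s) (hN : n ≤ N) (hn : 0 < n)
    (hf : ∀ S, 0 ≤ f S) (hS : s.toFinset n 3 = S)
    (hpost : ∀ t, Frame greedyAdd s t → ∀ x : Fin n, t.toFinset n 3 = insert x S →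
      (∀ y, f (insert y S) ≤ f (insert x S)) → post t) :
    WP f N greedyAdd post s := by
  have main : WP f N OracleRAM.greedyAdd (fun t => ∃ x : Fin n, t.toFinset n 3 = insert x S ∧
      ∀ y, f (insert y S) ≤ f (insert x S)) s := by
    refine WP.seq (WP.set fun c1 => WP.seq (WP.rset fun c2 => WP.seq ?_))
    refine WP.forLoop n (fun i t => (∀ y : Fin n, (y : ℕ) < i → f (insert y S) ≤ t.rmem 3 0) ∧
        ((∃ x : Fin n, t.mem 28 0 = x ∧ t.rmem 3 0 = f (insert x S)) ∨
        (t.rmem 3 0 = 0 ∧ i = 0))) ?_ hN rfl ?_ ?_ ?_ ?_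
    · simp [hE.size]
    · rintro i t u ⟨h1, h2⟩ h3 h4
      simp only [h4, h3 28 (by decide)]
      exact ⟨h1, h2⟩
    · simp
    · rintro i hi t hF ht ⟨h1, h2⟩
      have hEt : Env part cap t := by
        refine Env.frame ?_ hF rfl rfl rfl
        exact hE.congr rfl rfl rfl
      have ht3 : t.toFinset n 3 = S := by
        rw [← hS]
        exact State.toFinset_congr_mem (hF.mem 3 rfl)
      set x : Fin n := ⟨i, hi⟩ with hx
      refine WP.seq (WP.copySet (a := 3) hEt.size hN (by simp) (by simp) (fun w _ => rfl) (by simp)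
        (by simp) fun v hFv hv => ?_)
      have hv24 : v.mem 24 0 = i := by rw [hFv.mem 24 rfl, ht]
      have hv28 : v.mem 28 0 = t.mem 28 0 := by rw [hFv.mem 28 rfl]
      have hvr3 : v.rmem 3 0 = t.rmem 3 0 := by rw [hFv.rmem 3 rfl]
      have hins : (v.write 6 i 1).toFinset n 6 = insert x S := by
        rw [← ht3, ← hv]
        exact State.toFinset_write_one v 6 x
      refine WP.seq (WP.set fun d1 => WP.seq (WP.query hN fun d2 => ?_))
      refine WP.ite (fun h d3 => ?_) fun h d3 => WP.skip ?_
      · have h' : t.rmem 3 0 ≤ f (insert x S) := by simpa [hvr3, hv24, hins] using h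
        refine WP.seq (WP.set fun d4 => WP.rset fun d5 => ?_)
        refine ⟨fun y hy => ?_, .inl ⟨x, by simp [hv24, hx], by simp [hv24, hins]⟩⟩
        have : f (insert y S) ≤ f (insert x S) := by
          rcases Nat.lt_succ_iff_lt_or_eq.1 hy with h7 | h7
          · exact (h1 y h7).trans h'
          · have : y = x := Fin.ext h7
            rw [this]
        simpa [hv24, hins] using this
      · have h' : f (insert x S) < t.rmem 3 0 := by simpa [hvr3, hv24, hins] using h
        refine ⟨fun y hy => ?_, .inl ?_⟩
        · have : f (insert y S) ≤ t.rmem 3 0 := by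
            rcases Nat.lt_succ_iff_lt_or_eq.1 hy with h7 | h7
            · exact h1 y h7
            · have : y = x := Fin.ext h7
              rw [this]
              exact h'.le
          simpa [hvr3] using this
        · rcases h2 with ⟨x', h3, h4⟩ | ⟨h3, -⟩
          · exact ⟨x', by simp [hv28, h3], by simp [hvr3, h4]⟩
          · exact absurd (h3 ▸ h') (not_lt.2 (hf _))
    · rintro t hF ⟨h1, h2⟩
      have ht3 : t.toFinset n 3 = S := by
        rw [← hS]
        exact State.toFinset_congr_mem (hF.mem 3 rfl)
      rcases h2 with ⟨x, h3, h4⟩ | ⟨-, h2⟩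
      · refine WP.set fun d => ⟨x, ?_, fun y => h4 ▸ h1 y y.2⟩
        have := State.toFinset_write_one t 3 x
        rw [ht3] at this
        simpa [h3] using this
      · omega
  exact main.imp fun t hF ⟨x, h1, h2⟩ => hpost t hF x h1 h2

/-- The specification of the last phase, for slots `B`: if `γ * B.card` is at least `n`, the result
is the whole ground set, and otherwise it arises from a base by `⌊γ * B.card⌋ - B.card` greedy
steps. -/
theorem WP.finish {S B : Finset (Fin n)} {γ : ℝ} (hE : Env part cap s) (hN : n ≤ N)
    (hf : ∀ S, 0 ≤ f S) (hS : s.toFinset n 3 = S) (hB : s.toFinset n 5 = B)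
    (hI : PartIndep part cap S) (hγ : s.rmem 0 0 = γ) (hγ1 : 1 ≤ γ)
    (hpost : ∀ t, Frame finish s t → ∀ S₁, S ⊆ S₁ → PartIndep part cap S₁ →
      PartSpanning part cap S₁ →
      ((n ≤ γ * B.card ∧ t.toFinset n 3 = Finset.univ) ∨
        ∃ τ : ℕ, B.card + τ ≤ γ * B.card ∧ γ * B.card < B.card + τ + 1 ∧
          GreedyChain f S₁ τ (t.toFinset n 3)) → post t) :
    WP f N finish post s := by
  have main : WP f N OracleRAM.finish (fun t => ∃ S₁, S ⊆ S₁ ∧ PartIndep part cap S₁ ∧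
      PartSpanning part cap S₁ ∧
      ((n ≤ γ * B.card ∧ t.toFinset n 3 = Finset.univ) ∨
        ∃ τ : ℕ, B.card + τ ≤ γ * B.card ∧ γ * B.card < B.card + τ + 1 ∧
          GreedyChain f S₁ τ (t.toFinset n 3))) s := by
    refine WP.seq (WP.fill hE hN (by simp) (by simp) hS hI fun t1 hF1 S₁ h11 h12 h13 h14 => ?_)
    have hE1 := hE.frame hF1 rfl rfl rfl
    have hB1 : t1.toFinset n 5 = B := by
      rw [← hB]
      exact State.toFinset_congr_mem (hF1.mem 5 rfl)
    have hγ1' : t1.rmem 0 0 = γ := by rw [hF1.rmem 0 rfl, hγ]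
    refine WP.seq (WP.rset fun c1 => WP.seq (WP.rset fun c2 => ?_))
    refine WP.seq (WP.rset fun c3 => WP.seq ?_)
    refine WP.forLoop n (fun i t => t.rmem 7 0 = i ∧
      t.rmem 5 0 = γ * (Finset.univ.filter fun y : Fin n => (y : ℕ) < i ∧ y ∈ B).card ∧
      t.rmem 6 0 = (Finset.univ.filter fun y : Fin n => (y : ℕ) < i ∧ y ∈ B).card)
      ?_ hN rfl ?_ ?_ ?_ ?_
    · simp [hE1.size]
    · rintro i t u h1 - h2
      rw [h2]
      exact h1
    · simp
    · rintro i hi t hF ht ⟨h1, h2, h3⟩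
      have hcard := Fin.card_filter_lt_succ (fun y => y ∈ B) hi
      have hγt : t.rmem 0 0 = γ := by rw [hF.rmem 0 rfl]; exact hγ1'
      have hBt : (⟨i, hi⟩ : Fin n) ∈ B ↔ 1 ≤ t.mem 5 i := by
        rw [← hB1, State.mem_toFinset, Nat.one_le_iff_ne_zero, hF.mem 5 rfl]
        rfl
      refine WP.seq (WP.rset fun d1 => ?_)
      refine WP.ite (fun h d2 => WP.seq (WP.rset fun d3 => WP.rset fun d4 => ?_)) fun h d2 =>
        WP.skip ?_
      · rw [hcard, if_pos (hBt.2 (by simpa [ht] using h))]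
        refine ⟨by simp [h1], ?_, by simp [h3]⟩
        simp [h2, hγt, mul_add]
      · rw [hcard, if_neg (fun h' => absurd (hBt.1 h') (by simpa [ht] using h))]
        exact ⟨by simp [h1], by simp [h2], by simp [h3]⟩
    · rintro t2 hF2 ⟨h21, h22, h23⟩
      have hfilter : (Finset.univ.filter fun y : Fin n => (y : ℕ) < n ∧ y ∈ B) = B := by
        ext y
        simp
      rw [hfilter] at h22 h23
      have hE2 : Env part cap t2 := by
        refine Env.frame ?_ hF2 rfl rfl rfl
        exact hE1.congr rfl rfl rfl
      have h24 : t2.toFinset n 3 = S₁ := by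
        rw [← h11]
        exact State.toFinset_congr_mem (hF2.mem 3 rfl)
      refine WP.seq (WP.forLoop n (fun i t => ∃ τ : ℕ, GreedyChain f S₁ τ (t.toFinset n 3) ∧
        t.rmem 6 0 = B.card + τ ∧ B.card + τ ≤ γ * B.card ∧
        (τ = i ∨ γ * B.card < B.card + τ + 1)) ?_ hN rfl ?_ ?_ ?_ ?_)
      · simp [hE2.size]
      · rintro i t u ⟨τ, h1⟩ h2 h3
        rw [h3, State.toFinset_congr_mem (h2 3 (by decide))]
        exact ⟨τ, h1⟩
      · refine ⟨0, h24 ▸ .zero, by simp [h23], ?_, by simp⟩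
        have : (0 : ℝ) ≤ B.card := Nat.cast_nonneg _
        simp only [Nat.cast_zero, add_zero]
        nlinarith
      · rintro i hi t hF ht ⟨τ, h1, h2, h3, h4⟩
        have hEt := hE2.frame hF rfl rfl rfl
        have ht5 : t.rmem 5 0 = γ * B.card := by rw [hF.rmem 5 rfl, h22]
        refine WP.ite (fun h d1 => WP.seq (WP.rset fun d2 => ?_)) fun h d1 => WP.skip ?_
        · have h' : (B.card : ℝ) + τ + 1 ≤ γ * B.card := by simpa [h2, ht5] using h
          refine WP.greedyAdd (part := part) (cap := cap) (hEt.congr rfl rfl rfl) hN (by omega) hf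
            rfl fun u hFu x hu hmax => ?_
          have hu' : u.toFinset n 3 = insert x (t.toFinset n 3) := hu
          refine ⟨τ + 1, ?_, ?_, ?_, ?_⟩
          · rw [hu']
            exact .step x hmax h1
          · rw [hFu.rmem 6 rfl]
            simp [h2]
            ring
          · push_cast
            linarith
          · rcases h4 with h4 | h4
            · exact .inl (by rw [h4])
            · exact absurd h' (not_le.2 h4)
        · have h' : γ * B.card < (B.card : ℝ) + τ + 1 := by simpa [h2, ht5] using h
          exact ⟨τ, h1, by simpa using h2, h3, .inr h'⟩
      · rintro t3 hF3 ⟨τ, h1, h2, h3, h4⟩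
        have hE3 := hE2.frame hF3 rfl rfl rfl
        have h35 : t3.rmem 5 0 = γ * B.card := by rw [hF3.rmem 5 rfl, h22]
        have h37 : t3.rmem 7 0 = n := by rw [hF3.rmem 7 rfl, h21]
        refine WP.ite (fun h d1 => ?_) fun h d1 => WP.skip ?_
        · have h' : (n : ℝ) ≤ γ * B.card := by simpa [h35, h37] using h
          refine WP.forLoop n (fun i t => ∀ y : Fin n, (y : ℕ) < i → y ∈ t.toFinset n 3) ?_ hN rfl
            ?_ ?_ ?_ ?_
          · simp [hE3.size]
          · intro i t u h5 h6 _
            rwa [State.toFinset_congr_mem (h6 3 (by decide))]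
          · simp
          · intro i hi t hF ht h5
            refine WP.set fun d2 y hy => ?_
            have := State.toFinset_write_one t 3 ⟨i, hi⟩
            simp only [NatExpr.eval, ht, State.toFinset_tick]
            simp only at this
            rw [this, Finset.mem_insert]
            rcases Nat.lt_succ_iff_lt_or_eq.1 hy with h6 | h6
            · exact .inr (h5 y h6)
            · exact .inl (Fin.ext h6)
          · intro t hF h5
            exact ⟨S₁, h12, h13, h14, .inl ⟨h', Finset.eq_univ_iff_forall.2 fun y => h5 y y.2⟩⟩
        · have h' : γ * B.card < n := by simpa [h35, h37] using h
          refine ⟨S₁, h12, h13, h14, .inr ⟨τ, h3, ?_, h1⟩⟩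
          rcases h4 with rfl | h4
          · have : (0 : ℝ) ≤ B.card := Nat.cast_nonneg _
            linarith
          · exact h4
  exact main.imp fun t hF ⟨S₁, h1, h2, h3, h4⟩ => hpost t hF S₁ h1 h2 h3 h4

end

end OracleRAM

/-! ### Concentration of sample means -/

theorem sum_exp_le_of_sum_eq_zero {Ω : Type*} [Fintype Ω] {h : Ω → ℝ} (hh : ∀ x, |h x| ≤ 1)
    (h0 : ∑ x, h x = 0) {l : ℝ} (hl0 : 0 ≤ l) (hl1 : l ≤ 1) :
    ∑ x, Real.exp (l * h x) ≤ Fintype.card Ω * Real.exp (l ^ 2) := by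
  have h1 : ∀ x, Real.exp (l * h x) ≤ 1 + l * h x + l ^ 2 := by
    intro x
    have h2 : |l * h x| ≤ 1 := by
      rw [abs_mul, abs_of_nonneg hl0]
      exact mul_le_one₀ hl1 (abs_nonneg _) (hh x)
    have h3 := (abs_le.1 (Real.abs_exp_sub_one_sub_id_le h2)).2
    have h4 : (l * h x) ^ 2 ≤ l ^ 2 := by
      rw [mul_pow]
      exact mul_le_of_le_one_right (sq_nonneg l) ((sq_le_one_iff_abs_le_one _).2 (hh x))
    linarith
  calc ∑ x, Real.exp (l * h x) ≤ ∑ x, (1 + l * h x + l ^ 2) := Finset.sum_le_sum fun x _ => h1 x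
    _ = Fintype.card Ω * (l ^ 2 + 1) := by
      rw [Finset.sum_add_distrib, Finset.sum_add_distrib, ← Finset.mul_sum, h0]
      simp
      ring
    _ ≤ _ := by
      gcongr
      exact Real.add_one_le_exp _

/-- A Chernoff bound, stated by counting samples. -/
theorem card_sum_ge_le {Ω : Type*} [Fintype Ω] {h : Ω → ℝ} (hh : ∀ x, |h x| ≤ 1)
    (h0 : ∑ x, h x = 0) (m : ℕ) {η : ℝ} (hη : 0 ≤ η) (hη' : η ≤ 2) :
    (((Finset.univ.filter fun w : Fin m → Ω => m * η ≤ ∑ j, h (w j)).card : ℕ) : ℝ) ≤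
      Real.exp (-(m * η ^ 2 / 4)) * (Fintype.card Ω : ℝ) ^ m := by
  set l : ℝ := η / 2 with hl
  calc (((Finset.univ.filter fun w : Fin m → Ω => m * η ≤ ∑ j, h (w j)).card : ℕ) : ℝ)
      = ∑ w ∈ Finset.univ.filter fun w : Fin m → Ω => m * η ≤ ∑ j, h (w j), (1 : ℝ) := by simp
    _ ≤ ∑ w ∈ Finset.univ.filter fun w : Fin m → Ω => m * η ≤ ∑ j, h (w j),
        Real.exp (l * (∑ j, h (w j)) - l * (m * η)) := by
      refine Finset.sum_le_sum fun w hw => Real.one_le_exp ?_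
      have := (Finset.mem_filter.1 hw).2
      nlinarith
    _ ≤ ∑ w : Fin m → Ω, Real.exp (l * (∑ j, h (w j)) - l * (m * η)) :=
      Finset.sum_le_sum_of_subset_of_nonneg (Finset.filter_subset _ _)
        fun w _ _ => (Real.exp_pos _).le
    _ = Real.exp (-(l * (m * η))) * (∑ x, Real.exp (l * h x)) ^ m := by
      rw [Fintype.sum_pow, Finset.mul_sum]
      refine Finset.sum_congr rfl fun w _ => ?_
      rw [← Real.exp_sum, ← Real.exp_add, Finset.mul_sum]
      ring_nf
    _ ≤ Real.exp (-(l * (m * η))) * (Fintype.card Ω * Real.exp (l ^ 2)) ^ m := by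
      gcongr
      exact sum_exp_le_of_sum_eq_zero hh h0 (by positivity) (by rw [hl]; linarith)
    _ = _ := by
      rw [mul_pow, mul_comm ((Fintype.card Ω : ℝ) ^ m), ← mul_assoc, ← Real.exp_nat_mul,
        ← Real.exp_add]
      congr 2
      rw [hl]
      ring

/-- A two-sided bound for functions with values in `[0, M]`. -/
theorem card_abs_sum_sub_gt_le {Ω : Type*} [Fintype Ω] [Nonempty Ω] {g : Ω → ℝ} {M : ℝ}
    (hM : 0 ≤ M) (hg0 : ∀ x, 0 ≤ g x) (hg1 : ∀ x, g x ≤ M) (m : ℕ) {η : ℝ} (hη : 0 ≤ η)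
    (hη' : η ≤ 2) :
    (((Finset.univ.filter fun w : Fin m → Ω =>
      m * (η * M) < |∑ j, g (w j) - m * ((∑ x, g x) / Fintype.card Ω)|).card : ℕ) : ℝ) ≤
      2 * Real.exp (-(m * η ^ 2 / 4)) * (Fintype.card Ω : ℝ) ^ m := by
  classical
  have hW : (0 : ℝ) < Fintype.card Ω := by exact_mod_cast Fintype.card_pos
  rcases hM.eq_or_lt with rfl | hM
  · have hg : ∀ x, g x = 0 := fun x => le_antisymm (hg1 x) (hg0 x)
    simp only [hg]
    simp
    positivity
  set μ : ℝ := (∑ x, g x) / Fintype.card Ω with hμ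
  have hμ0 : 0 ≤ μ := div_nonneg (Finset.sum_nonneg fun x _ => hg0 x) hW.le
  have hμ1 : μ ≤ M := by
    rw [hμ, div_le_iff₀ hW]
    calc ∑ x, g x ≤ ∑ _x : Ω, M := Finset.sum_le_sum fun x _ => hg1 x
      _ = M * Fintype.card Ω := by simp [mul_comm]
  set h : Ω → ℝ := fun x => (g x - μ) / M with hh
  have hh1 : ∀ x, |h x| ≤ 1 := by
    intro x
    rw [hh, abs_div, abs_of_pos hM, div_le_one hM, abs_le]
    constructor <;> linarith [hg0 x, hg1 x]
  have hh0 : ∑ x, h x = 0 := by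
    rw [hh, ← Finset.sum_div, Finset.sum_sub_distrib]
    simp only [Finset.sum_const, Finset.card_univ, nsmul_eq_mul, hμ]
    field_simp
    simp
  have key : ∀ w : Fin m → Ω, ∑ j, g (w j) - m * μ = M * ∑ j, h (w j) := by
    intro w
    rw [Finset.mul_sum]
    simp only [hh]
    rw [Finset.sum_congr rfl fun j _ => mul_div_cancel₀ (g (w j) - μ) hM.ne',
      Finset.sum_sub_distrib]
    simp
  have h1 := card_sum_ge_le hh1 hh0 m hη hη'
  have h2 := card_sum_ge_le (h := fun x => -h x) (by simpa using hh1) (by simp [hh0]) m hη hη'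
  have hsub : (Finset.univ.filter fun w : Fin m → Ω =>
      m * (η * M) < |∑ j, g (w j) - m * μ|) ⊆
      (Finset.univ.filter fun w : Fin m → Ω => m * η ≤ ∑ j, h (w j)) ∪
      (Finset.univ.filter fun w : Fin m → Ω => m * η ≤ ∑ j, -h (w j)) := by
    intro w hw
    simp only [Finset.mem_filter, Finset.mem_univ, true_and, Finset.mem_union, key,
      Finset.sum_neg_distrib] at hw ⊢
    rw [abs_mul, abs_of_pos hM] at hw
    have : m * η < |∑ j, h (w j)| := by nlinarith
    rcases lt_abs.1 this with h3 | h3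
    · exact .inl h3.le
    · exact .inr h3.le
  calc _ ≤ (((Finset.univ.filter fun w : Fin m → Ω => m * η ≤ ∑ j, h (w j)) ∪
      (Finset.univ.filter fun w : Fin m → Ω => m * η ≤ ∑ j, -h (w j))).card : ℝ) := by
        exact_mod_cast Finset.card_le_card hsub
    _ ≤ _ := by
      refine (Nat.cast_le.2 (Finset.card_union_le _ _)).trans ?_
      push_cast
      linarith

/-! ### Submodular functions -/

theorem IsSubmodular.marginal_le {α : Type*} [DecidableEq α] {f : Finset α → ℝ}
    (hsub : IsSubmodular f) (hmono : Monotone f) {S S' : Finset α} (h : S ⊆ S') (x : α) :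
    f (insert x S') - f S' ≤ f (insert x S) - f S := by
  have h1 := hsub (insert x S) S'
  have h2 : insert x S ∪ S' = insert x S' := by
    rw [Finset.insert_union, Finset.union_eq_right.2 h]
  have h3 : f S ≤ f (insert x S ∩ S') :=
    hmono (Finset.subset_inter (Finset.subset_insert _ _) h)
  rw [h2] at h1
  linarith

theorem IsSubmodular.union_image_sub_le_sum {α β : Type*} [DecidableEq α] [DecidableEq β]
    {f : Finset α → ℝ} (hsub : IsSubmodular f) (hmono : Monotone f) (S : Finset α) (o : β → α)
    (A : Finset β) :
    f (S ∪ A.image o) - f S ≤ ∑ s ∈ A, (f (insert (o s) S) - f S) := by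
  induction A using Finset.induction_on with
  | empty => simp
  | insert a A ha ih =>
    rw [Finset.sum_insert ha, Finset.image_insert, Finset.union_insert]
    have := hsub.marginal_le hmono (Finset.subset_union_left (s₁ := S) (s₂ := A.image o)) (o a)
    linarith

/-! ### Tables -/

/-- A table assigns to each slot and colour a set of elements. The empty set stands for an entry
that has not been chosen yet. -/
abbrev Table (n C : ℕ) : Type := Fin n → Fin C → Finset (Fin n)

namespace Table

variable {n C : ℕ}

/-- The set that a table yields for a colouring of the slots. -/
def select (T : Table n C) (w : Fin n → Fin C) : Finset (Fin n) :=
  Finset.univ.biUnion fun s => T s (w s)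

/-- The sum of the values of the sets that a table yields for all colourings of the slots. -/
def total (f : Finset (Fin n) → ℝ) (T : Table n C) : ℝ :=
  ∑ w : Fin n → Fin C, f (T.select w)

/-- Change one entry of a table to `{x}`. -/
def put (T : Table n C) (s : Fin n) (c : Fin C) (x : Fin n) : Table n C :=
  Function.update T s (Function.update (T s) c {x})

theorem mem_select {T : Table n C} {w : Fin n → Fin C} {x : Fin n} :
    x ∈ T.select w ↔ ∃ s, x ∈ T s (w s) := by
  simp [select]

theorem put_same (T : Table n C) (s : Fin n) (c : Fin C) (x : Fin n) : T.put s c x s c = {x} := by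
  simp [put]

theorem put_of_ne (T : Table n C) {s t : Fin n} {c d : Fin C} (x : Fin n)
    (h : t ≠ s ∨ d ≠ c) : T.put s c x t d = T t d := by
  unfold put
  by_cases hts : t = s
  · subst hts
    simp [h.resolve_left (by simp)]
  · simp [hts]

theorem select_put {T : Table n C} {s : Fin n} {c : Fin C} (hT : T s c = ∅) (x : Fin n)
    (w : Fin n → Fin C) :
    (T.put s c x).select w = if w s = c then insert x (T.select w) else T.select w := by
  ext y
  split_ifs with h
  · simp only [mem_select, Finset.mem_insert]
    constructor
    · rintro ⟨t, ht⟩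
      by_cases hts : t = s
      · subst hts
        rw [h, put_same] at ht
        exact .inl (Finset.mem_singleton.1 ht)
      · rw [put_of_ne _ _ (.inl hts)] at ht
        exact .inr ⟨t, ht⟩
    · rintro (rfl | ⟨t, ht⟩)
      · exact ⟨s, by simp [h, put_same]⟩
      · by_cases hts : t = s
        · subst hts
          simp [h, hT] at ht
        · exact ⟨t, by rwa [put_of_ne _ _ (.inl hts)]⟩
  · simp only [mem_select]
    refine exists_congr fun t => ?_
    rw [put_of_ne]
    by_contra! h'
    obtain ⟨rfl, h2⟩ := h'
    exact h h2

/-- Marginal values of the optimum with respect to all colourings can be compared with those with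
respect to the colourings in which the slot `s` has the colour `c`, since the entry there is still
empty. -/
theorem sum_marginal_le {f : Finset (Fin n) → ℝ} (hsub : IsSubmodular f) (hmono : Monotone f)
    {T : Table n C} {s : Fin n} {c : Fin C} (hT : T s c = ∅) (x : Fin n) :
    ∑ w : Fin n → Fin C, (f (insert x (T.select w)) - f (T.select w)) ≤
      C * ((T.put s c x).total f - T.total f) := by
  have h1 : (T.put s c x).total f - T.total f =
      ∑ w ∈ Finset.univ.filter fun w : Fin n → Fin C => w s = c,
        (f (insert x (T.select w)) - f (T.select w)) := by
    rw [total, total, ← Finset.sum_sub_distrib, Finset.sum_filter]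
    refine Finset.sum_congr rfl fun w _ => ?_
    rw [select_put hT]
    split_ifs <;> simp
  have h2 : ∀ a : Fin C, ∑ w ∈ Finset.univ.filter fun w : Fin n → Fin C => w s = a,
      (f (insert x (T.select w)) - f (T.select w)) ≤ (T.put s c x).total f - T.total f := by
    intro a
    rw [h1]
    calc _ ≤ ∑ w ∈ Finset.univ.filter fun w : Fin n → Fin C => w s = a,
          (f (insert x (T.select (Function.update w s c))) -
            f (T.select (Function.update w s c))) := by
          refine Finset.sum_le_sum fun w _ => hsub.marginal_le hmono (fun y hy => ?_) x
          obtain ⟨t, ht⟩ := mem_select.1 hy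
          by_cases hts : t = s
          · subst hts
            simp [hT] at ht
          · rw [Function.update_of_ne hts] at ht
            exact mem_select.2 ⟨t, ht⟩
      _ = _ := by
          refine Finset.sum_nbij' (fun w => Function.update w s c) (fun w => Function.update w s a)
            ?_ ?_ ?_ ?_ ?_
          · simp
          · simp
          · intro w hw
            simp only [Finset.mem_filter, Finset.mem_univ, true_and] at hw
            simp [← hw]
          · intro w hw
            simp only [Finset.mem_filter, Finset.mem_univ, true_and] at hw
            simp [← hw]
          · simp
  calc _ = ∑ a : Fin C, ∑ w ∈ Finset.univ.filter fun w : Fin n → Fin C => w s = a,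
      (f (insert x (T.select w)) - f (T.select w)) :=
        (Finset.sum_fiberwise _ _ _).symm
    _ ≤ ∑ _a : Fin C, ((T.put s c x).total f - T.total f) := Finset.sum_le_sum fun a _ => h2 a
    _ = _ := by simp [mul_sub]

/-- The tables that the greedy procedure builds: an entry for a slot in `B` has at most one
element, from the part of the slot; the other entries are empty. -/
structure Valid {q : ℕ} (part : Fin n → Fin q) (B : Finset (Fin n)) (T : Table n C) : Prop where
  card_le : ∀ s c, (T s c).card ≤ 1
  part_eq : ∀ s c, ∀ x ∈ T s c, part x = part s
  mem : ∀ s c, s ∉ B → T s c = ∅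

theorem Valid.put {q : ℕ} {part : Fin n → Fin q} {B : Finset (Fin n)} {T : Table n C}
    (h : T.Valid part B) {s : Fin n} (hs : s ∈ B) (c : Fin C) {x : Fin n} (hx : part x = part s) :
    (T.put s c x).Valid part B := by
  have key : ∀ t d, (t = s ∧ d = c) ∨ (T.put s c x) t d = T t d := by
    intro t d
    by_cases h' : t = s ∧ d = c
    · exact .inl h'
    · exact .inr (put_of_ne _ _ (by tauto))
  refine ⟨fun t d => ?_, fun t d y hy => ?_, fun t d ht => ?_⟩
  · rcases key t d with ⟨rfl, rfl⟩ | h1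
    · simp [put_same]
    · rw [h1]
      exact h.card_le t d
  · rcases key t d with ⟨rfl, rfl⟩ | h1
    · rw [put_same, Finset.mem_singleton] at hy
      rw [hy, hx]
    · rw [h1] at hy
      exact h.part_eq t d y hy
  · rcases key t d with ⟨rfl, rfl⟩ | h1
    · exact absurd hs ht
    · rw [h1]
      exact h.mem t d ht

theorem Valid.partIndep_select {q : ℕ} {part : Fin n → Fin q} {cap : Fin q → ℕ}
    {B : Finset (Fin n)} {T : Table n C} (h : T.Valid part B) (hB : PartIndep part cap B)
    (w : Fin n → Fin C) : PartIndep part cap (T.select w) := by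
  intro i
  refine le_trans ?_ (hB i)
  calc partCount part (T.select w) i
      ≤ ((B.filter fun s => part s = i).biUnion fun s => T s (w s)).card := by
        refine Finset.card_le_card fun x hx => ?_
        obtain ⟨h1, h2⟩ := Finset.mem_filter.1 hx
        obtain ⟨s, hs⟩ := mem_select.1 h1
        refine Finset.mem_biUnion.2 ⟨s, Finset.mem_filter.2 ⟨?_, ?_⟩, hs⟩
        · by_contra h3
          simp [h.mem s _ h3] at hs
        · rw [← h2, h.part_eq _ _ _ hs]
    _ ≤ (B.filter fun s => part s = i).card * 1 :=
        Finset.card_biUnion_le_card_mul _ _ _ fun s _ => h.card_le _ _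
    _ = partCount part B i := by rw [mul_one, partCount]

end Table

/-- A sample of `m` colourings is accurate if for all tables the average of the values over the
sample is within `η * M` of the average over all colourings. The values are truncated at `M`, since
a table that does not arise in the greedy procedure may yield sets of a larger value. -/
def Accurate {n C m : ℕ} (f : Finset (Fin n) → ℝ) (M η : ℝ) (w : Fin m → Fin n → Fin C) : Prop :=
  ∀ T : Table n C, |∑ j, min (f (T.select (w j))) M -
    m * ((∑ v : Fin n → Fin C, min (f (T.select v)) M) / Fintype.card (Fin n → Fin C))| ≤
      m * (η * M)

open Classical in
/-- Almost all samples are accurate: there are so few tables that the Chernoff bound can be applied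
to all of them at once. -/
theorem card_not_accurate_le {n C m : ℕ} [NeZero C] {f : Finset (Fin n) → ℝ} (hf : ∀ S, 0 ≤ f S)
    {M : ℝ} (hM : 0 ≤ M) {η : ℝ} (hη : 0 ≤ η) (hη' : η ≤ 2) :
    (((Finset.univ.filter fun w : Fin m → Fin n → Fin C => ¬ Accurate f M η w).card : ℕ) : ℝ) ≤
      2 ^ (n * C * n) * (2 * Real.exp (-(m * η ^ 2 / 4))) *
        (Fintype.card (Fin n → Fin C) : ℝ) ^ m := by
  have hsub : (Finset.univ.filter fun w : Fin m → Fin n → Fin C => ¬ Accurate f M η w) ⊆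
      (Finset.univ : Finset (Table n C)).biUnion fun T =>
        Finset.univ.filter fun w : Fin m → Fin n → Fin C => m * (η * M) <
          |∑ j, min (f (T.select (w j))) M -
            m * ((∑ v : Fin n → Fin C, min (f (T.select v)) M) /
              Fintype.card (Fin n → Fin C))| := by
    intro w hw
    simp only [Accurate, Finset.mem_filter, Finset.mem_univ, true_and, not_forall, not_le] at hw
    simpa using hw
  calc _ ≤ ((∑ T : Table n C, (Finset.univ.filter fun w : Fin m → Fin n → Fin C => m * (η * M) <
          |∑ j, min (f (T.select (w j))) M -
            m * ((∑ v : Fin n → Fin C, min (f (T.select v)) M) /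
              Fintype.card (Fin n → Fin C))|).card : ℕ) : ℝ) := by
        exact_mod_cast (Finset.card_le_card hsub).trans Finset.card_biUnion_le
    _ ≤ ∑ _T : Table n C, 2 * Real.exp (-(m * η ^ 2 / 4)) *
        (Fintype.card (Fin n → Fin C) : ℝ) ^ m := by
        rw [Nat.cast_sum]
        refine Finset.sum_le_sum fun T _ => ?_
        exact card_abs_sum_sub_gt_le (g := fun v => min (f (T.select v)) M) hM
          (fun v => le_min (hf _) hM) (fun v => min_le_right _ _) m hη hη'
    _ = _ := by
        rw [Finset.sum_const, nsmul_eq_mul, Finset.card_univ]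
        have : Fintype.card (Table n C) = 2 ^ (n * C * n) := by
          simp [Table, ← pow_mul]
        rw [this]
        push_cast
        ring

/-! ### The value of a greedy run -/

section

variable {n q C m : ℕ} {f : Finset (Fin n) → ℝ} {part : Fin n → Fin q} {cap : Fin q → ℕ}
  {B O : Finset (Fin n)} {M η : ℝ}

theorem Accurate.abs_sub_le {w : Fin m → Fin n → Fin C} (hacc : Accurate f M η w)
    (hB : PartIndep part cap B) (hM : ∀ S, PartIndep part cap S → f S ≤ M) {T : Table n C}
    (hT : T.Valid part B) :
    |∑ j, f (T.select (w j)) - m * (T.total f / Fintype.card (Fin n → Fin C))| ≤ m * (η * M) := by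
  have h : ∀ v, min (f (T.select v)) M = f (T.select v) :=
    fun v => min_eq_left (hM _ (hT.partIndep_select hB v))
  simpa [h, Table.total] using hacc T

/-- The state of the analysis of a greedy run: the sets `R j` are given by a table, whose entries
are empty where the run has not yet been. If the sample is accurate, then the value of the table is
at most `r ^ c * (f O - f {e}) + c * K` away from the optimum at the beginning of the round for
colour `c`, and during the round it grows at the rate given by the marginal values of the elements
`o s` of the optimum; here `r = C / (C + 1)`, and `K` bounds the estimation error in a round. -/
theorem GreedyRun.exists_table [NeZero C] (hm : 0 < m) (hsub : IsSubmodular f)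
    (hmono : Monotone f) (hB : PartIndep part cap B) (hM : ∀ S, PartIndep part cap S → f S ≤ M)
    (hM0 : 0 ≤ M) (hη : 0 ≤ η) {o : Fin n → Fin n} (ho : ∀ s ∈ B, part (o s) = part s)
    (hO : O ⊆ B.image o)
    {col : ℕ → Fin n → ℕ} {w : Fin m → Fin n → Fin C} (hcol : ∀ (j : Fin m) s, col j s = w j s)
    {s₀ : Fin n} (hs₀ : s₀ ∈ B) {e : Fin n} (he : part e = part s₀) {c i : ℕ}
    {R : ℕ → Finset (Fin n)} (hrun : GreedyRun f part B m col s₀ e c i R)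
    (hci : c < C ∨ c = C ∧ i = 0) :
    ∃ T : Table n C, T.Valid part B ∧
      (∀ s (d : Fin C), s ≠ s₀ → (c < d ∨ c = d ∧ i ≤ s) → T s d = ∅) ∧
      (∀ d, T s₀ d = {e}) ∧ (∀ j : Fin m, R j = T.select (w j)) ∧
      (e = o s₀ → Accurate f M η w → ∃ E : ℝ,
        Fintype.card (Fin n → Fin C) * f O - E ≤ Fintype.card (Fin n → Fin C) *
          (((C : ℝ) / (C + 1)) ^ c * (f O - f {e}) + c * (2 * n * (η * M))) ∧
        ∑ s ∈ B.filter fun s => s ≠ s₀ ∧ (s : ℕ) < i,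
          ((∑ v, (f (insert (o s) (T.select v)) - f (T.select v))) / C -
            2 * (η * M) * Fintype.card (Fin n → Fin C)) ≤ T.total f - E) := by
  set W : ℝ := (Fintype.card (Fin n → Fin C) : ℝ) with hW
  have hW0 : 0 < W := by
    rw [hW]
    exact_mod_cast Fintype.card_pos
  have hC0 : (0 : ℝ) < C := by exact_mod_cast Nat.pos_of_ne_zero (NeZero.ne C)
  have hm0 : (0 : ℝ) < m := by exact_mod_cast hm
  induction hrun with
  | init =>
    have hsel : ∀ v : Fin n → Fin C,
        Table.select (fun s _ => if s = s₀ then {e} else ∅) v = {e} := by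
      intro v
      ext x
      rw [Table.mem_select, Finset.mem_singleton]
      constructor
      · rintro ⟨s, hs⟩
        split_ifs at hs
        · simpa using hs
        · simp at hs
      · rintro rfl
        exact ⟨s₀, by simp⟩
    refine ⟨fun s _ => if s = s₀ then {e} else ∅, ⟨fun s d => ?_, fun s d x hx => ?_,
      fun s d hs => ?_⟩, fun s d hs _ => by simp [hs], by simp, fun j => ?_, fun _ _ => ?_⟩
    · split_ifs <;> simp
    · split_ifs at hx with h
      · rw [Finset.mem_singleton.1 hx, he, h]
      · simp at hx
    · rw [if_neg]
      rintro rfl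
      exact hs hs₀
    · exact (hsel _).symm
    · refine ⟨W * f {e}, by simp [mul_sub], ?_⟩
      simp [Table.total, hsel, hW]
  | @skip c R s hs _ ih =>
    obtain ⟨T, h1, h2, h3, h4, h5⟩ := ih (by omega)
    refine ⟨T, h1, fun t d ht htd => h2 t d ht (by omega), h3, h4, fun h6 h7 => ?_⟩
    obtain ⟨E, h8, h9⟩ := h5 h6 h7
    refine ⟨E, h8, le_of_eq_of_le (Finset.sum_congr ?_ fun _ _ => rfl) h9⟩
    ext t
    simp only [Finset.mem_filter, Nat.lt_succ_iff_lt_or_eq]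
    constructor
    · rintro ⟨h10, h11, h12 | h12⟩
      · exact ⟨h10, h11, h12⟩
      · obtain rfl : t = s := Fin.ext h12
        tauto
    · tauto
  | @step c R s hs hss₀ x hx hmax _ ih =>
    have hcC : c < C := by omega
    obtain ⟨T, h1, h2, h3, h4, h5⟩ := ih (by omega)
    set d : Fin C := ⟨c, hcC⟩ with hd
    have hTs : T s d = ∅ := h2 s d hss₀ (.inr ⟨rfl, le_rfl⟩)
    have hadd : ∀ (y : Fin n) (j : Fin m), addAt col c s y R j = (T.put s d y).select (w j) := by
      intro y j
      rw [Table.select_put hTs, addAt, hcol, h4]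
      simp [hd, Fin.ext_iff]
    refine ⟨T.put s d x, h1.put hs d hx, fun t d' ht htd => ?_, fun d' => ?_, hadd x,
      fun h6 h7 => ?_⟩
    · rw [Table.put_of_ne]
      · exact h2 t d' ht (by omega)
      · by_contra! h8
        rw [h8.1, h8.2] at htd
        simp [hd] at htd
    · rw [Table.put_of_ne _ _ (.inl hss₀.symm), h3]
    · obtain ⟨E, h8, h9⟩ := h5 h6 h7
      refine ⟨E, h8, ?_⟩
      -- The chosen element is at least as good as `o s`, up to the error of two estimates.
      have hest : (T.put s d (o s)).total f ≤ (T.put s d x).total f + 2 * (η * M) * W := by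
        have h10 := (abs_le.1 (h7.abs_sub_le hB hM (h1.put hs d hx))).2
        have h11 := (abs_le.1 (h7.abs_sub_le hB hM (h1.put hs d (ho s hs)))).1
        have h12 : ∑ j, f ((T.put s d (o s)).select (w j)) ≤
            ∑ j, f ((T.put s d x).select (w j)) := by
          have := hmax (o s) (ho s hs)
          rw [Finset.sum_range, Finset.sum_range] at this
          simpa only [hadd] using this
        rw [← hW] at h10 h11
        have h13 : m * ((T.put s d (o s)).total f / W) ≤
            m * ((T.put s d x).total f / W + 2 * (η * M)) := by linarith
        have h14 := le_of_mul_le_mul_left h13 hm0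
        rw [div_add' _ _ _ hW0.ne', div_le_div_iff_of_pos_right hW0] at h14
        exact h14
      have hmarg := Table.sum_marginal_le hsub hmono hTs (o s)
      have hfilter : (B.filter fun t => t ≠ s₀ ∧ (t : ℕ) < (s : ℕ) + 1) =
          insert s (B.filter fun t => t ≠ s₀ ∧ (t : ℕ) < s) := by
        ext t
        simp only [Finset.mem_filter, Finset.mem_insert, Nat.lt_succ_iff_lt_or_eq, Fin.ext_iff]
        constructor
        · tauto
        · rintro (h10 | h10)
          · obtain rfl : t = s := Fin.ext h10
            exact ⟨hs, by simpa [Fin.ext_iff] using hss₀, .inr rfl⟩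
          · tauto
      have hanti : ∀ t, (∑ v, (f (insert (o t) ((T.put s d x).select v)) -
          f ((T.put s d x).select v))) ≤
          ∑ v, (f (insert (o t) (T.select v)) - f (T.select v)) := by
        intro t
        refine Finset.sum_le_sum fun v _ => hsub.marginal_le hmono ?_ _
        rw [Table.select_put hTs]
        split_ifs
        · exact Finset.subset_insert _ _
        · exact subset_rfl
      rw [hfilter, Finset.sum_insert (by simp)]
      have h15 : ∑ t ∈ B.filter fun t => t ≠ s₀ ∧ (t : ℕ) < s,
          ((∑ v, (f (insert (o t) ((T.put s d x).select v)) - f ((T.put s d x).select v))) / C -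
            2 * (η * M) * W) ≤ T.total f - E := by
        refine le_trans (Finset.sum_le_sum fun t _ => ?_) h9
        have := hanti t
        gcongr
      have h16 : (∑ v, (f (insert (o s) ((T.put s d x).select v)) -
          f ((T.put s d x).select v))) / C ≤ (T.put s d (o s)).total f - T.total f := by
        rw [div_le_iff₀' hC0]
        exact (hanti s).trans hmarg
      linarith
  | @next c R _ ih =>
    have hcC : c < C := by omega
    obtain ⟨T, h1, h2, h3, h4, h5⟩ := ih (by omega)
    refine ⟨T, h1, fun t d ht htd => h2 t d ht (by omega), h3, h4, fun h6 h7 => ?_⟩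
    obtain ⟨E, h8, h9⟩ := h5 h6 h7
    refine ⟨T.total f, ?_, by simp⟩
    set A : Finset (Fin n) := B.filter fun s => s ≠ s₀ ∧ (s : ℕ) < n with hA
    have hAcard : (A.card : ℝ) ≤ n := by
      have := Finset.card_le_univ A
      rw [Fintype.card_fin] at this
      exact_mod_cast this
    have hgain : W * f O - T.total f ≤
        ∑ s ∈ A, ∑ v, (f (insert (o s) (T.select v)) - f (T.select v)) := by
      rw [Finset.sum_comm]
      have : W * f O - T.total f = ∑ v : Fin n → Fin C, (f O - f (T.select v)) := by
        rw [Finset.sum_sub_distrib]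
        simp [Table.total, hW]
      rw [this]
      refine Finset.sum_le_sum fun v _ => le_trans ?_
        (hsub.union_image_sub_le_sum hmono (T.select v) o A)
      refine sub_le_sub_right (hmono fun y hy => ?_) _
      obtain ⟨s, hs, rfl⟩ := Finset.mem_image.1 (hO hy)
      by_cases hss : s = s₀
      · refine Finset.mem_union_left _ (Table.mem_select.2 ⟨s₀, ?_⟩)
        rw [h3, h6, hss]
        exact Finset.mem_singleton_self _
      · exact Finset.mem_union_right _ (Finset.mem_image_of_mem _ (by simp [hA, hs, hss]))
    rw [Finset.sum_sub_distrib, ← Finset.sum_div, Finset.sum_const, nsmul_eq_mul] at h9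
    set K : ℝ := 2 * n * (η * M) with hK
    have hK0 : 0 ≤ K := by positivity
    have hAK : A.card * (2 * (η * M) * W) ≤ K * W := by
      have : A.card * (2 * (η * M) * W) ≤ n * (2 * (η * M) * W) := by gcongr
      linarith
    have h10 : (W * f O - T.total f) / C ≤
        (∑ s ∈ A, ∑ v, (f (insert (o s) (T.select v)) - f (T.select v))) / C := by gcongr
    set D : ℝ := W * f O - T.total f with hD
    set r : ℝ := (C : ℝ) / (C + 1) with hr
    have hr0 : 0 ≤ r := by positivity
    have hr1 : r ≤ 1 := by
      rw [hr, div_le_one (by positivity)]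
      linarith
    have h11 : D / C + D ≤ W * f O - E + K * W := by linarith
    have h12 : D = r * (D / C + D) := by
      rw [hr]
      field_simp
      ring
    have h13 : r * (D / C + D) ≤ r * (W * (r ^ c * (f O - f {e}) + c * K) + K * W) :=
      mul_le_mul_of_nonneg_left (by linarith) hr0
    have h14 : r * (c * K + K) ≤ 1 * (c * K + K) := by gcongr
    rw [h12]
    refine h13.trans ?_
    have h15 : r * (W * (r ^ c * (f O - f {e}) + c * K) + K * W) =
        W * (r ^ (c + 1) * (f O - f {e}) + r * (c * K + K)) := by ring
    rw [h15]
    push_cast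
    exact mul_le_mul_of_nonneg_left (by linarith) hW0.le

theorem GreedyRun.partIndep [NeZero C] (hm : 0 < m) (hsub : IsSubmodular f) (hmono : Monotone f)
    (hB : PartIndep part cap B) (hM : ∀ S, PartIndep part cap S → f S ≤ M) (hM0 : 0 ≤ M)
    {col : ℕ → Fin n → ℕ} {w : Fin m → Fin n → Fin C} (hcol : ∀ (j : Fin m) s, col j s = w j s)
    {s₀ : Fin n} (hs₀ : s₀ ∈ B) {e : Fin n} (he : part e = part s₀)
    {R : ℕ → Finset (Fin n)} (hrun : GreedyRun f part B m col s₀ e C 0 R) {j : ℕ} (hj : j < m) :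
    PartIndep part cap (R j) := by
  obtain ⟨T, h1, -, -, h2, -⟩ := hrun.exists_table (η := 0) (o := id) (O := ∅) hm hsub hmono hB hM
    hM0 le_rfl (fun _ _ => rfl) (by simp) hcol hs₀ he (.inr ⟨rfl, rfl⟩)
  rw [h2 ⟨j, hj⟩]
  exact h1.partIndep_select hB _

/-- The best set of a greedy run with the right guess, for an accurate sample. -/
theorem GreedyRun.sub_le [NeZero C] (hm : 0 < m) (hsub : IsSubmodular f) (hmono : Monotone f)
    (hB : PartIndep part cap B) (hM : ∀ S, PartIndep part cap S → f S ≤ M) (hM0 : 0 ≤ M)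
    (hη : 0 ≤ η) {o : Fin n → Fin n} (ho : ∀ s ∈ B, part (o s) = part s) (hO : O ⊆ B.image o)
    {col : ℕ → Fin n → ℕ} {w : Fin m → Fin n → Fin C} (hcol : ∀ (j : Fin m) s, col j s = w j s)
    (hacc : Accurate f M η w) {s₀ : Fin n} (hs₀ : s₀ ∈ B) {R : ℕ → Finset (Fin n)}
    (hrun : GreedyRun f part B m col s₀ (o s₀) C 0 R) {V : ℝ} (hV : ∀ j < m, f (R j) ≤ V) :
    f O - V ≤ ((C : ℝ) / (C + 1)) ^ C * (f O - f {o s₀}) + (2 * n * C + 1) * (η * M) := by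
  obtain ⟨T, h1, -, -, h2, h3⟩ := hrun.exists_table (η := η) (o := o) (O := O) hm hsub hmono hB hM
    hM0 hη ho hO hcol hs₀ (ho s₀ hs₀) (.inr ⟨rfl, rfl⟩)
  obtain ⟨E, h4, h5⟩ := h3 rfl hacc
  have h6 : 0 ≤ T.total f - E := by simpa using h5
  have h7 := (abs_le.1 (hacc.abs_sub_le hB hM h1)).1
  set W : ℝ := (Fintype.card (Fin n → Fin C) : ℝ) with hW
  have hW0 : 0 < W := by
    rw [hW]
    exact_mod_cast Fintype.card_pos
  have hm0 : (0 : ℝ) < m := by exact_mod_cast hm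
  have h8 : ∑ j : Fin m, f (T.select (w j)) ≤ m * V := by
    calc ∑ j : Fin m, f (T.select (w j)) ≤ ∑ _j : Fin m, V :=
          Finset.sum_le_sum fun j _ => h2 j ▸ hV j j.2
      _ = m * V := by simp
  have h9 : m * (T.total f / W) ≤ m * (V + η * M) := by linarith
  have h10 := le_of_mul_le_mul_left h9 hm0
  rw [div_le_iff₀ hW0] at h10
  have h11 : W * (f O - V - η * M) ≤
      W * (((C : ℝ) / (C + 1)) ^ C * (f O - f {o s₀}) + C * (2 * n * (η * M))) := by linarith
  have h12 := le_of_mul_le_mul_left h11 hW0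
  linarith

end

/-! ### Colours from random bits -/

theorem bitsVal_congr {g g' : ℕ → ℕ} {p b : ℕ} (h : ∀ t < b, g (p + t) = g' (p + t)) :
    bitsVal g p b = bitsVal g' p b := by
  induction b with
  | zero => rfl
  | succ b ih => rw [bitsVal, bitsVal, ih fun t ht => h t (by omega), h b (by omega)]

theorem bitsVal_lt {g : ℕ → ℕ} (hg : ∀ i, g i ≤ 1) (p b : ℕ) : bitsVal g p b < 2 ^ b := by
  induction b with
  | zero => simp [bitsVal]
  | succ b ih =>
    have := hg (p + b)
    rw [bitsVal, pow_succ]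
    omega

theorem eq_of_bitsVal_eq {g g' : ℕ → ℕ} (hg : ∀ i, g i ≤ 1) (hg' : ∀ i, g' i ≤ 1) {p b : ℕ}
    (h : bitsVal g p b = bitsVal g' p b) : ∀ t < b, g (p + t) = g' (p + t) := by
  induction b with
  | zero => simp
  | succ b ih =>
    intro t ht
    have h1 := hg (p + b)
    have h2 := hg' (p + b)
    rw [bitsVal, bitsVal] at h
    rcases Nat.lt_succ_iff_lt_or_eq.1 ht with h3 | rfl
    · exact ih (by omega) t h3
    · omega

/-- A word of bits as a function on the natural numbers, continued by zeros. -/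
def bitsFun {M : ℕ} (β : Fin M → Fin 2) (i : ℕ) : ℕ :=
  if h : i < M then β ⟨i, h⟩ else 0

theorem bitsFun_le_one {M : ℕ} (β : Fin M → Fin 2) (i : ℕ) : bitsFun β i ≤ 1 := by
  unfold bitsFun
  split_ifs with h
  · have := (β ⟨i, h⟩).2
    omega
  · omega

theorem bit_index_lt {m n b j s t : ℕ} (hj : j < m) (hs : s < n) (ht : t < b) :
    (j * n + s) * b + t < m * n * b := by
  have h1 : j * n + s + 1 ≤ m * n := by nlinarith
  calc (j * n + s) * b + t < (j * n + s) * b + b := by omega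
    _ = (j * n + s + 1) * b := by ring
    _ ≤ m * n * b := Nat.mul_le_mul_right _ h1

/-- The `m` colourings of `n` slots with `2 ^ b` colours which are encoded by a word of bits. -/
def colouring {m n b : ℕ} (β : Fin (m * n * b) → Fin 2) (j : Fin m) (s : Fin n) : Fin (2 ^ b) :=
  ⟨bitsVal (bitsFun β) ((j * n + s) * b) b, bitsVal_lt (bitsFun_le_one β) _ _⟩

/-- Distinct words of bits encode distinct samples, so uniform bits give a uniform sample. -/
theorem colouring_injective {m n b : ℕ} :
    Function.Injective (colouring : (Fin (m * n * b) → Fin 2) → Fin m → Fin n → Fin (2 ^ b)) := by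
  intro β β' h
  funext i
  have hi := i.2
  have hb : 0 < b := Nat.pos_of_ne_zero fun h0 => by simp [h0] at hi
  have hu : (i : ℕ) / b < m * n := Nat.div_lt_of_lt_mul (hi.trans_eq (mul_comm _ _))
  have hn : 0 < n := Nat.pos_of_ne_zero fun h0 => by simp [h0] at hu
  have hj : (i : ℕ) / b / n < m := Nat.div_lt_of_lt_mul (hu.trans_eq (mul_comm _ _))
  have h1 := congrArg Fin.val (congrFun (congrFun h ⟨_, hj⟩) ⟨(i : ℕ) / b % n, Nat.mod_lt _ hn⟩)
  have h2 := eq_of_bitsVal_eq (bitsFun_le_one β) (bitsFun_le_one β') h1 ((i : ℕ) % b)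
    (Nat.mod_lt _ hb)
  have h3 : ((i : ℕ) / b / n * n + (i : ℕ) / b % n) * b + (i : ℕ) % b = i := by
    rw [Nat.div_add_mod', Nat.div_add_mod']
  simp only [h3, bitsFun, hi, dif_pos] at h2
  exact Fin.ext h2

open Classical in
theorem card_colouring_not_accurate_le {m n b : ℕ} {f : Finset (Fin n) → ℝ} (hf : ∀ S, 0 ≤ f S)
    {M : ℝ} (hM : 0 ≤ M) {η : ℝ} (hη : 0 ≤ η) (hη' : η ≤ 2) :
    (((Finset.univ.filter fun β : Fin (m * n * b) → Fin 2 =>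
      ¬ Accurate f M η (colouring (m := m) (n := n) (b := b) β)).card : ℕ) : ℝ) ≤
      2 ^ (n * 2 ^ b * n) * (2 * Real.exp (-(m * η ^ 2 / 4))) * 2 ^ (m * n * b) := by
  have h1 := card_not_accurate_le (n := n) (C := 2 ^ b) (m := m) hf hM hη hη'
  have h2 : (Fintype.card (Fin n → Fin (2 ^ b)) : ℝ) ^ m = 2 ^ (m * n * b) := by
    simp only [Fintype.card_fun, Fintype.card_fin, Nat.cast_pow, Nat.cast_ofNat]
    rw [← pow_mul, ← pow_mul]
    congr 1
    ring
  rw [h2] at h1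
  refine le_trans ?_ h1
  rw [Nat.cast_le]
  refine Finset.card_le_card_of_injOn (colouring (m := m) (n := n) (b := b)) ?_
    colouring_injective.injOn
  intro β hβ
  simpa using hβ

/-! ### Bases of the partition matroid -/

section

variable {n q : ℕ} {part : Fin n → Fin q} {cap : Fin q → ℕ} {B S O : Finset (Fin n)}

theorem PartSpanning.partCount_le (hB : PartSpanning part cap B) (hO : PartIndep part cap O)
    (i : Fin q) : partCount part O i ≤ partCount part B i := by
  by_cases h : ∃ x, part x = i ∧ x ∉ B
  · obtain ⟨x, rfl, hx⟩ := h
    exact (hO _).trans ((hB x).resolve_left hx)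
  · push Not at h
    refine Finset.card_le_card fun x hx => ?_
    obtain ⟨-, h2⟩ := Finset.mem_filter.1 hx
    exact Finset.mem_filter.2 ⟨h x h2, h2⟩

/-- The slots can be matched with the elements of any independent set, within the parts. -/
theorem PartSpanning.exists_matching (hB : PartSpanning part cap B) (hO : PartIndep part cap O) :
    ∃ o : Fin n → Fin n, (∀ s ∈ B, part (o s) = part s) ∧ O ⊆ B.image o := by
  classical
  have h : ∀ i, ∃ φ : {x // x ∈ O.filter fun x => part x = i} →
      {x // x ∈ B.filter fun x => part x = i}, Function.Injective φ := by
    intro i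
    have : Fintype.card {x // x ∈ O.filter fun x => part x = i} ≤
        Fintype.card {x // x ∈ B.filter fun x => part x = i} := by
      rw [Fintype.card_coe, Fintype.card_coe]
      exact hB.partCount_le hO i
    obtain ⟨φ⟩ := Function.Embedding.nonempty_of_card_le this
    exact ⟨φ, φ.injective⟩
  choose φ hφ using h
  let ψ : Fin n → Fin n := fun x =>
    if hx : x ∈ O.filter fun y => part y = part x then φ (part x) ⟨x, hx⟩ else x
  have hψ : ∀ x ∈ O, ψ x ∈ B ∧ part (ψ x) = part x := by
    intro x hx
    have hx' : x ∈ O.filter fun y => part y = part x := Finset.mem_filter.2 ⟨hx, rfl⟩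
    simp only [ψ, dif_pos hx']
    exact Finset.mem_filter.1 (φ (part x) ⟨x, hx'⟩).2
  have hinj : ∀ x ∈ O, ∀ y ∈ O, ψ x = ψ y → x = y := by
    intro x hx y hy hxy
    have hp : part x = part y := by rw [← (hψ x hx).2, hxy, (hψ y hy).2]
    have hx' : x ∈ O.filter fun z => part z = part x := Finset.mem_filter.2 ⟨hx, rfl⟩
    have hy' : y ∈ O.filter fun z => part z = part y := Finset.mem_filter.2 ⟨hy, rfl⟩
    simp only [ψ, dif_pos hx', dif_pos hy'] at hxy
    have key : ∀ i j (a : {x // x ∈ O.filter fun x => part x = i})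
        (b : {x // x ∈ O.filter fun x => part x = j}), i = j →
        (φ i a : Fin n) = φ j b → (a : Fin n) = b := by
      rintro i j a b rfl h
      exact congrArg Subtype.val (hφ i (Subtype.ext h))
    exact key _ _ _ _ hp hxy
  refine ⟨fun s => if h : ∃ x ∈ O, ψ x = s then h.choose else s, fun s _ => ?_, fun x hx => ?_⟩
  · simp only
    split_ifs with h
    · have h1 := h.choose_spec
      rw [← (hψ _ h1.1).2, h1.2]
    · rfl
  · refine Finset.mem_image.2 ⟨ψ x, (hψ x hx).1, ?_⟩
    have h : ∃ y ∈ O, ψ y = ψ x := ⟨x, hx, rfl⟩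
    simp only [dif_pos h]
    exact hinj _ h.choose_spec.1 _ hx h.choose_spec.2

theorem PartSpanning.card_le (hB : PartSpanning part cap B) (hO : PartIndep part cap O) :
    O.card ≤ B.card := by
  obtain ⟨o, -, h⟩ := hB.exists_matching hO
  exact (Finset.card_le_card h).trans Finset.card_image_le

theorem partitionMatroid_indep_coe_iff :
    (partitionMatroid part cap).Indep (O : Set (Fin n)) ↔ PartIndep part cap O := by
  rw [partitionMatroid_indep_iff]
  refine forall_congr' fun i => ?_
  rw [partCount, ← Set.ncard_coe_finset]
  have : ((O.filter fun x => part x = i : Finset (Fin n)) : Set (Fin n)) =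
      (O : Set (Fin n)) ∩ part ⁻¹' {i} := by
    ext x
    simp
  rw [this]

theorem eRank_partitionMatroid_eq (hB : PartIndep part cap B) (hB' : PartSpanning part cap B) :
    (partitionMatroid part cap).eRank = B.card := by
  classical
  refine le_antisymm ?_ ?_
  · obtain ⟨D, hD⟩ := (partitionMatroid part cap).exists_isBase
    rw [← hD.encard_eq_eRank]
    have h := hD.indep
    rw [← Set.coe_toFinset D] at h ⊢
    rw [Set.encard_coe_eq_coe_finsetCard]
    exact_mod_cast hB'.card_le (partitionMatroid_indep_coe_iff.1 h)
  · rw [← Set.encard_coe_eq_coe_finsetCard]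
    exact (partitionMatroid_indep_coe_iff.2 hB).encard_le_eRank

theorem eRk_partitionMatroid_eq (hB : PartIndep part cap B) (hB' : PartSpanning part cap B)
    (h : B ⊆ S) : (partitionMatroid part cap).eRk (S : Set (Fin n)) =
      (partitionMatroid part cap).eRank := by
  refine le_antisymm (Matroid.eRk_le_eRank _ _) ?_
  rw [eRank_partitionMatroid_eq hB hB', ← Set.encard_coe_eq_coe_finsetCard]
  exact (partitionMatroid_indep_coe_iff.2 hB).encard_le_eRk_of_subset (by exact_mod_cast h)

end

/-! ### The size and the value of a greedy chain -/

section

variable {α : Type*} [DecidableEq α] {f : Finset α → ℝ} {S₁ S O : Finset α} {τ : ℕ}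

theorem GreedyChain.subset (h : GreedyChain f S₁ τ S) : S₁ ⊆ S := by
  induction h with
  | zero => exact subset_rfl
  | step x _ _ ih => exact ih.trans (Finset.subset_insert _ _)

theorem GreedyChain.card_le (h : GreedyChain f S₁ τ S) : S.card ≤ S₁.card + τ := by
  induction h with
  | zero => simp
  | step x _ _ ih => exact (Finset.card_insert_le _ _).trans (by omega)

/-- Every greedy step reduces the distance to the optimum by the factor `1 - 1 / k`, by the analysis
of Nemhauser, Wolsey and Fisher. -/
theorem GreedyChain.sub_le (hsub : IsSubmodular f) (hmono : Monotone f) {k : ℕ} (hk : 0 < k)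
    (hO : O.card ≤ k) (h : GreedyChain f S₁ τ S) :
    f O - f S ≤ (1 - 1 / (k : ℝ)) ^ τ * (f O - f S₁) := by
  have hk1 : (1 : ℝ) ≤ k := by exact_mod_cast hk
  have hk2 : 0 ≤ 1 - 1 / (k : ℝ) := by
    rw [sub_nonneg, div_le_one (by linarith)]
    exact hk1
  induction h with
  | zero => simp
  | @step τ S x hx _ ih =>
    have h1 := hsub.union_image_sub_le_sum hmono S id O
    have h2 : f O ≤ f (S ∪ O.image id) := hmono (by simp)
    have h3 : 0 ≤ f (insert x S) - f S := sub_nonneg.2 (hmono (Finset.subset_insert _ _))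
    have h4 : ∑ s ∈ O, (f (insert (id s) S) - f S) ≤ k * (f (insert x S) - f S) := by
      calc ∑ s ∈ O, (f (insert (id s) S) - f S) ≤ ∑ _s ∈ O, (f (insert x S) - f S) :=
            Finset.sum_le_sum fun s _ => sub_le_sub_right (hx s) _
        _ = O.card * (f (insert x S) - f S) := by simp [mul_sub]
        _ ≤ k * (f (insert x S) - f S) := by gcongr
    have h5 : (f O - f S) / k ≤ f (insert x S) - f S := by
      rw [div_le_iff₀' (by linarith)]
      linarith
    calc f O - f (insert x S) ≤ (1 - 1 / (k : ℝ)) * (f O - f S) := by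
          have : (1 - 1 / (k : ℝ)) * (f O - f S) = f O - f S - (f O - f S) / k := by ring
          linarith
      _ ≤ (1 - 1 / (k : ℝ)) * ((1 - 1 / (k : ℝ)) ^ τ * (f O - f S₁)) :=
          mul_le_mul_of_nonneg_left ih hk2
      _ = _ := by ring

end

/-! ### Estimates -/

theorem Real.one_sub_add_sq_div_three_le_exp_neg {x : ℝ} (hx0 : 0 ≤ x) (hx1 : x ≤ 1) :
    1 - x + x ^ 2 / 3 ≤ Real.exp (-x) := by
  have h1 := Real.exp_bound' hx0 hx1 (n := 3) (by norm_num)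
  norm_num [Finset.sum_range_succ, Nat.factorial] at h1
  have h2 : 0 ≤ 1 - x + x ^ 2 / 3 := by nlinarith
  have h3 : (1 - x + x ^ 2 / 3) * Real.exp x ≤ 1 := by
    refine (mul_le_mul_of_nonneg_left h1 h2).trans ?_
    have h4 : x ^ 3 ≤ x ^ 2 := pow_le_pow_of_le_one hx0 hx1 (by norm_num)
    have h5 : x ^ 5 ≤ x ^ 2 := pow_le_pow_of_le_one hx0 hx1 (by norm_num)
    have h6 : 0 ≤ x ^ 4 := by positivity
    have h7 : 0 ≤ x ^ 2 := by positivity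
    nlinarith
  rw [Real.exp_neg]
  rwa [← one_div, le_div_iff₀ (Real.exp_pos x)]

theorem div_add_one_pow_le {C : ℕ} (hC : 0 < C) :
    ((C : ℝ) / (C + 1)) ^ C ≤ Real.exp (-1) * (1 + 1 / C) := by
  have hC0 : (0 : ℝ) < C := by exact_mod_cast hC
  have h1 : (C : ℝ) / (C + 1) ≤ Real.exp (-(1 / ((C : ℝ) + 1))) := by
    have := Real.one_sub_le_exp_neg (1 / ((C : ℝ) + 1))
    refine le_trans (le_of_eq ?_) this
    field_simp
    ring
  have h2 : Real.exp (1 / ((C : ℝ) + 1)) ≤ 1 + 1 / C := by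
    have h3 : Real.exp (1 / ((C : ℝ) + 1)) * ((C : ℝ) / (C + 1)) ≤ 1 := by
      refine (mul_le_mul_of_nonneg_left h1 (Real.exp_pos _).le).trans ?_
      rw [← Real.exp_add]
      simp
    have h4 : Real.exp (1 / ((C : ℝ) + 1)) ≤ 1 / ((C : ℝ) / (C + 1)) := by
      rwa [le_div_iff₀ (by positivity)]
    refine h4.trans (le_of_eq ?_)
    field_simp
  calc ((C : ℝ) / (C + 1)) ^ C ≤ Real.exp (-(1 / ((C : ℝ) + 1))) ^ C := by gcongr
    _ = Real.exp (-1) * Real.exp (1 / ((C : ℝ) + 1)) := by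
      rw [← Real.exp_nat_mul, ← Real.exp_add]
      congr 1
      field_simp
      ring
    _ ≤ _ := by gcongr

/-- The slack gained by guessing one element makes up for the error terms: `1 - 1 / k` is smaller
than `exp (-1 / k)` by at least `1 / (3 * k ^ 2)`. With more than `6 * n ^ 2` colours, half of this
covers the factor `1 + 1 / C` by which `(C / (C + 1)) ^ C` can exceed `exp (-1)`, and with the
accuracy `1 / (450 * n ^ 5)` the other half covers the errors of all estimates. -/
theorem greedy_factor_le {n k C : ℕ} (hk : 0 < k) (hkn : k ≤ n) (hC : 6 * n * n < C)
    (hC' : C ≤ 12 * n * n) :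
    ((C : ℝ) / (C + 1)) ^ C * (1 - 1 / k) + (2 * n * C + 1) * (1 / (450 * (n : ℝ) ^ 5)) ≤
      Real.exp (-1) * Real.exp (-(1 / (k : ℝ))) := by
  have hk1 : (1 : ℝ) ≤ k := by exact_mod_cast hk
  have hkn' : (k : ℝ) ≤ n := by exact_mod_cast hkn
  have hn1 : (1 : ℝ) ≤ n := hk1.trans hkn'
  have hC1 : 6 * (n : ℝ) ^ 2 ≤ C := by
    have : 6 * n * n ≤ C := hC.le
    have h : ((6 * n * n : ℕ) : ℝ) ≤ C := by exact_mod_cast this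
    push_cast at h
    linarith
  have hC2 : (C : ℝ) ≤ 12 * (n : ℝ) ^ 2 := by
    have h : ((C : ℕ) : ℝ) ≤ ((12 * n * n : ℕ) : ℝ) := by exact_mod_cast hC'
    push_cast at h
    linarith
  have hx1 : 1 / (k : ℝ) ≤ 1 := by
    rw [div_le_one (by linarith)]
    exact hk1
  have hexp := Real.one_sub_add_sq_div_three_le_exp_neg (by positivity) hx1
  have hsq : 1 / (6 * (n : ℝ) ^ 2) ≤ (1 / (k : ℝ)) ^ 2 / 6 := by
    rw [div_pow, one_pow, div_div]
    apply one_div_le_one_div_of_le (by positivity)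
    have : (k : ℝ) ^ 2 ≤ (n : ℝ) ^ 2 := by gcongr
    linarith
  have he : (1 : ℝ) / 3 ≤ Real.exp (-1) := by
    rw [Real.exp_neg, ← one_div]
    apply one_div_le_one_div_of_le (Real.exp_pos _)
    linarith [Real.exp_one_lt_d9]
  have h1 : ((C : ℝ) / (C + 1)) ^ C * (1 - 1 / k) ≤
      Real.exp (-1) * (1 - 1 / k + (1 / (k : ℝ)) ^ 2 / 6) := by
    calc ((C : ℝ) / (C + 1)) ^ C * (1 - 1 / k)
        ≤ (Real.exp (-1) * (1 + 1 / C)) * (1 - 1 / k) := by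
          gcongr
          exact div_add_one_pow_le (by omega)
      _ = Real.exp (-1) * (1 - 1 / k + 1 / C * (1 - 1 / k)) := by ring
      _ ≤ _ := by
          gcongr
          have h2 : (1 : ℝ) / C ≤ 1 / (6 * (n : ℝ) ^ 2) :=
            one_div_le_one_div_of_le (by positivity) hC1
          have h3 : (0 : ℝ) ≤ 1 / C := by positivity
          have h4 : (0 : ℝ) ≤ 1 / k := by positivity
          nlinarith
  have h2 : (2 * n * C + 1) * (1 / (450 * (n : ℝ) ^ 5)) ≤
      Real.exp (-1) * ((1 / (k : ℝ)) ^ 2 / 6) := by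
    have h3 : 2 * (n : ℝ) * C + 1 ≤ 25 * (n : ℝ) ^ 3 := by
      have h4 : (1 : ℝ) ≤ (n : ℝ) ^ 3 := one_le_pow₀ hn1
      have h5 : 2 * (n : ℝ) * C ≤ 2 * n * (12 * (n : ℝ) ^ 2) := by gcongr
      nlinarith
    calc (2 * n * C + 1) * (1 / (450 * (n : ℝ) ^ 5))
        ≤ 25 * (n : ℝ) ^ 3 * (1 / (450 * (n : ℝ) ^ 5)) := by gcongr
      _ = 1 / 3 * (1 / (6 * (n : ℝ) ^ 2)) := by
        field_simp
        norm_num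
      _ ≤ _ := by gcongr
  calc _ ≤ Real.exp (-1) * (1 - 1 / k + (1 / (k : ℝ)) ^ 2 / 3) := by linarith
    _ ≤ _ := by gcongr

/-- The number of samples suffices for the union bound: it makes the exponent in the Chernoff bound
equal to `(c + 13) * n ^ 4`, and the number of tables is at most `2 ^ (12 * n ^ 4)`. -/
theorem failure_bound {n c C m : ℕ} (hn : 0 < n) (hC : C ≤ 12 * n * n)
    (hm : m = 810000 * (c + 13) * n ^ 14) :
    (2 : ℝ) ^ (n * C * n) * (2 * Real.exp (-(m * (1 / (450 * (n : ℝ) ^ 5)) ^ 2 / 4))) *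
      ((n : ℝ) + 1) ^ c ≤ 1 := by
  have hn1 : (1 : ℝ) ≤ n := by exact_mod_cast hn
  have h2 : (2 : ℝ) ≤ Real.exp 1 := by linarith [Real.exp_one_gt_d9]
  have h3 : (n : ℝ) + 1 ≤ Real.exp n := Real.add_one_le_exp _
  have hexp : (m : ℝ) * (1 / (450 * (n : ℝ) ^ 5)) ^ 2 / 4 = (c + 13) * (n : ℝ) ^ 4 := by
    rw [hm]
    push_cast
    field_simp
    norm_num
  rw [hexp]
  calc (2 : ℝ) ^ (n * C * n) * (2 * Real.exp (-((c + 13) * (n : ℝ) ^ 4))) * ((n : ℝ) + 1) ^ c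
      ≤ Real.exp 1 ^ (n * C * n) * (Real.exp 1 * Real.exp (-((c + 13) * (n : ℝ) ^ 4))) *
        Real.exp n ^ c := by gcongr
    _ = Real.exp ((n * C * n : ℕ) + 1 - (c + 13) * (n : ℝ) ^ 4 + c * n) := by
      rw [← Real.exp_nat_mul, ← Real.exp_nat_mul, ← Real.exp_add, ← Real.exp_add, ← Real.exp_add]
      congr 1
      ring
    _ ≤ 1 := by
      rw [Real.exp_le_one_iff]
      have h4 : n * C * n ≤ 12 * n ^ 4 := by
        calc n * C * n ≤ n * (12 * n * n) * n := by gcongr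
          _ = 12 * n ^ 4 := by ring
      have h5 : ((n * C * n : ℕ) : ℝ) ≤ 12 * (n : ℝ) ^ 4 := by exact_mod_cast h4
      have h6 : (n : ℝ) ≤ (n : ℝ) ^ 4 := le_self_pow₀ hn1 (by norm_num)
      have h7 : (c : ℝ) * n ≤ c * (n : ℝ) ^ 4 := by gcongr
      nlinarith

/-! ### The algorithm -/

namespace OracleRAM

/-- The whole algorithm; the number of samples is `A * n ^ 14`. -/
def algorithm (A : ℕ) : Prog :=
  .seq (.seq (fill 5) (setParameters A))
  (.seq flipBits (.seq decodeColours (.seq allGuesses finish)))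

section

variable {n q : ℕ} {part : Fin n → Fin q} {cap : Fin q → ℕ} {f : Finset (Fin n) → ℝ} {N : ℕ}
  {γ : ℝ}

/-- What the final state of a run guarantees, depending on the random bits `β`. -/
def RunSpec (part : Fin n → Fin q) (cap : Fin q → ℕ) (f : Finset (Fin n) → ℝ) (γ : ℝ)
    (B : Finset (Fin n)) {m b : ℕ} (β : Fin (m * n * b) → Fin 2) (t : State) : Prop :=
  ∃ S₀ S₁ : Finset (Fin n), S₀ ⊆ S₁ ∧ PartIndep part cap S₁ ∧ PartSpanning part cap S₁ ∧
    ((n ≤ γ * B.card ∧ output n t = Finset.univ) ∨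
      ∃ τ : ℕ, B.card + τ ≤ γ * B.card ∧ γ * B.card < B.card + τ + 1 ∧
        GreedyChain f S₁ τ (output n t)) ∧
    ∀ s₀ ∈ B, ∀ e, part e = part s₀ → ∃ R, GreedyRun f part B m
      (fun j s => bitsVal (bitsFun β) ((j * n + s) * b) b) s₀ e (2 ^ b) 0 R ∧
        ∀ j < m, f (R j) ≤ f S₀

theorem env_initState : Env part cap (initState part cap γ) where
  size := by simp [initState]
  part x := by simp [initState]
  cap i := by simp [initState]

/-- The algorithm is a deterministic function of the word of random bits. -/
theorem exec_algorithm (hf : ∀ S, 0 ≤ f S) (hsub : IsSubmodular f) (hmono : Monotone f)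
    (hγ : 1 ≤ γ) {A m : ℕ} (hm : m = A * n ^ 14) (hN : n ≤ N) (hN14 : 14 ≤ N) (hN2 : 12 * n * n ≤ N)
    (hNm : m ≤ N) (hNM : m * n * (6 * n * n) ≤ N) :
    ∃ (B : Finset (Fin n)) (b : ℕ) (H : (Fin (m * n * b) → Fin 2) → State),
      PartIndep part cap B ∧ PartSpanning part cap B ∧ 6 * n * n < 2 ^ b ∧
      (2 ^ b ≤ 2 * (6 * n * n) ∨ b = 0) ∧
      (algorithm A).exec f (initState part cap γ) = (PMF.uniformOfFintype _).map H ∧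
      ∀ β, (H β).time ≤ (algorithm A).cost N ∧ RunSpec part cap f γ B β (H β) := by
  have hN6 : 6 * n * n ≤ N := by
    refine le_trans ?_ hN2
    gcongr
    norm_num
  set s : State := initState part cap γ with hs
  have hE : Env part cap s := env_initState
  -- the deterministic part before the bits are drawn
  have hpre : WP f N (.seq (fill 5) (setParameters A)) (fun t => ∃ (B : Finset (Fin n)) (b : ℕ),
      t.toFinset n 5 = B ∧ PartIndep part cap B ∧ PartSpanning part cap B ∧
      t.mem 10 0 = m ∧ t.mem 12 0 = 2 ^ b ∧ t.mem 13 0 = b ∧ t.mem 14 0 = m * n * b ∧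
      b ≤ 6 * n * n ∧ 6 * n * n < 2 ^ b ∧ (2 ^ b ≤ 2 * (6 * n * n) ∨ b = 0)) s := by
    have h5 : s.toFinset n 5 = ∅ := by
      ext x
      simp [State.mem_toFinset, hs, initState]
    refine WP.seq (WP.fill hE hN (by simp) (by simp) h5 (fun i => by simp [partCount])
      fun t hF B h1 _ h2 h3 => ?_)
    refine WP.setParameters (hE.frame hF rfl rfl rfl) hN hN14 hN6
      fun u hFu b g1 g2 g3 g4 g5 g6 g7 => ⟨B, b, ?_, h2, h3, hm ▸ g1, g2, g3, hm ▸ g4, g5, g6, g7⟩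
    rw [← h1]
    exact State.toFinset_congr_mem (hFu.mem 5 rfl)
  obtain ⟨s1, hs1, ht1, B, b, hB, hBI, hBS, h10, h12, h13, h14, hb1, hb2, hb3⟩ := hpre
  have hF1 : Frame (.seq (fill 5) (setParameters A)) s s1 :=
    Frame.of_mem_support (f := f) (by simp [hs1])
  have hE1 : Env part cap s1 := hE.frame hF1 rfl rfl rfl
  have hbN : b ≤ N := hb1.trans hN6
  have hCN : 2 ^ b ≤ N := by
    rcases hb3 with h | h
    · refine h.trans (le_trans (le_of_eq ?_) hN2)
      ring
    · rw [h]
      omega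
  obtain ⟨G, hG, hG'⟩ := exec_flipBits f h14 ((Nat.mul_le_mul_left _ hb1).trans hNM)
  -- the deterministic part after the bits are drawn
  have hpost : ∀ β, WP f N (.seq decodeColours (.seq allGuesses finish))
      (RunSpec part cap f γ B β) (G β) := by
    intro β
    obtain ⟨-, hF2, hbits⟩ := hG' β
    have hE2 : Env part cap (G β) := hE1.frame hF2 rfl rfl rfl
    refine WP.seq (WP.decodeColours (m := m) (b := b) hE2 hN (by rw [hF2.mem 10 rfl, h10])
      (by rw [hF2.mem 13 rfl, h13]) hNm hbN fun s3 hF3 h3 => ?_)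
    have hE3 : Env part cap s3 := hE2.frame hF3 rfl rfl rfl
    set col : ℕ → Fin n → ℕ := fun j s => bitsVal (bitsFun β) ((j * n + s) * b) b with hcol
    have hC3 : Ctx part cap m (2 ^ b) col B s3 := by
      refine ⟨hE3, by rw [hF3.mem 10 rfl, hF2.mem 10 rfl, h10],
        by rw [hF3.mem 12 rfl, hF2.mem 12 rfl, h12], fun j hj x => ?_, ?_⟩
      · rw [h3 j hj x]
        refine bitsVal_congr fun t ht => ?_
        have hlt := bit_index_lt hj x.2 ht
        rw [bitsFun, dif_pos hlt]
        exact hbits ⟨_, hlt⟩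
      · rw [← hB]
        refine State.toFinset_congr_mem ?_
        rw [hF3.mem 5 rfl, hF2.mem 5 rfl]
    have h33 : s3.toFinset n 3 = ∅ := by
      ext x
      simp only [State.mem_toFinset]
      rw [hF3.mem 3 rfl, hF2.mem 3 rfl, hF1.mem 3 rfl]
      simp [hs, initState]
    have h34 : s3.rmem 4 0 = 0 := by
      rw [hF3.rmem 4 rfl, hF2.rmem 4 rfl, hF1.rmem 4 rfl]
      simp [hs, initState]
    refine WP.seq (WP.allGuesses hC3 hN hNm hCN hf h33 h34 (fun s₀ hs₀ e R he hrun j hj => ?_)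
      fun s4 hF4 h41 h42 h43 => ?_)
    · exact hrun.partIndep (w := colouring β) (by omega) hsub hmono hBI
        (fun S _ => hmono (Finset.subset_univ S)) (hf _) (fun _ _ => rfl) hs₀ he hj
    · refine WP.finish h42.env hN hf rfl h42.slots h41 ?_ hγ fun s5 hF5 S₁ g1 g2 g3 g4 =>
        ⟨s4.toFinset n 3, S₁, g1, g2, g3, g4, h43⟩
      rw [hF4.rmem 0 rfl, hF3.rmem 0 rfl, hF2.rmem 0 rfl, hF1.rmem 0 rfl]
      simp [hs, initState]
  choose H hH1 hH2 hH3 using hpost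
  refine ⟨B, b, H, hBI, hBS, hb2, hb3, ?_, fun β => ⟨?_, hH3 β⟩⟩
  · rw [algorithm, Prog.exec, hs1, PMF.pure_bind, Prog.exec, hG, PMF.bind_map,
      ← PMF.bind_pure_comp]
    congr 1
    funext β
    simp only [Function.comp_apply]
    exact hH1 β
  · have h0 : s.time = 0 := rfl
    have h1 := (hG' β).1
    have h2 := hH2 β
    simp only [algorithm, Prog.cost] at h1 h2 ht1 ⊢
    omega

theorem two_pow_le_of_or {n b : ℕ} (hn : 0 < n) (h : 2 ^ b ≤ 2 * (6 * n * n) ∨ b = 0) :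
    2 ^ b ≤ 12 * n * n := by
  rcases h with h | rfl
  · exact h.trans (le_of_eq (by ring))
  · have : 0 < n * n := Nat.mul_pos hn hn
    nlinarith

/-- For accurate samples the output is as good as claimed. -/
theorem RunSpec.le_output (hf : ∀ S, 0 ≤ f S) (hsub : IsSubmodular f) (hmono : Monotone f)
    (hγ : 1 ≤ γ) {B O : Finset (Fin n)} (hBI : PartIndep part cap B)
    (hBS : PartSpanning part cap B) (hO : PartIndep part cap O)
    (hmax : ∀ S, PartIndep part cap S → f S ≤ f O) {m b : ℕ} (hm : 0 < n → 0 < m)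
    (hb : 6 * n * n < 2 ^ b) (hb' : 2 ^ b ≤ 2 * (6 * n * n) ∨ b = 0)
    {β : Fin (m * n * b) → Fin 2}
    (hacc : Accurate f (f O) (1 / (450 * (n : ℝ) ^ 5)) (colouring (m := m) (n := n) (b := b) β))
    {t : State} (ht : RunSpec part cap f γ B β t) {F : Finset (Fin n)}
    (hF : PartIndep part cap F) :
    (1 - Real.exp (-γ)) * f F ≤ f (output n t) := by
  obtain ⟨S₀, S₁, h01, h1I, h1S, hout, hbest⟩ := ht
  have hγ0 : 0 ≤ 1 - Real.exp (-γ) := by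
    rw [sub_nonneg, Real.exp_le_one_iff]
    linarith
  have hγ1 : 1 - Real.exp (-γ) ≤ 1 := by linarith [Real.exp_pos (-γ)]
  have hle : (1 - Real.exp (-γ)) * f F ≤ f F := mul_le_of_le_one_left (hf F) hγ1
  rcases hout with ⟨-, hout⟩ | ⟨τ, -, hτ2, hchain⟩
  · rw [hout]
    exact hle.trans (hmono (Finset.subset_univ F))
  rcases B.eq_empty_or_nonempty with rfl | hBne
  · have hF0 : F = ∅ := by
      have := hBS.card_le hF
      simpa using this
    exact hle.trans (hF0 ▸ hmono (Finset.empty_subset _))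
  have hk : 0 < B.card := hBne.card_pos
  have hkn : B.card ≤ n := by simpa using Finset.card_le_univ B
  have hn : 0 < n := by omega
  have hbC : 2 ^ b ≤ 12 * n * n := two_pow_le_of_or hn hb'
  obtain ⟨o, ho, hOB⟩ := hBS.exists_matching hO
  -- the right guess: the slot whose partner in the optimum has the largest value
  obtain ⟨s₀, hs₀, hs₀max⟩ := Finset.exists_max_image B (fun s => f {o s}) hBne
  have hk0 : (0 : ℝ) < B.card := by exact_mod_cast hk
  have hguess : f O - f {o s₀} ≤ (1 - 1 / (B.card : ℝ)) * f O := by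
    have h1 := hsub.union_image_sub_le_sum hmono ∅ o B
    have h2 : f O ≤ f (∅ ∪ B.image o) := hmono (by simpa using hOB)
    have h3 : ∑ s ∈ B, (f (insert (o s) ∅) - f ∅) ≤ B.card * (f {o s₀} - f ∅) := by
      rw [← nsmul_eq_mul]
      exact Finset.sum_le_card_nsmul _ _ _ fun s hs => sub_le_sub_right (hs₀max s hs) _
    have h4 : f ∅ ≤ B.card * f ∅ := le_mul_of_one_le_left (hf _) (by exact_mod_cast hk)
    have h5 : f O / B.card ≤ f {o s₀} := by
      rw [div_le_iff₀' hk0]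
      linarith
    have h6 : (1 - 1 / (B.card : ℝ)) * f O = f O - f O / B.card := by ring
    linarith
  obtain ⟨R, hrun, hR⟩ := hbest s₀ hs₀ (o s₀) (ho s₀ hs₀)
  have hval := GreedyRun.sub_le (w := colouring β) (hm hn) hsub hmono hBI hmax (hf O)
    (by positivity) ho hOB (fun _ _ => rfl) hacc hs₀ hrun hR
  have hfac := greedy_factor_le hk hkn hb hbC
  set C : ℕ := 2 ^ b with hC
  have h1 : f O - f S₁ ≤ Real.exp (-1) * Real.exp (-(1 / (B.card : ℝ))) * f O := by
    have h2 : f S₀ ≤ f S₁ := hmono h01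
    have h3 : ((C : ℝ) / (C + 1)) ^ C * (f O - f {o s₀}) ≤
        ((C : ℝ) / (C + 1)) ^ C * ((1 - 1 / (B.card : ℝ)) * f O) := by gcongr
    have h4 := mul_le_mul_of_nonneg_right hfac (hf O)
    linarith
  have h2 := hchain.sub_le hsub hmono hk (hBS.card_le hO)
  have h3 : (1 - 1 / (B.card : ℝ)) ^ τ ≤ Real.exp (-(τ / (B.card : ℝ))) := by
    calc (1 - 1 / (B.card : ℝ)) ^ τ ≤ Real.exp (-(1 / (B.card : ℝ))) ^ τ := by
          have : 0 ≤ 1 - 1 / (B.card : ℝ) := by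
            rw [sub_nonneg, div_le_one hk0]
            exact_mod_cast hk
          gcongr
          exact Real.one_sub_le_exp_neg _
      _ = _ := by
          rw [← Real.exp_nat_mul]
          congr 1
          ring
  have h4 : f O - f (output n t) ≤ Real.exp (-γ) * f O := by
    have h0 : 0 ≤ (1 - 1 / (B.card : ℝ)) ^ τ := by
      apply pow_nonneg
      rw [sub_nonneg, div_le_one hk0]
      exact_mod_cast hk
    calc f O - f (output n t) ≤ (1 - 1 / (B.card : ℝ)) ^ τ * (f O - f S₁) := h2
      _ ≤ (1 - 1 / (B.card : ℝ)) ^ τ *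
          (Real.exp (-1) * Real.exp (-(1 / (B.card : ℝ))) * f O) := by gcongr
      _ ≤ Real.exp (-(τ / (B.card : ℝ))) *
          (Real.exp (-1) * Real.exp (-(1 / (B.card : ℝ))) * f O) := by
          have := hf O
          gcongr
      _ = Real.exp (-(τ / (B.card : ℝ)) + (-1 + -(1 / (B.card : ℝ)))) * f O := by
          rw [Real.exp_add, Real.exp_add]
          ring
      _ ≤ Real.exp (-γ) * f O := by
          refine mul_le_mul_of_nonneg_right (Real.exp_le_exp.2 ?_) (hf O)
          have h5 : γ ≤ (B.card + τ + 1) / B.card := by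
            rw [le_div_iff₀ hk0]
            exact hτ2.le
          have h6 : ((B.card : ℝ) + τ + 1) / B.card = 1 + τ / B.card + 1 / B.card := by
            field_simp
          linarith
  calc (1 - Real.exp (-γ)) * f F ≤ (1 - Real.exp (-γ)) * f O :=
        mul_le_mul_of_nonneg_left (hmax F hF) hγ0
    _ ≤ f (output n t) := by linarith

open Classical in
/-- A uniform random element of a finite type lies in a set with probability at least `1 - 1 / d`
if at most a fraction `1 / d` of all elements lies outside. -/
theorem one_sub_le_toOuterMeasure_uniform {α : Type*} [Fintype α] [Nonempty α] (p : α → Prop)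
    {d : ℕ}
    (h : (Finset.univ.filter fun x => ¬ p x).card * d ≤ Fintype.card α) :
    1 - 1 / (d : ℝ≥0∞) ≤ (PMF.uniformOfFintype α).toOuterMeasure {x | p x} := by
  rcases Nat.eq_zero_or_pos d with rfl | hd
  · simp
  have hcard : (Finset.univ.filter fun x => p x).card +
      (Finset.univ.filter fun x => ¬ p x).card = Fintype.card α :=
    Finset.card_filter_add_card_filter_not _
  have hα : (Fintype.card α : ℝ≥0∞) ≠ 0 := by exact_mod_cast Fintype.card_ne_zero
  have hα' : (Fintype.card α : ℝ≥0∞) ≠ ⊤ := ENNReal.natCast_ne_top _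
  rw [PMF.toOuterMeasure_uniformOfFintype_apply, tsub_le_iff_right]
  have h1 : Fintype.card {x | p x} = (Finset.univ.filter fun x => p x).card := by
    rw [← Fintype.card_subtype]
    rfl
  rw [h1]
  have h2 : (((Finset.univ.filter fun x => ¬ p x).card : ℕ) : ℝ≥0∞) / Fintype.card α ≤
      1 / (d : ℝ≥0∞) := by
    rw [ENNReal.le_div_iff_mul_le (.inl (by exact_mod_cast hd.ne')) (.inr (by simp)),
      mul_comm, ← mul_div_assoc]
    refine ENNReal.div_le_of_le_mul ?_
    rw [one_mul, mul_comm]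
    exact_mod_cast h
  calc (1 : ℝ≥0∞) = ((Finset.univ.filter fun x => p x).card : ℝ≥0∞) / Fintype.card α +
      ((Finset.univ.filter fun x => ¬ p x).card : ℝ≥0∞) / Fintype.card α := by
        rw [← ENNReal.add_div, ← Nat.cast_add, hcard, ENNReal.div_self hα hα']
    _ ≤ _ := by gcongr

end

open Classical in
/-- The fraction of words of bits that lead to an inaccurate sample. -/
theorem card_colouring_not_accurate_mul_le {n b c m : ℕ} {f : Finset (Fin n) → ℝ}
    (hf : ∀ S, 0 ≤ f S) {M : ℝ} (hM : 0 ≤ M) (hn : 0 < n) (hb : 2 ^ b ≤ 12 * n * n)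
    (hm : m = 810000 * (c + 13) * n ^ 14) :
    (Finset.univ.filter fun β : Fin (m * n * b) → Fin 2 =>
      ¬ Accurate f M (1 / (450 * (n : ℝ) ^ 5)) (colouring (m := m) (n := n) (b := b) β)).card *
        (n + 1) ^ c ≤ Fintype.card (Fin (m * n * b) → Fin 2) := by
  have hη2 : 1 / (450 * (n : ℝ) ^ 5) ≤ 2 := by
    have hn1 : (1 : ℝ) ≤ (n : ℝ) ^ 5 := one_le_pow₀ (by exact_mod_cast hn)
    rw [div_le_iff₀ (by positivity)]
    linarith
  have h2 := card_colouring_not_accurate_le (m := m) (n := n) (b := b) hf hM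
    (by positivity) hη2
  have h3 := failure_bound hn hb hm
  have h4 : (0 : ℝ) ≤ ((n : ℝ) + 1) ^ c := by positivity
  have h5 : (0 : ℝ) ≤ 2 ^ (m * n * b) := by positivity
  have h6 := mul_le_mul_of_nonneg_right h2 h4
  have h7 := mul_le_mul_of_nonneg_right h3 h5
  have h8 : ((Finset.univ.filter fun β : Fin (m * n * b) → Fin 2 =>
      ¬ Accurate f M (1 / (450 * (n : ℝ) ^ 5)) (colouring (m := m) (n := n) (b := b) β)).card : ℝ) *
        ((n : ℝ) + 1) ^ c ≤ 2 ^ (m * n * b) := by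
    linarith
  rw [Fintype.card_fun, Fintype.card_fin, Fintype.card_fin, ← Nat.cast_le (α := ℝ)]
  push_cast
  exact h8

end OracleRAM

theorem mainTheorem9 (c : ℕ) :
    ∃ (P : OracleRAM.Prog) (p : Polynomial ℕ),
      ∀ (n q : ℕ) (part : Fin n → Fin q) (cap : Fin q → ℕ) (k : ℕ),
        (partitionMatroid part cap).eRank = (k : ℕ∞) →
      ∀ f : Finset (Fin n) → ℝ, 0 ≤ f ∅ → Monotone f → IsSubmodular f →
      ∀ γ : ℝ, 1 ≤ γ →
        (∀ s ∈ (P.exec f (OracleRAM.initState part cap γ)).support,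
          s.time ≤ p.eval (n + q) ∧
          (partitionMatroid part cap).eRk (OracleRAM.output n s : Set (Fin n)) = (k : ℕ∞) ∧
          ((OracleRAM.output n s).card : ℝ) ≤ γ * k) ∧
        1 - 1 / ((n : ℝ≥0∞) + 1) ^ c ≤
          (P.exec f (OracleRAM.initState part cap γ)).toOuterMeasure
            {s | ∀ F : Finset (Fin n),
              (partitionMatroid part cap).Indep (F : Set (Fin n)) →
                (1 - Real.exp (-γ)) * f F ≤ f (OracleRAM.output n s)} := by
  classical
  obtain ⟨A, hA⟩ : ∃ A, A = 810000 * (c + 13) := ⟨_, rfl⟩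
  obtain ⟨p, hp⟩ := (OracleRAM.algorithm A).exists_polynomial_cost
  refine ⟨OracleRAM.algorithm A,
    p.comp (Polynomial.C (6 * A + 14) * (Polynomial.X + 1) ^ 17), ?_⟩
  intro n q part cap k hk f hf0 hmono hsub γ hγ
  have hf : ∀ S, 0 ≤ f S := fun S => hf0.trans (hmono (Finset.empty_subset S))
  set N : ℕ := (6 * A + 14) * (n + q + 1) ^ 17 with hN
  have hNeval : (p.comp (Polynomial.C (6 * A + 14) * (Polynomial.X + 1) ^ 17)).eval (n + q) =
      (OracleRAM.algorithm A).cost N := by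
    rw [Polynomial.eval_comp, ← hp]
    simp [hN]
  -- every loop bound is at most a monomial in `n` of degree at most `17` with coefficient at most
  -- `6 * A + 14`
  have hpow : ∀ a i : ℕ, a ≤ 6 * A + 14 → i ≤ 17 → a * n ^ i ≤ N := by
    intro a i ha hi
    calc a * n ^ i ≤ (6 * A + 14) * (n + q + 1) ^ i := by gcongr; omega
      _ ≤ N := by
        rw [hN]
        gcongr
        omega
  obtain ⟨m, hm⟩ : ∃ m, m = A * n ^ 14 := ⟨_, rfl⟩
  obtain ⟨B, b, H, hBI, hBS, hb, hb', hexec, hH⟩ :=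
    OracleRAM.exec_algorithm (part := part) (cap := cap) (f := f) (N := N) (γ := γ) (A := A)
      hf hsub hmono hγ hm
      ((by simp : n ≤ 1 * n ^ 1).trans (hpow 1 1 (by omega) (by omega)))
      ((by simp : 14 ≤ 14 * n ^ 0).trans (hpow 14 0 (by omega) (by omega)))
      ((le_of_eq (by ring) : 12 * n * n ≤ 12 * n ^ 2).trans (hpow 12 2 (by omega) (by omega)))
      (hm.trans_le (hpow A 14 (by omega) (by omega)))
      ((le_of_eq (by rw [hm]; ring) : m * n * (6 * n * n) ≤ (6 * A) * n ^ 17).trans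
        (hpow (6 * A) 17 (by omega) (by omega)))
  have hkB : k = B.card := by
    have := eRank_partitionMatroid_eq hBI hBS
    rw [hk] at this
    exact_mod_cast this
  refine ⟨fun s hs => ?_, ?_⟩
  · rw [hexec, PMF.support_map] at hs
    obtain ⟨β, -, rfl⟩ := hs
    obtain ⟨hT, S₀, S₁, -, h1I, h1S, hout, -⟩ := hH β
    refine ⟨hNeval ▸ hT, ?_, ?_⟩
    · rw [← hk]
      refine eRk_partitionMatroid_eq h1I h1S ?_
      rcases hout with ⟨-, hout⟩ | ⟨τ, -, -, hchain⟩
      · rw [hout]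
        exact Finset.subset_univ _
      · exact hchain.subset
    · rw [hkB]
      rcases hout with ⟨hn, hout⟩ | ⟨τ, hτ, -, hchain⟩
      · rw [hout]
        simpa using hn
      · refine le_trans ?_ hτ
        have h1 := hchain.card_le
        have h2 := hBS.card_le h1I
        exact_mod_cast h1.trans (Nat.add_le_add_right h2 τ)
  · obtain ⟨O, hO, hOmax⟩ := Finset.exists_max_image
      (Finset.univ.filter fun S : Finset (Fin n) => PartIndep part cap S) f
      ⟨∅, Finset.mem_filter.2 ⟨Finset.mem_univ _, fun i => by simp [partCount]⟩⟩
    have hOI : PartIndep part cap O := (Finset.mem_filter.1 hO).2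
    have hmax : ∀ S, PartIndep part cap S → f S ≤ f O := fun S hS => hOmax S (by simpa using hS)
    rcases Nat.eq_zero_or_pos n with rfl | hn
    -- for `n = 0` the required probability is `0`
    · simp
    have hbC : 2 ^ b ≤ 12 * n * n := OracleRAM.two_pow_le_of_or hn hb'
    have hm0 : 0 < m := by
      rw [hm]
      exact Nat.mul_pos (by omega) (pow_pos hn 14)
    have hprob := OracleRAM.one_sub_le_toOuterMeasure_uniform
      (fun β => Accurate f (f O) (1 / (450 * (n : ℝ) ^ 5))
        (colouring (m := m) (n := n) (b := b) β))
      (OracleRAM.card_colouring_not_accurate_mul_le hf (hf O) hn hbC (by rw [hm, hA]))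
    push_cast at hprob
    rw [hexec, PMF.toOuterMeasure_map_apply]
    refine hprob.trans ((PMF.uniformOfFintype _).toOuterMeasure.mono fun β hβ F hF => ?_)
    exact (hH β).2.le_output hf hsub hmono hγ hBI hBS hOI hmax (fun _ => hm0) hb hb' hβ
      (partitionMatroid_indep_coe_iff.1 hF)
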